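/- Let $\beta>0$, $0<d\le 1$, $\epsilon>0$, $\kappa>0$. For $m\ge 1$ put $a=m\beta/(2d)$ and let $B_\beta=B_\beta^{(m)}$ be the random real $m\times m$ lower bidiagonal matrix with independent entries $$(B_\beta)_{ii}\sim\chi_{2a-\beta(i-1)}\quad(1\le i\le m),\qquad (B_\beta)_{i+1,i}\sim\chi_{\beta(m-i)}\quad(1\le i\le m-1),$$ all other entries being zero, where $\chi_r$ is the distribution on $(0,\infty)$ with density $\frac{2^{1-r/2}}{\Gamma(r/2)}x^{r-1}e^{-x^2/2}$. Let $M_{\beta,d}=\frac{d}{\beta m}B_\beta B_\beta^t$ be the normalized $\beta$-Laguerre matrix and let $$s_{\beta,d}(z)=\frac1m\operatorname{tr}(M_{\beta,d}-z)^{-1}$$ be the Stieltjes transform of its empirical eigenvalue distribution. Let $\lambda_\pm=(1\pm\sqrt d)^2$ and let $$s_{MP,d}(z)=\int_{\lambda_-}^{\lambda_+}\frac{1}{x-z}\,\frac{\sqrt{(\lambda_+-x)(x-\lambda_-)}}{2\pi d\,x}\,dx$$ be the Stieltjes transform of the Marchenko–Pastur distribution with parameter $d$. Set $$D_{\epsilon,\kappa}=D_{\epsilon,\kappa}^{(m)}=\{z\in\mathbb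 C:\ \operatorname{Im}z>m^{-1+\epsilon},\ \lambda_-+\kappa<\operatorname{Re}z<\lambda_+-\kappa,\ |z|\le 4\}.$$ Then $\sup_{z\in D_{\epsilon,\kappa}}|s_{\beta,d}(z)-s_{MP,d}(z)|=o(1)$ with overwhelming probability; that is, for every $c>0$ and every $k\in\mathbb N$ there is a constant $C$ such that for all $m\ge1$ $$\mathbb P\Big(\sup_{z\in D_{\epsilon,\kappa}}|s_{\beta,d}(z)-s_{MP,d}(z)|>c\Big)\le C\,m^{-k}$$ (the supremum over the empty set being $0$). -/

import Mathlib

open MeasureTheory ProbabilityTheory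
open scoped ENNReal

noncomputable section

namespace BetaLaguerre

/-- The density `2^(1 - r/2) / Γ(r/2) * x^(r-1) * exp(-x²/2)`, `x > 0`, of the chi distribution with
`r` degrees of freedom (`r > 0` real); it vanishes for `x ≤ 0`. -/
def chiPDFReal (r x : ℝ) : ℝ :=
  if 0 < x then
    2 ^ (1 - r / 2) / Real.Gamma (r / 2) * x ^ (r - 1) * Real.exp (-(x ^ 2) / 2)
  else 0

/-- The chi distribution with `r` degrees of freedom. -/
def chiMeasure (r : ℝ) : Measure ℝ :=
  volume.withDensity fun x => ENNReal.ofReal (chiPDFReal r x)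

/-- `B` is a random `m × m` lower bidiagonal matrix with independent entries, whose diagonal is
distributed as `χ_{2a}, χ_{2a-β}, …, χ_{2a-β(m-1)}` and whose subdiagonal as
`χ_{β(m-1)}, …, χ_{2β}, χ_β` (rows and columns are numbered from `0`). The entries that are
identically zero may be included in the independence condition, being constants. -/
structure IsBidiagonalModel {Ω : Type*} [MeasurableSpace Ω] (P : Measure Ω) (β a : ℝ) {m : ℕ}
    (B : Ω → Matrix (Fin m) (Fin m) ℝ) : Prop where
  hasLaw_diag : ∀ i : Fin m,
    HasLaw (fun ω => B ω i i) (chiMeasure (2 * a - β * (i : ℕ))) P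
  hasLaw_subdiag : ∀ i j : Fin m, (i : ℕ) = j + 1 →
    HasLaw (fun ω => B ω i j) (chiMeasure (β * ((m : ℝ) - (i : ℕ)))) P
  eq_zero : ∀ i j : Fin m, i ≠ j → (i : ℕ) ≠ j + 1 → ∀ ω, B ω i j = 0
  indep : iIndepFun (fun (p : Fin m × Fin m) (ω : Ω) => B ω p.1 p.2) P

/-- The normalized matrix `M = d / (β m) • B Bᵗ`. -/
def laguerreMatrix (β d : ℝ) {m : ℕ} (B : Matrix (Fin m) (Fin m) ℝ) :
    Matrix (Fin m) (Fin m) ℝ :=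
  (d / (β * m)) • (B * B.transpose)

/-- The normalized trace of the resolvent, `m⁻¹ tr (M - z)⁻¹`, of a real `m × m` matrix; for
symmetric `M` this is the Stieltjes transform of the empirical eigenvalue distribution. -/
def stieltjes {m : ℕ} (M : Matrix (Fin m) (Fin m) ℝ) (z : ℂ) : ℂ :=
  (1 / (m : ℂ)) * Matrix.trace (M.map Complex.ofReal - z • (1 : Matrix (Fin m) (Fin m) ℂ))⁻¹

/-- The lower edge `λ₋ = (1 - √d)²`. -/
def lambdaMinus (d : ℝ) : ℝ := (1 - √d) ^ 2

/-- The upper edge `λ₊ = (1 + √d)²`. -/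
def lambdaPlus (d : ℝ) : ℝ := (1 + √d) ^ 2

/-- The Marchenko–Pastur density with parameter `d`, `0 < d ≤ 1`. -/
def rhoMP (d x : ℝ) : ℝ :=
  (Set.Icc (lambdaMinus d) (lambdaPlus d)).indicator
    (fun x => 1 / (2 * d * Real.pi * x) * √((lambdaPlus d - x) * (x - lambdaMinus d))) x

/-- The Marchenko–Pastur distribution with parameter `d`. -/
def marchenkoPastur (d : ℝ) : Measure ℝ :=
  volume.withDensity fun x => ENNReal.ofReal (rhoMP d x)

/-- The Stieltjes transform `∫ (x - z)⁻¹ dμ(x)` of the Marchenko–Pastur distribution `μ`. -/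
def stieltjesMP (d : ℝ) (z : ℂ) : ℂ :=
  resolventTransform (marchenkoPastur d) z

/-- The domain `D_{ε,κ}` (for given `d` and `m`). -/
def domain (d ε κ : ℝ) (m : ℕ) : Set ℂ :=
  {z | (m : ℝ) ^ (-1 + ε) < z.im ∧ lambdaMinus d + κ < z.re ∧ z.re < lambdaPlus d - κ ∧ ‖z‖ ≤ 4}

/-- The events `E m` hold with overwhelming probability: for each `k` there is a constant `C` with
`P (E m)ᶜ ≤ C m⁻ᵏ` for all `m ≥ 1`. -/
def WithOverwhelmingProbability {Ω : ℕ → Type*} [∀ m, MeasurableSpace (Ω m)]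
    (P : ∀ m, Measure (Ω m)) (E : ∀ m, Set (Ω m)) : Prop :=
  ∀ k : ℕ, ∃ C : ℝ, ∀ m : ℕ, 1 ≤ m → P m (E m)ᶜ ≤ ENNReal.ofReal (C / (m : ℝ) ^ k)

/-- `X m = o(1)` with overwhelming probability, for nonnegative (possibly infinite) `X m`: for every
`c > 0`, the event `{X m ≤ c}` holds with overwhelming probability. -/
def IsLittleOOneWOP {Ω : ℕ → Type*} [∀ m, MeasurableSpace (Ω m)]
    (P : ∀ m, Measure (Ω m)) (X : ∀ m, Ω m → ℝ≥0∞) : Prop :=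
  ∀ c : ℝ, 0 < c → WithOverwhelmingProbability P fun m => {ω | X m ω ≤ ENNReal.ofReal c}

end BetaLaguerre

end

/-!
# The local law for the β-Laguerre ensemble in the bulk

Let `G = (c B Bᵀ - z)⁻¹` with `c = d / (β m)`, let `B'` be `B` without its first row and column, and
let `u`, `g` be the upper left entries of the resolvents of `B` and `B'`. The proof has three parts.

*The trace is close to `m u`.* To a lower bidiagonal `B` belongs the isospectral flow
`B' = S B - B S̃`, where `S` is half the difference of the strictly lower and upper triangular parts
of `G` and `S̃` is the same for `c Bᵀ B`; it multiplies the entry `B i j` by a multiple of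
`G i i - G̃ j j`. This flow preserves `tr (B Bᵀ)` (`sum_sq_mul_flowRate`) and is divergence free in
the logarithms of the entries (`sum_mul_dflowRate`), and the sum of its logarithmic rates, weighted
by the parameters of the `χ` distributions, telescopes to a multiple of `X = tr G - m u`
(`sum_chiParam_mul_flowRate`). Integration by parts in the independent `χ` entries along the flow
therefore gives `(β / 2) E[F X] = E[∂F]` for every test function `F`, where `∂` is the derivative
along the flow (`IsBidiagonalModel.loop_equation`). The flow does not move the trace of any
resolvent of `c B Bᵀ`, and it moves the corner entry at speed at most `Im u / Im z`, by the Ward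
identity. So
`F = X ^ k X̄ ^ (k + 1)` yields `E ‖X‖ ^ (2k + 2) ≤ (2 / β) (2k + 1) (m / Im z) E[‖X‖ ^ (2k) Im u]`
(`IsBidiagonalModel.integral_norm_cornerDefect_pow_le`). The same holds for the minor `B'`, which
is again a bidiagonal model.

*The corner entry nearly solves the Marchenko–Pastur equation.* With `α = c (B 0 0)²` and
`γ = c (B 1 0)²`, the Schur complement formula is `z γ g u + (z - α) u + γ g + 1 = 0`
(`corner_equation`). Since the traces for `B` and `B'` differ by `O(1 / Im z)`, the distance
`u - g` is controlled by the two normalized defects and `1 / N`, where `N = m Im z`. For typical `α`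
and `γ` the equation then bounds `u` and `g` by the defects, so that the moment inequality improves
itself to the bound `O(N ^ (-(k + 1)))` for the moment of order `2k + 2` of the normalized defects,
up to the contribution of untypical `α` and `γ`
(`IsBidiagonalModel.integral_defectSum_pow_le_of_large`). Here `N ≥ m ^ ε`, and `k` is arbitrary.
As `α → 1` and `γ → d` with exponentially small error probabilities, `u` is an approximate solution
of `d z u² + (z + d - 1) u + 1 = 0`.

*Stability and uniformity.* In the coordinate `w` with `z = 1 + d + √d (w + w⁻¹)` and `‖w‖ < 1`, the
Marchenko–Pastur transform is `-w / (√d (1 + √d w))` (`stieltjesMP_eq`), and the other root of the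
quadratic equation is excluded with a margin in the bulk, because `Im (z u) ≥ 0`
(`norm_sub_stieltjesMP_le`). A union bound over a grid of spectral parameters, together with
the Lipschitz continuity of the defects in `z`, makes the estimate uniform in `z`.
-/

namespace BetaLaguerre

open Matrix

universe u

/-! ### Resolvents of real symmetric matrices -/

section Resolvent

variable {ι : Type*} [Fintype ι] [DecidableEq ι]

/-- The resolvent `(A - z)⁻¹` of a real square matrix `A` at a complex number `z`. -/
noncomputable def res (A : Matrix ι ι ℝ) (z : ℂ) : Matrix ι ι ℂ :=
  (A.map Complex.ofReal - z • (1 : Matrix ι ι ℂ))⁻¹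

theorem isUnit_det_sub_smul {A : Matrix ι ι ℝ} (hA : A.IsSymm) {z : ℂ} (hz : z.im ≠ 0) :
    IsUnit (A.map Complex.ofReal - z • (1 : Matrix ι ι ℂ)).det := by
  have hH : (A.map Complex.ofReal).IsHermitian := by
    ext i j
    simp [Matrix.conjTranspose_apply, hA.apply i j]
  rw [isUnit_iff_ne_zero]
  intro h
  obtain ⟨v, hv, h0⟩ := Matrix.exists_mulVec_eq_zero_iff.2 h
  have h1 : A.map Complex.ofReal *ᵥ v = z • v := by
    rw [Matrix.sub_mulVec, sub_eq_zero] at h0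
    rw [h0, Matrix.smul_mulVec, Matrix.one_mulVec]
  have h2 : (star v ⬝ᵥ (A.map Complex.ofReal *ᵥ v)).im = 0 := hH.im_star_dotProduct_mulVec_self v
  rw [h1, dotProduct_smul] at h2
  have h3 : star v ⬝ᵥ v = ((∑ i, ‖v i‖ ^ 2 : ℝ) : ℂ) := by
    simp only [dotProduct, Pi.star_apply, RCLike.star_def, Complex.ofReal_sum]
    refine Finset.sum_congr rfl fun i _ => ?_
    rw [mul_comm, Complex.mul_conj, Complex.normSq_eq_norm_sq]
  rw [h3] at h2
  have h4 : z.im * (∑ i, ‖v i‖ ^ 2) = 0 := by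
    rwa [smul_eq_mul, Complex.im_mul_ofReal] at h2
  have h5 : ∑ i, ‖v i‖ ^ 2 = 0 := by simpa [hz] using h4
  apply hv
  rw [Finset.sum_eq_zero_iff_of_nonneg (fun i _ => by positivity)] at h5
  ext i
  simpa using h5 i (Finset.mem_univ i)

section Symmetric

variable {A : Matrix ι ι ℝ} {z w : ℂ}

theorem sub_mul_res (hA : A.IsSymm) (hz : z.im ≠ 0) :
    (A.map Complex.ofReal - z • (1 : Matrix ι ι ℂ)) * res A z = 1 :=
  Matrix.mul_nonsing_inv _ (isUnit_det_sub_smul hA hz)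

theorem res_mul_sub (hA : A.IsSymm) (hz : z.im ≠ 0) :
    res A z * (A.map Complex.ofReal - z • (1 : Matrix ι ι ℂ)) = 1 :=
  Matrix.nonsing_inv_mul _ (isUnit_det_sub_smul hA hz)

theorem map_mul_res (hA : A.IsSymm) (hz : z.im ≠ 0) :
    A.map Complex.ofReal * res A z = 1 + z • res A z := by
  have := sub_mul_res hA hz
  rw [Matrix.sub_mul, Matrix.smul_mul, Matrix.one_mul] at this
  rw [← this]; abel

theorem res_mul_map (hA : A.IsSymm) (hz : z.im ≠ 0) :
    res A z * A.map Complex.ofReal = 1 + z • res A z := by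
  have := res_mul_sub hA hz
  rw [Matrix.mul_sub, Matrix.mul_smul, Matrix.mul_one] at this
  rw [← this]; abel

theorem res_transpose (hA : A.IsSymm) : (res A z)ᵀ = res A z := by
  rw [res, Matrix.transpose_nonsing_inv, Matrix.transpose_sub, Matrix.transpose_smul,
    Matrix.transpose_one, ← Matrix.transpose_map, hA.eq]

theorem res_symm (hA : A.IsSymm) (i j : ι) : res A z i j = res A z j i := by
  conv_lhs => rw [← res_transpose hA]
  rfl

theorem res_conj (hA : A.IsSymm) (i j : ι) :
    res A (starRingEnd ℂ z) i j = starRingEnd ℂ (res A z i j) := by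
  have : (res A z)ᴴ = res A (starRingEnd ℂ z) := by
    rw [res, Matrix.conjTranspose_nonsing_inv, Matrix.conjTranspose_sub, Matrix.conjTranspose_smul,
      Matrix.conjTranspose_one, res]
    congr 2
    ext i j
    simp [Matrix.conjTranspose_apply, hA.apply i j]
  rw [← this, Matrix.conjTranspose_apply, res_symm hA]
  rfl

/-- The first resolvent identity. -/
theorem res_sub_res (hA : A.IsSymm) (hz : z.im ≠ 0) (hw : w.im ≠ 0) :
    res A z - res A w = (z - w) • (res A z * res A w) := by
  have h1 : res A z * (A.map Complex.ofReal) * res A w = (1 + z • res A z) * res A w := by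
    rw [res_mul_map hA hz]
  rw [Matrix.mul_assoc, map_mul_res hA hw, Matrix.mul_add, Matrix.add_mul, Matrix.mul_one,
    Matrix.one_mul, Matrix.mul_smul, Matrix.smul_mul] at h1
  rw [sub_smul, sub_eq_sub_iff_add_eq_add, h1, add_comm]

/-- The Ward identity of the resolvent. -/
theorem res_diag_im (hA : A.IsSymm) (hz : z.im ≠ 0) (i : ι) :
    (res A z i i).im = z.im * ∑ j, ‖res A z i j‖ ^ 2 := by
  have hw : (starRingEnd ℂ z).im ≠ 0 := by simpa using hz
  have h := congrFun (congrFun (res_sub_res hA hz hw) i) i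
  simp only [Matrix.sub_apply, Matrix.smul_apply, Matrix.mul_apply, res_conj hA, smul_eq_mul] at h
  have h2 : ∑ j, res A z i j * starRingEnd ℂ (res A z j i)
      = ((∑ j, ‖res A z i j‖ ^ 2 : ℝ) : ℂ) := by
    rw [Complex.ofReal_sum]
    refine Finset.sum_congr rfl fun j _ => ?_
    rw [res_symm hA j i, Complex.mul_conj, Complex.normSq_eq_norm_sq]
  rw [h2, Complex.sub_conj, Complex.sub_conj] at h
  generalize ∑ j, ‖res A z i j‖ ^ 2 = s at h ⊢
  have h3 := congrArg Complex.im h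
  simp at h3
  linarith

theorem res_diag_im_nonneg (hA : A.IsSymm) (hz : 0 < z.im) (i : ι) : 0 ≤ (res A z i i).im := by
  rw [res_diag_im hA hz.ne']
  positivity

theorem norm_res_diag_le (hA : A.IsSymm) (hz : z.im ≠ 0) (i : ι) :
    ‖res A z i i‖ ≤ |z.im|⁻¹ := by
  have h := res_diag_im hA hz i
  have h1 : ‖res A z i i‖ ^ 2 ≤ ∑ j, ‖res A z i j‖ ^ 2 :=
    Finset.single_le_sum (f := fun j => ‖res A z i j‖ ^ 2) (fun j _ => by positivity)
      (Finset.mem_univ i)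
  have h2 := Complex.abs_im_le_norm (res A z i i)
  rw [h, abs_mul, abs_of_nonneg (a := ∑ j, ‖res A z i j‖ ^ 2)
    (Finset.sum_nonneg fun j _ => by positivity)] at h2
  have h0 : 0 < |z.im| := abs_pos.2 hz
  rw [← one_div, le_div_iff₀ h0]
  by_contra! hc
  have hpos : 0 < ‖res A z i i‖ := by
    by_contra! h4
    nlinarith
  nlinarith [mul_le_mul_of_nonneg_left h1 h0.le]

theorem sum_norm_sq_res_le (hA : A.IsSymm) (hz : z.im ≠ 0) (i : ι) :
    ∑ j, ‖res A z i j‖ ^ 2 ≤ (|z.im|⁻¹) ^ 2 := by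
  have h := res_diag_im hA hz i
  have h2 := (Complex.abs_im_le_norm (res A z i i)).trans (norm_res_diag_le hA hz i)
  have h0 : 0 < |z.im| := abs_pos.2 hz
  rw [h, abs_mul, abs_of_nonneg (a := ∑ j, ‖res A z i j‖ ^ 2)
    (Finset.sum_nonneg fun j _ => by positivity)] at h2
  rw [sq]
  calc _ = |z.im|⁻¹ * (|z.im| * ∑ j, ‖res A z i j‖ ^ 2) := by field_simp
    _ ≤ _ := by gcongr

theorem norm_res_le (hA : A.IsSymm) (hz : z.im ≠ 0) (i j : ι) :
    ‖res A z i j‖ ≤ |z.im|⁻¹ := by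
  have h := sum_norm_sq_res_le hA hz i
  have h1 : ‖res A z i j‖ ^ 2 ≤ ∑ j, ‖res A z i j‖ ^ 2 :=
    Finset.single_le_sum (f := fun j => ‖res A z i j‖ ^ 2) (fun j _ => by positivity)
      (Finset.mem_univ j)
  exact (sq_le_sq₀ (norm_nonneg _) (by positivity)).1 (h1.trans h)

/-- Resolvents are Lipschitz in the spectral parameter. -/
theorem norm_res_sub_res_le (hA : A.IsSymm) (hz : z.im ≠ 0) (hw : w.im ≠ 0) (i j : ι) :
    ‖res A z i j - res A w i j‖ ≤ ‖z - w‖ * (|z.im|⁻¹ * |w.im|⁻¹) := by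
  have h := congrFun (congrFun (res_sub_res hA hz hw) i) j
  rw [Matrix.sub_apply] at h
  rw [h, Matrix.smul_apply, smul_eq_mul, norm_mul, Matrix.mul_apply]
  gcongr
  calc ‖∑ k, res A z i k * res A w k j‖ ≤ ∑ k, ‖res A z i k‖ * ‖res A w j k‖ := by
        refine (norm_sum_le _ _).trans (le_of_eq ?_)
        refine Finset.sum_congr rfl fun k _ => ?_
        rw [norm_mul, res_symm hA k j]
    _ ≤ √(∑ k, ‖res A z i k‖ ^ 2) * √(∑ k, ‖res A w j k‖ ^ 2) :=
        Real.sum_mul_le_sqrt_mul_sqrt _ _ _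
    _ ≤ |z.im|⁻¹ * |w.im|⁻¹ := by
        gcongr
        · exact Real.sqrt_le_iff.2 ⟨by positivity, sum_norm_sq_res_le hA hz i⟩
        · exact Real.sqrt_le_iff.2 ⟨by positivity, sum_norm_sq_res_le hA hw j⟩

end Symmetric

/-- The scaled Gram matrix `c • B Bᵀ`. -/
def gram (c : ℝ) (B : Matrix ι ι ℝ) : Matrix ι ι ℝ := c • (B * Bᵀ)

omit [DecidableEq ι] in
theorem gram_isSymm (c : ℝ) (B : Matrix ι ι ℝ) : (gram c B).IsSymm := by
  simp [gram, Matrix.IsSymm, Matrix.transpose_mul]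

omit [DecidableEq ι] in
theorem gram_map (c : ℝ) (B : Matrix ι ι ℝ) : (gram c B).map Complex.ofReal
    = (c : ℂ) • (B.map Complex.ofReal * (B.map Complex.ofReal)ᵀ) := by
  ext i j
  simp [gram, Matrix.mul_apply]

/-- The columns of `Bᵀ (c B Bᵀ - z)⁻¹` have a squared norm given by the imaginary part of `z` times
the resolvent. Hence the entries of `Bᵀ (c B Bᵀ - z)⁻¹` are bounded uniformly in `B`, although
those of `B` are not, and `z (c B Bᵀ - z)⁻¹` has a diagonal in the closed upper half plane. -/
theorem res_gram_mul_im {c : ℝ} {B : Matrix ι ι ℝ} {z : ℂ} (hz : z.im ≠ 0) (i : ι) :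
    (z * res (gram c B) z i i).im
      = z.im * (c * ∑ j, ‖((B.map Complex.ofReal)ᵀ * res (gram c B) z) j i‖ ^ 2) := by
  set A := gram c B with hAdef
  have hA : A.IsSymm := gram_isSymm c B
  have hw : (starRingEnd ℂ z).im ≠ 0 := by simpa using hz
  set b := B.map Complex.ofReal with hb
  have e1 : res A (starRingEnd ℂ z) * (A.map Complex.ofReal * res A z)
      = res A (starRingEnd ℂ z) + z • (res A (starRingEnd ℂ z) * res A z) := by
    rw [map_mul_res hA hz, Matrix.mul_add, Matrix.mul_one, Matrix.mul_smul]
  have e2 : (z - starRingEnd ℂ z) • (res A (starRingEnd ℂ z) * (A.map Complex.ofReal * res A z))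
      = z • res A z - (starRingEnd ℂ z) • res A (starRingEnd ℂ z) := by
    have h := res_sub_res hA hw hz
    have h' : (z - starRingEnd ℂ z) • (res A (starRingEnd ℂ z) * res A z)
      = res A z - res A (starRingEnd ℂ z) := by
      rw [← neg_sub, neg_smul, ← h]; abel
    rw [e1, smul_add, smul_comm, h']
    module
  have e3 : (res A (starRingEnd ℂ z) * (A.map Complex.ofReal * res A z)) i i
      = ((c * ∑ j, ‖(bᵀ * res A z) j i‖ ^ 2 : ℝ) : ℂ) := by
    rw [hAdef, gram_map, ← hAdef, ← hb]
    have : res A (starRingEnd ℂ z) * ((c : ℂ) • (b * bᵀ) * res A z)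
        = (c : ℂ) • ((res A (starRingEnd ℂ z) * b) * (bᵀ * res A z)) := by
      simp only [Matrix.smul_mul, Matrix.mul_smul, Matrix.mul_assoc]
    rw [this, Matrix.smul_apply, Matrix.mul_apply, smul_eq_mul, Complex.ofReal_mul,
      Complex.ofReal_sum]
    congr 1
    refine Finset.sum_congr rfl fun j _ => ?_
    have : (res A (starRingEnd ℂ z) * b) i j = starRingEnd ℂ ((bᵀ * res A z) j i) := by
      rw [Matrix.mul_apply, Matrix.mul_apply, map_sum]
      refine Finset.sum_congr rfl fun k _ => ?_
      rw [res_conj hA, res_symm hA i k, map_mul, mul_comm]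
      simp [hb]
    rw [this, mul_comm, Complex.mul_conj, Complex.normSq_eq_norm_sq]
  have h := congrFun (congrFun e2 i) i
  rw [Matrix.smul_apply, e3, Matrix.sub_apply, Matrix.smul_apply, Matrix.smul_apply, res_conj hA,
    smul_eq_mul, smul_eq_mul, smul_eq_mul, ← map_mul, Complex.sub_conj, Complex.sub_conj] at h
  generalize ∑ j, ‖(bᵀ * res A z) j i‖ ^ 2 = s at h ⊢
  generalize z * res A z i i = u at h ⊢
  have h3 := congrArg Complex.im h
  simp at h3
  linarith

theorem res_gram_mul_im_nonneg {c : ℝ} (hc : 0 ≤ c) {B : Matrix ι ι ℝ} {z : ℂ} (hz : 0 < z.im)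
    (i : ι) : 0 ≤ (z * res (gram c B) z i i).im := by
  rw [res_gram_mul_im hz.ne']
  positivity

theorem norm_transpose_mul_res_le {c : ℝ} (hc : 0 < c) {B : Matrix ι ι ℝ} {z : ℂ}
    (hz : z.im ≠ 0) (i j : ι) :
    ‖((B.map Complex.ofReal)ᵀ * res (gram c B) z) j i‖ ≤ 1 + ‖z‖ / (c * z.im ^ 2) := by
  have h := res_gram_mul_im (c := c) (B := B) hz i
  set s := ∑ j, ‖((B.map Complex.ofReal)ᵀ * res (gram c B) z) j i‖ ^ 2 with hs
  have h1 : ‖((B.map Complex.ofReal)ᵀ * res (gram c B) z) j i‖ ^ 2 ≤ s :=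
    Finset.single_le_sum (f := fun j => ‖((B.map Complex.ofReal)ᵀ * res (gram c B) z) j i‖ ^ 2)
      (fun j _ => by positivity) (Finset.mem_univ j)
  have hs0 : 0 ≤ s := (by positivity : (0:ℝ) ≤ _).trans h1
  have h2 := (Complex.abs_im_le_norm (z * res (gram c B) z i i)).trans_eq (norm_mul _ _)
  have h3 := norm_res_diag_le (gram_isSymm c B) hz i
  have h0 : 0 < |z.im| := abs_pos.2 hz
  rw [h, abs_mul, abs_of_nonneg (by positivity : 0 ≤ c * s)] at h2
  have h4 : s ≤ ‖z‖ / (c * z.im ^ 2) := by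
    rw [le_div_iff₀ (by positivity), ← sq_abs z.im]
    have h5 : |z.im| * (c * s) ≤ ‖z‖ * |z.im|⁻¹ := h2.trans (by gcongr)
    calc s * (c * |z.im| ^ 2) = |z.im| * (|z.im| * (c * s)) := by ring
      _ ≤ |z.im| * (‖z‖ * |z.im|⁻¹) := by gcongr
      _ = ‖z‖ := by field_simp
  nlinarith [sq_nonneg (‖((B.map Complex.ofReal)ᵀ * res (gram c B) z) j i‖ - 1),
    norm_nonneg (((B.map Complex.ofReal)ᵀ * res (gram c B) z) j i)]

section RankOne

variable {A : Matrix ι ι ℝ} {b : ι → ℝ} {t : ℝ} {z : ℂ}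

omit [Fintype ι] [DecidableEq ι] in
theorem isSymm_add_rankOne (hA : A.IsSymm) : (A + t • vecMulVec b b).IsSymm := by
  rw [Matrix.IsSymm, Matrix.transpose_add, hA.eq, Matrix.transpose_smul, Matrix.transpose_vecMulVec]

/-- The effect of a rank one perturbation on the resolvent, free of any denominator. -/
theorem res_sub_res_rankOne (hA : A.IsSymm) (hz : z.im ≠ 0) :
    res A z - res (A + t • vecMulVec b b) z
      = (t : ℂ) • vecMulVec (res A z *ᵥ fun i => (b i : ℂ))
        (res (A + t • vecMulVec b b) z *ᵥ fun i => (b i : ℂ)) := by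
  set A' := A + t • vecMulVec b b with hA'
  have hs : A'.IsSymm := isSymm_add_rankOne hA
  have hmap : A'.map Complex.ofReal
      = A.map Complex.ofReal + (t : ℂ) • vecMulVec (fun i => (b i : ℂ)) (fun i => (b i : ℂ)) := by
    ext i j
    simp [hA', vecMulVec_apply]
  have h1 : res A z * (A'.map Complex.ofReal) * res A' z = res A z * (1 + z • res A' z) := by
    rw [Matrix.mul_assoc, map_mul_res hs hz]
  rw [hmap, Matrix.mul_add, res_mul_map hA hz, Matrix.add_mul, Matrix.add_mul, Matrix.one_mul,
    Matrix.mul_add, Matrix.mul_one, Matrix.smul_mul, Matrix.mul_smul, Matrix.mul_smul,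
    Matrix.smul_mul, Matrix.mul_vecMulVec, Matrix.vecMulVec_mul] at h1
  have h2 : (fun i => (b i : ℂ)) ᵥ* res A' z = res A' z *ᵥ (fun i => (b i : ℂ)) := by
    rw [← Matrix.mulVec_transpose, res_transpose hs]
  rw [h2] at h1
  rw [sub_eq_iff_eq_add']
  have h3 := add_right_cancel (b := z • (res A z * res A' z)) (a := res A' z + (t : ℂ) •
    vecMulVec (res A z *ᵥ fun i => (b i : ℂ)) (res A' z *ᵥ fun i => (b i : ℂ))) (c := res A z) ?_
  · exact h3.symm
  · rw [← h1]; abel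

/-- The denominator `1 + t ⟨b, (A - z)⁻¹ b⟩` of the Sherman–Morrison formula. -/
noncomputable def rankOneDenom (A : Matrix ι ι ℝ) (b : ι → ℝ) (t : ℝ) (z : ℂ) : ℂ :=
  1 + t * ((fun i => (b i : ℂ)) ⬝ᵥ (res A z *ᵥ fun i => (b i : ℂ)))

theorem rankOneDenom_smul (hA : A.IsSymm) (hz : z.im ≠ 0) :
    rankOneDenom A b t z • (res (A + t • vecMulVec b b) z *ᵥ fun i => (b i : ℂ))
      = res A z *ᵥ fun i => (b i : ℂ) := by
  have h := res_sub_res_rankOne (b := b) (t := t) hA hz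
  have hs : (A + t • vecMulVec b b).IsSymm := isSymm_add_rankOne hA
  set A' := A + t • vecMulVec b b
  have h' := congrArg Matrix.transpose h
  rw [Matrix.transpose_sub, res_transpose hA, res_transpose hs, Matrix.transpose_smul,
    Matrix.transpose_vecMulVec] at h'
  have h2 := congrArg (fun M => M *ᵥ fun i => (b i : ℂ)) h'
  simp only [Matrix.sub_mulVec, Matrix.smul_mulVec, Matrix.vecMulVec_mulVec] at h2
  rw [rankOneDenom, dotProduct_comm, add_smul, one_smul]
  ext i
  have h3 := congrFun h2 i
  simp at h3 ⊢
  linear_combination -h3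

theorem rankOneDenom_im (hA : A.IsSymm) (hz : z.im ≠ 0) :
    (rankOneDenom A b t z).im = t * (z.im * ∑ i, ‖(res A z *ᵥ fun i => (b i : ℂ)) i‖ ^ 2) := by
  have hw : (starRingEnd ℂ z).im ≠ 0 := by simpa using hz
  set bc : ι → ℂ := fun i => (b i : ℂ) with hbc
  have hconj : res A (starRingEnd ℂ z) *ᵥ bc = fun i => starRingEnd ℂ ((res A z *ᵥ bc) i) := by
    ext i
    simp [Matrix.mulVec, dotProduct, res_conj hA, hbc]
  have h := res_sub_res hA hw hz
  have h2 := congrArg (fun M => bc ⬝ᵥ (M *ᵥ bc)) h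
  simp only [Matrix.sub_mulVec, Matrix.smul_mulVec, dotProduct_sub, dotProduct_smul] at h2
  have h3 : bc ⬝ᵥ ((res A (starRingEnd ℂ z) * res A z) *ᵥ bc)
      = ((∑ i, ‖(res A z *ᵥ bc) i‖ ^ 2 : ℝ) : ℂ) := by
    rw [← Matrix.mulVec_mulVec, Matrix.dotProduct_mulVec, ← Matrix.mulVec_transpose,
      res_transpose hA, hconj, dotProduct, Complex.ofReal_sum]
    refine Finset.sum_congr rfl fun i _ => ?_
    rw [mul_comm, Complex.mul_conj, Complex.normSq_eq_norm_sq]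
  have h4 : bc ⬝ᵥ (res A (starRingEnd ℂ z) *ᵥ bc) = starRingEnd ℂ (bc ⬝ᵥ (res A z *ᵥ bc)) := by
    rw [hconj]
    simp [dotProduct, hbc]
  rw [h3, h4, ← neg_sub, ← neg_sub z, Complex.sub_conj, Complex.sub_conj] at h2
  rw [rankOneDenom, ← hbc]
  generalize ∑ i, ‖(res A z *ᵥ bc) i‖ ^ 2 = s at h2 ⊢
  have h5 := congrArg Complex.im h2
  simp at h5
  simp
  left
  linarith

/-- Rank one perturbations change the trace of the resolvent by at most `1 / |Im z|`. -/
theorem norm_trace_res_rankOne_sub_le (hA : A.IsSymm) (hz : z.im ≠ 0) :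
    ‖(res (A + t • vecMulVec b b) z).trace - (res A z).trace‖ ≤ |z.im|⁻¹ := by
  have h := congrArg Matrix.trace (res_sub_res_rankOne (b := b) (t := t) hA hz)
  have hd := rankOneDenom_smul (b := b) (t := t) hA hz
  have him := rankOneDenom_im (b := b) (t := t) hA hz
  set v := res A z *ᵥ fun i => (b i : ℂ)
  set v' := res (A + t • vecMulVec b b) z *ᵥ fun i => (b i : ℂ)
  set D := rankOneDenom A b t z
  set q := ∑ i, ‖v i‖ ^ 2 with hq
  rw [Matrix.trace_sub, Matrix.trace_smul, Matrix.trace_vecMulVec, smul_eq_mul] at h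
  rw [norm_sub_rev, h]
  have h0 : 0 < |z.im| := abs_pos.2 hz
  have hq0 : 0 ≤ q := Finset.sum_nonneg fun i _ => by positivity
  have h1 : ‖D‖ * ‖(t : ℂ) * (v ⬝ᵥ v')‖ ≤ |t| * q := by
    rw [← norm_mul]
    have : D * (t * (v ⬝ᵥ v')) = t * (v ⬝ᵥ v) := by
      have e : v ⬝ᵥ v = D * (v ⬝ᵥ v') := by
        nth_rewrite 2 [← hd]
        rw [dotProduct_smul, smul_eq_mul]
      rw [e]; ring
    rw [this, norm_mul, Complex.norm_real, Real.norm_eq_abs]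
    gcongr
    refine (norm_sum_le _ _).trans (le_of_eq (Finset.sum_congr rfl fun i _ => ?_))
    rw [norm_mul, sq]
  have h2 : |t| * (|z.im| * q) ≤ ‖D‖ := by
    refine le_trans (le_of_eq ?_) (Complex.abs_im_le_norm D)
    rw [him, abs_mul, abs_mul, abs_of_nonneg hq0]
  rcases (mul_nonneg (abs_nonneg t) hq0).eq_or_lt with h3 | h3
  · -- if `t = 0` or `v = 0` then the perturbation does not change the trace
    have : (t : ℂ) * (v ⬝ᵥ v') = 0 := by
      rcases mul_eq_zero.1 h3.symm with h4 | h4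
      · simp [abs_eq_zero.1 h4]
      · rw [hq, Finset.sum_eq_zero_iff_of_nonneg (fun i _ => by positivity)] at h4
        have : v = 0 := by
          ext i
          simpa using h4 i (Finset.mem_univ i)
        simp [this]
    rw [this]; simp
  · have hD : 0 < ‖D‖ := lt_of_lt_of_le (by
      have := mul_pos h0 h3
      nlinarith) h2
    have h5 : |z.im| * ‖(t : ℂ) * (v ⬝ᵥ v')‖ * (|t| * q) ≤ 1 * (|t| * q) := by
      calc |z.im| * ‖(t : ℂ) * (v ⬝ᵥ v')‖ * (|t| * q)
          = (|t| * (|z.im| * q)) * ‖(t : ℂ) * (v ⬝ᵥ v')‖ := by ring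
        _ ≤ ‖D‖ * ‖(t : ℂ) * (v ⬝ᵥ v')‖ := by gcongr
        _ ≤ 1 * (|t| * q) := by linarith
    have h6 := le_of_mul_le_mul_right h5 h3
    rw [← one_div, le_div_iff₀ h0]
    linarith

end RankOne

end Resolvent

/-! ### Derivatives of the resolvent in the entries of the matrix -/

section Derivative

variable {ι : Type*} [Fintype ι] [DecidableEq ι]

theorem continuous_res_gram {X : Type*} [TopologicalSpace X] {f : X → Matrix ι ι ℝ}
    (hf : Continuous f) (c : ℝ) {z : ℂ} (hz : z.im ≠ 0) :
    Continuous fun x => res (gram c (f x)) z := by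
  have h1 : Continuous fun x =>
      (gram c (f x)).map Complex.ofReal - z • (1 : Matrix ι ι ℂ) := by
    unfold gram
    refine Continuous.sub (Continuous.matrix_map ?_ Complex.continuous_ofReal) continuous_const
    fun_prop
  unfold res
  simp only [Matrix.inv_def, Ring.inverse_eq_inv']
  exact Continuous.smul (h1.matrix_det.inv₀
    fun x => (isUnit_det_sub_smul (gram_isSymm c (f x)) hz).ne_zero) h1.matrix_adjugate

/-- The partial derivative of the resolvent entry `(c B Bᵀ - z)⁻¹ k l` with respect to `B i j`. -/
noncomputable def dres (c : ℝ) (z : ℂ) (i j k l : ι) (B : Matrix ι ι ℝ) : ℂ :=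
  -c * (res (gram c B) z k i * ((B.map Complex.ofReal)ᵀ * res (gram c B) z) j l
    + ((B.map Complex.ofReal)ᵀ * res (gram c B) z) j k * res (gram c B) z i l)

theorem continuous_dres (c : ℝ) {z : ℂ} (hz : z.im ≠ 0) (i j k l : ι) :
    Continuous (dres c z i j k l) := by
  have h := continuous_res_gram (ι := ι) continuous_id c hz
  simp only [id] at h
  have h2 : Continuous fun B : Matrix ι ι ℝ => (B.map Complex.ofReal)ᵀ * res (gram c B) z :=
    ((continuous_id.matrix_map Complex.continuous_ofReal).matrix_transpose).matrix_mul h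
  unfold dres
  exact continuous_const.mul (((h.matrix_elem k i).mul (h2.matrix_elem j l)).add
    ((h2.matrix_elem j k).mul (h.matrix_elem i l)))

theorem norm_dres_le {c : ℝ} (hc : 0 < c) {z : ℂ} (hz : z.im ≠ 0) (i j k l : ι)
    (B : Matrix ι ι ℝ) :
    ‖dres c z i j k l B‖ ≤ 2 * c * |z.im|⁻¹ * (1 + ‖z‖ / (c * z.im ^ 2)) := by
  have h1 := norm_res_le (gram_isSymm c B) hz k i
  have h2 := norm_res_le (gram_isSymm c B) hz i l
  have h3 := norm_transpose_mul_res_le (B := B) hc hz l j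
  have h4 := norm_transpose_mul_res_le (B := B) hc hz k j
  unfold dres
  rw [norm_mul, norm_neg, Complex.norm_real, Real.norm_of_nonneg hc.le]
  calc _ ≤ c * (|z.im|⁻¹ * (1 + ‖z‖ / (c * z.im ^ 2)) + (1 + ‖z‖ / (c * z.im ^ 2)) * |z.im|⁻¹) := by
        gcongr
        refine (norm_add_le _ _).trans ?_
        rw [norm_mul, norm_mul]
        gcongr
    _ = _ := by ring

section Normed

attribute [local instance] Matrix.linftyOpNormedRing Matrix.linftyOpNormedAlgebra

theorem hasDerivAt_res {A : ℝ → Matrix ι ι ℝ} {A' : Matrix ι ι ℝ} {z : ℂ} (hz : z.im ≠ 0) {t : ℝ}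
    (hA : (A t).IsSymm) (hd : ∀ i j, HasDerivAt (fun s => A s i j) (A' i j) t) (k l : ι) :
    HasDerivAt (fun s => res (A s) z k l)
      (-(res (A t) z * A'.map Complex.ofReal * res (A t) z) k l) t := by
  have h1 : HasDerivAt (fun s => (A s).map Complex.ofReal - z • (1 : Matrix ι ι ℂ))
      (A'.map Complex.ofReal) t := by
    refine HasDerivAt.sub_const _ ?_
    refine hasDerivAt_pi.2 fun i => hasDerivAt_pi.2 fun j => ?_
    exact (hd i j).ofReal_comp
  obtain ⟨u, hu⟩ := (Matrix.isUnit_iff_isUnit_det _).2 (isUnit_det_sub_smul hA hz)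
  have h2 := hasFDerivAt_ringInverse (𝕜 := ℝ) u
  rw [hu] at h2
  have h3 := h2.comp_hasDerivAt t h1
  have h4 : (↑u⁻¹ : Matrix ι ι ℂ) = res (A t) z := by
    rw [res, ← hu, Matrix.nonsing_inv_eq_ringInverse, Ring.inverse_unit]
  have h5 := hasDerivAt_pi.1 (hasDerivAt_pi.1 h3 k) l
  rw [h4] at h5
  have h6 : (fun s => res (A s) z k l)
      = fun s => (Ring.inverse ∘ fun s => (A s).map Complex.ofReal - z • 1) s k l := by
    ext s
    rw [res, Matrix.nonsing_inv_eq_ringInverse]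
    rfl
  rw [h6]
  exact h5

end Normed

theorem hasDerivAt_res_gram (c : ℝ) {z : ℂ} (hz : z.im ≠ 0) (i j k l : ι) (B : Matrix ι ι ℝ) :
    HasDerivAt (fun s : ℝ => res (gram c (B + s • Matrix.single i j 1)) z k l)
      (dres c z i j k l B) 0 := by
  set E : Matrix ι ι ℝ := Matrix.single i j 1
  have hd : ∀ p q, HasDerivAt (fun s : ℝ => gram c (B + s • E) p q)
      ((c • (E * Bᵀ + B * Eᵀ)) p q) 0 := by
    intro p q
    have h0 : ∀ s : ℝ, gram c (B + s • E) p q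
        = gram c B p q + s * (c • (E * Bᵀ + B * Eᵀ)) p q + s ^ 2 * (c • (E * Eᵀ)) p q := by
      intro s
      simp only [gram, Matrix.transpose_add, Matrix.transpose_smul, Matrix.add_mul, Matrix.mul_add,
        Matrix.smul_mul, Matrix.mul_smul, Matrix.smul_apply, Matrix.add_apply, smul_eq_mul]
      ring
    rw [funext h0]
    have h1 := ((hasDerivAt_id (0 : ℝ)).mul_const ((c • (E * Bᵀ + B * Eᵀ)) p q))
    have h2 := (hasDerivAt_pow 2 (0 : ℝ)).mul_const ((c • (E * Eᵀ)) p q)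
    have h3 := (h1.const_add (gram c B p q)).add h2
    refine h3.congr_deriv ?_
    simp
  have h := hasDerivAt_res hz (t := 0) (by simpa using gram_isSymm c _) hd k l
  simp only [zero_smul, add_zero] at h
  convert h using 1
  set b := B.map Complex.ofReal
  set G := res (gram c B) z
  have hG : Gᵀ = G := res_transpose (gram_isSymm c B)
  have e1 : (c • (E * Bᵀ + B * Eᵀ)).map Complex.ofReal
      = (c : ℂ) • (Matrix.single i j (1 : ℂ) * bᵀ + b * Matrix.single j i (1 : ℂ)) := by
    ext p q
    simp [Matrix.mul_apply, E, b, Matrix.single_apply, apply_ite Complex.ofReal, mul_add]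
  rw [e1]
  have e2 : G * ((c : ℂ) • (Matrix.single i j (1 : ℂ) * bᵀ + b * Matrix.single j i (1 : ℂ))) * G
      = (c : ℂ) • (G * Matrix.single i j (1 : ℂ) * (bᵀ * G)
        + (bᵀ * G)ᵀ * Matrix.single j i (1 : ℂ) * G) := by
    rw [Matrix.transpose_mul, hG, Matrix.transpose_transpose]
    simp only [Matrix.mul_smul, Matrix.smul_mul, Matrix.mul_add, Matrix.add_mul, Matrix.mul_assoc]
  have e3 : ∀ (X Y : Matrix ι ι ℂ) (i j k l : ι),
      (X * Matrix.single i j (1 : ℂ) * Y) k l = X k i * Y j l := by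
    intro X Y i j k l
    rw [Matrix.mul_apply, Finset.sum_eq_single j]
    · simp
    · intro x _ hx
      simp [Matrix.mul_single_apply_of_ne, hx]
    · simp
  rw [e2, Matrix.smul_apply, Matrix.add_apply, e3, e3, dres]
  simp only [Matrix.transpose_apply, smul_eq_mul]
  ring

end Derivative

/-! ### The isospectral flow of a bidiagonal matrix -/

section Algebra

variable {m : ℕ}

/-- `B` is lower bidiagonal: only the diagonal and the first subdiagonal may be nonzero. -/
def IsLowerBidiagonal (B : Matrix (Fin m) (Fin m) ℝ) : Prop :=
  ∀ i j : Fin m, i ≠ j → (i : ℕ) ≠ j + 1 → B i j = 0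

/-- The sign `1` on the diagonal, `-1` on the subdiagonal and `0` elsewhere. -/
def sgnBidiag (i j : Fin m) : ℂ := if i = j then 1 else if (i : ℕ) = j + 1 then -1 else 0

/-- The sign `1` below the diagonal, `-1` above it and `0` on it. -/
def sgnLower (i j : Fin m) : ℂ := if j < i then 1 else if i < j then -1 else 0

variable (c : ℝ) (z : ℂ) (B : Matrix (Fin m) (Fin m) ℝ)

/-- The logarithmic velocity of the entry `B i j` under the isospectral flow `B' = S B - B S̃`,
where `S` and `S̃` are the generators `flowGen` of `B` and `Bᵀ`; see `flowVel_eq`. -/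
noncomputable def flowRate (i j : Fin m) (B : Matrix (Fin m) (Fin m) ℝ) : ℂ :=
  1 / 2 * sgnBidiag i j * (res (gram c B) z i i - res (gram c Bᵀ) z j j)

/-- The skew-symmetric generator of the isospectral flow: half the strictly lower minus half the
strictly upper triangular part of the resolvent of `c B Bᵀ` at `z`. -/
noncomputable def flowGen : Matrix (Fin m) (Fin m) ℂ :=
  Matrix.of fun i j => 1 / 2 * sgnLower i j * res (gram c B) z i j

/-- The velocity field of the isospectral flow. It is complex valued, and differentiates functions
of the real matrix `B` through the complex combination of their partial derivatives. -/
noncomputable def flowVel : Matrix (Fin m) (Fin m) ℂ :=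
  Matrix.of fun i j => (B i j : ℂ) * flowRate c z i j B

variable {c z B}

/-- `G B = B G̃`, where `G` and `G̃` are the resolvents of `c B Bᵀ` and `c Bᵀ B`. -/
theorem res_gram_mul (hz : z.im ≠ 0) :
    res (gram c B) z * B.map Complex.ofReal = B.map Complex.ofReal * res (gram c Bᵀ) z := by
  set b := B.map Complex.ofReal with hb
  have h1 := res_mul_sub (gram_isSymm c B) hz
  have h2 := sub_mul_res (gram_isSymm c Bᵀ) hz
  set G := res (gram c B) z
  set G' := res (gram c Bᵀ) z
  have hbt : (Bᵀ).map Complex.ofReal = bᵀ := by rw [hb, Matrix.transpose_map]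
  have e : ((gram c B).map Complex.ofReal - z • (1 : Matrix (Fin m) (Fin m) ℂ)) * b
      = b * ((gram c Bᵀ).map Complex.ofReal - z • (1 : Matrix (Fin m) (Fin m) ℂ)) := by
    rw [gram_map, gram_map, hbt, Matrix.transpose_transpose, ← hb]
    simp only [Matrix.sub_mul, Matrix.mul_sub, Matrix.smul_mul, Matrix.mul_smul, Matrix.one_mul,
      Matrix.mul_one, Matrix.mul_assoc]
  calc G * b = G * (b * (((gram c Bᵀ).map Complex.ofReal
        - z • (1 : Matrix (Fin m) (Fin m) ℂ)) * G')) := by rw [h2, Matrix.mul_one]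
    _ = G * ((((gram c B).map Complex.ofReal - z • (1 : Matrix (Fin m) (Fin m) ℂ))) * b) * G' := by
        rw [e]; simp only [Matrix.mul_assoc]
    _ = b * G' := by rw [← Matrix.mul_assoc, h1, Matrix.one_mul]

theorem transpose_mul_res_gram (hz : z.im ≠ 0) :
    (B.map Complex.ofReal)ᵀ * res (gram c B) z
      = res (gram c Bᵀ) z * (B.map Complex.ofReal)ᵀ := by
  have h := congrArg Matrix.transpose (res_gram_mul (c := c) (B := B) hz)
  rwa [Matrix.transpose_mul, Matrix.transpose_mul, res_transpose (gram_isSymm c _),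
    res_transpose (gram_isSymm c _)] at h

/-- For `z` off the real axis this also holds when `B` is singular, since both Gram matrices have
the same size. -/
theorem trace_res_gram_transpose (hz : z.im ≠ 0) :
    (res (gram c Bᵀ) z).trace = (res (gram c B) z).trace := by
  have h1 := congrArg Matrix.trace (map_mul_res (gram_isSymm c B) hz)
  have h2 := congrArg Matrix.trace (res_mul_map (gram_isSymm c Bᵀ) hz)
  have h3 : ((gram c B).map Complex.ofReal * res (gram c B) z).trace
      = (res (gram c Bᵀ) z * (gram c Bᵀ).map Complex.ofReal).trace := by
    rw [gram_map, gram_map, Matrix.smul_mul, Matrix.mul_smul, Matrix.trace_smul, Matrix.trace_smul,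
      Matrix.mul_assoc, transpose_mul_res_gram hz, Matrix.transpose_map,
      Matrix.transpose_transpose, ← Matrix.mul_assoc, Matrix.trace_mul_comm,
      ← Matrix.mul_assoc, Matrix.trace_mul_comm]
  rw [h3, h2, Matrix.trace_add, Matrix.trace_add, Matrix.trace_smul, Matrix.trace_smul] at h1
  have h4 : z ≠ 0 := by rintro rfl; simp at hz
  exact mul_left_cancel₀ h4 (add_left_cancel h1)

theorem flowGen_transpose : (flowGen c z B)ᵀ = -flowGen c z B := by
  ext i j
  simp only [flowGen, Matrix.transpose_apply, Matrix.of_apply, Matrix.neg_apply, sgnLower]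
  rw [res_symm (gram_isSymm c B) j i]
  rcases lt_trichotomy i j with h | h | h
  · simp [h, h.not_gt]
  · simp [h]
  · simp [h, h.not_gt]

/-- The velocity field has the form `S B - B S̃` with skew-symmetric `S` and `S̃`. This is where
the bidiagonal shape enters: on the support of `B` the two triangular truncations in
`(S B - B S̃) i j` differ from a common multiple of `(G B - B G̃) i j = 0` only by diagonal
terms. -/
theorem flowVel_eq (hB : IsLowerBidiagonal B) (hz : z.im ≠ 0) :
    flowVel c z B = flowGen c z B * B.map Complex.ofReal
      - B.map Complex.ofReal * flowGen c z Bᵀ := by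
  have h := res_gram_mul (c := c) (B := B) hz
  ext i j
  have hij := congrFun (congrFun h i) j
  rw [Matrix.mul_apply, Matrix.mul_apply] at hij
  simp only [flowVel, flowGen, Matrix.of_apply, Matrix.sub_apply, Matrix.mul_apply,
    Matrix.map_apply, flowRate] at hij ⊢
  -- if `k` is in the support of the column `j`, then the position of `k` relative to `i` is
  -- determined by that of `j`, except when `k = i`
  have key : ∀ k, B k j ≠ 0 →
      sgnLower i k = (if i ≤ j then -1 else 1) + sgnBidiag i j * (if k = i then 1 else 0) := by
    intro k hk
    have h0 : k = j ∨ (k : ℕ) = j + 1 := by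
      by_contra! hc
      exact hk (hB k j hc.1 hc.2)
    simp only [sgnLower, sgnBidiag, Fin.ext_iff, Fin.lt_def, Fin.le_def] at h0 ⊢
    split_ifs <;> first | omega | norm_num
  have key' : ∀ k, B i k ≠ 0 →
      sgnLower k j = (if i ≤ j then -1 else 1) + sgnBidiag i j * (if k = j then 1 else 0) := by
    intro k hk
    have h0 : i = k ∨ (i : ℕ) = k + 1 := by
      by_contra! hc
      exact hk (hB i k hc.1 hc.2)
    simp only [sgnLower, sgnBidiag, Fin.ext_iff, Fin.lt_def, Fin.le_def] at h0 ⊢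
    split_ifs <;> first | omega | norm_num
  have e1 : ∑ k, 1 / 2 * sgnLower i k * res (gram c B) z i k * (B k j : ℂ)
      = 1 / 2 * ((if i ≤ j then -1 else 1) * ∑ k, res (gram c B) z i k * (B k j : ℂ)
        + sgnBidiag i j * (res (gram c B) z i i * B i j)) := by
    have : res (gram c B) z i i * (B i j : ℂ)
        = ∑ k, (if k = i then 1 else 0) * (res (gram c B) z i k * B k j) := by simp
    rw [this, Finset.mul_sum, Finset.mul_sum, ← Finset.sum_add_distrib, Finset.mul_sum]
    refine Finset.sum_congr rfl fun k _ => ?_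
    by_cases hk : B k j = 0
    · simp [hk]
    · rw [key k hk]; ring
  have e2 : ∑ k, (B i k : ℂ) * (1 / 2 * sgnLower k j * res (gram c Bᵀ) z k j)
      = 1 / 2 * ((if i ≤ j then -1 else 1) * ∑ k, (B i k : ℂ) * res (gram c Bᵀ) z k j
        + sgnBidiag i j * (B i j * res (gram c Bᵀ) z j j)) := by
    have : (B i j : ℂ) * res (gram c Bᵀ) z j j
        = ∑ k, (if k = j then 1 else 0) * ((B i k : ℂ) * res (gram c Bᵀ) z k j) := by simp
    rw [this, Finset.mul_sum, Finset.mul_sum, ← Finset.sum_add_distrib, Finset.mul_sum]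
    refine Finset.sum_congr rfl fun k _ => ?_
    by_cases hk : B i k = 0
    · simp [hk]
    · rw [key' k hk]; ring
  rw [e1, e2, hij]
  ring

theorem trace_skew_mul_symm {S T : Matrix (Fin m) (Fin m) ℂ} (hS : Sᵀ = -S) (hT : Tᵀ = T) :
    (S * T).trace = 0 := by
  have h : (S * T).trace = -(S * T).trace := by
    conv_lhs => rw [← Matrix.trace_transpose, Matrix.transpose_mul, hS, hT, Matrix.mul_neg,
      Matrix.trace_neg, Matrix.trace_mul_comm]
  exact self_eq_neg.1 h

/-- The flow preserves `tr (B Bᵀ)`: this disposes of the Gaussian weights in the integration by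
parts. -/
theorem sum_sq_mul_flowRate (hB : IsLowerBidiagonal B) (hz : z.im ≠ 0) :
    ∑ i, ∑ j, (B i j : ℂ) ^ 2 * flowRate c z i j B = 0 := by
  have h : ∑ i, ∑ j, (B i j : ℂ) ^ 2 * flowRate c z i j B
      = (flowVel c z B * (B.map Complex.ofReal)ᵀ).trace := by
    simp only [Matrix.trace, Matrix.diag, Matrix.mul_apply, flowVel, Matrix.of_apply,
      Matrix.transpose_apply, Matrix.map_apply]
    refine Finset.sum_congr rfl fun i _ => Finset.sum_congr rfl fun j _ => ?_
    ring
  rw [h, flowVel_eq hB hz, Matrix.sub_mul, Matrix.trace_sub, Matrix.mul_assoc,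
    trace_skew_mul_symm flowGen_transpose (by simp [Matrix.transpose_mul]),
    Matrix.trace_mul_comm, ← Matrix.mul_assoc, Matrix.trace_mul_comm,
    trace_skew_mul_symm flowGen_transpose (by simp [Matrix.transpose_mul]), sub_zero]

/-- Derivative of the resolvent along the flow: a commutator with the generator. -/
theorem sum_flowVel_mul_dres (hB : IsLowerBidiagonal B) (hz : z.im ≠ 0) {w : ℂ} (hw : w.im ≠ 0)
    (k l : Fin m) :
    ∑ i, ∑ j, flowVel c z B i j * dres c w i j k l B
      = (flowGen c z B * res (gram c B) w - res (gram c B) w * flowGen c z B) k l := by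
  set b := B.map Complex.ofReal with hb
  set G := res (gram c B) w with hG
  have hGt : Gᵀ = G := res_transpose (gram_isSymm c B)
  set V := flowVel c z B with hV
  set S := flowGen c z B
  set S' := flowGen c z Bᵀ
  have h1 : ∑ i, ∑ j, V i j * dres c w i j k l B
      = (-(c : ℂ) • (G * (V * bᵀ + b * Vᵀ) * G)) k l := by
    have e : G * (V * bᵀ + b * Vᵀ) * G = G * V * (bᵀ * G) + (bᵀ * G)ᵀ * (Vᵀ * G) := by
      rw [Matrix.transpose_mul, hGt, Matrix.transpose_transpose]
      simp only [Matrix.mul_add, Matrix.add_mul, Matrix.mul_assoc]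
    rw [e, Matrix.smul_apply, Matrix.add_apply, Matrix.mul_apply, Matrix.mul_apply, smul_eq_mul,
      ← Finset.sum_add_distrib, Finset.mul_sum, Finset.sum_comm]
    refine Finset.sum_congr rfl fun j _ => ?_
    rw [Matrix.mul_apply (M := G), Matrix.mul_apply (M := Vᵀ), Finset.sum_mul, Finset.mul_sum,
      ← Finset.sum_add_distrib, Finset.mul_sum]
    refine Finset.sum_congr rfl fun i _ => ?_
    rw [dres, ← hb, ← hG, Matrix.transpose_apply, Matrix.transpose_apply]
    ring
  have h2 : V * bᵀ + b * Vᵀ = S * (b * bᵀ) - (b * bᵀ) * S := by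
    rw [hV, flowVel_eq hB hz, ← hb, Matrix.transpose_sub, Matrix.transpose_mul,
      Matrix.transpose_mul, flowGen_transpose, flowGen_transpose]
    simp only [Matrix.mul_sub, Matrix.sub_mul, Matrix.mul_neg, Matrix.neg_mul, Matrix.mul_assoc]
    abel
  have h3 := map_mul_res (gram_isSymm c B) hw
  have h4 := res_mul_map (gram_isSymm c B) hw
  rw [gram_map, ← hb, ← hG] at h3 h4
  rw [h1, h2]
  have h5 : -(c : ℂ) • (G * (S * (b * bᵀ) - b * bᵀ * S) * G)
      = (G * ((c : ℂ) • (b * bᵀ))) * S * G - G * S * (((c : ℂ) • (b * bᵀ)) * G) := by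
    simp only [Matrix.mul_sub, Matrix.sub_mul, Matrix.mul_smul, Matrix.smul_mul, Matrix.mul_assoc,
      smul_sub, neg_smul]
    abel
  rw [h5, h3, h4]
  simp only [Matrix.mul_add, Matrix.add_mul, Matrix.mul_smul, Matrix.smul_mul, Matrix.mul_assoc,
    Matrix.one_mul, Matrix.mul_one]
  rw [add_sub_add_right_eq_sub]

/-- The derivative of `flowRate i j` with respect to `B i j`. -/
noncomputable def dflowRate (c : ℝ) (z : ℂ) (i j : Fin m) (B : Matrix (Fin m) (Fin m) ℝ) : ℂ :=
  1 / 2 * sgnBidiag i j * (dres c z i j i i B - dres c z j i j j Bᵀ)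

/-- The isospectral flow is divergence free in logarithmic coordinates. With
`q i j = c * B i j * (Bᵀ G) j i`, the row and column sums of `q` are `1 + z * G i i` and
`1 + z * G̃ j j`, so `z` times the divergence is a quadratic form in `q`, which cancels. -/
theorem sum_mul_dflowRate (hB : IsLowerBidiagonal B) (hz : z.im ≠ 0) :
    ∑ i, ∑ j, (B i j : ℂ) * dflowRate c z i j B = 0 := by
  set b := B.map Complex.ofReal with hb
  set G := res (gram c B) z with hG
  set G' := res (gram c Bᵀ) z with hG'
  set H := bᵀ * G with hH
  have hbt : (Bᵀ).map Complex.ofReal = bᵀ := by rw [hb, Matrix.transpose_map]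
  have hH' : bᵀᵀ * G' = Hᵀ := by
    rw [hH, Matrix.transpose_mul, Matrix.transpose_transpose,
      show Gᵀ = G from res_transpose (gram_isSymm c B), res_gram_mul hz]
  have hz0 : z ≠ 0 := by rintro rfl; simp at hz
  let q : Fin m → Fin m → ℂ := fun i j => c * (b i j * H j i)
  have hq0 : ∀ i j : Fin m, i ≠ j → (i : ℕ) ≠ j + 1 → q i j = 0 := by
    intro i j h1 h2
    simp [q, hb, hB i j h1 h2]
  have hrow : ∀ i, ∑ j, q i j = 1 + z * G i i := by
    intro i
    have h := congrFun (congrFun (map_mul_res (gram_isSymm c B) hz) i) i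
    rw [gram_map, ← hb, Matrix.smul_mul, Matrix.mul_assoc, ← hG, ← hH, Matrix.smul_apply,
      Matrix.mul_apply] at h
    simpa [q, Finset.mul_sum] using h
  have hcol : ∀ j, ∑ i, q i j = 1 + z * G' j j := by
    intro j
    have h := congrFun (congrFun (res_mul_map (gram_isSymm c Bᵀ) hz) j) j
    rw [gram_map, hbt, Matrix.transpose_transpose, Matrix.mul_smul, ← Matrix.mul_assoc, ← hG',
      ← transpose_mul_res_gram hz, ← hH, Matrix.smul_apply, Matrix.mul_apply] at h
    simp only [Matrix.add_apply, Matrix.one_apply_eq, Matrix.smul_apply, smul_eq_mul] at h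
    rw [← h, Finset.mul_sum]
    refine Finset.sum_congr rfl fun i _ => ?_
    simp only [q]; ring
  have hterm : ∀ i j, (B i j : ℂ) * dflowRate c z i j B
      = -(sgnBidiag i j * q i j * (G i i - G' j j)) := by
    intro i j
    simp only [dflowRate, dres, hbt, ← hb, ← hG, ← hG', ← hH, hH', Matrix.transpose_apply, q]
    simp only [hb, Matrix.map_apply]
    ring
  have hz_term : ∀ i j, z * (sgnBidiag i j * q i j * (G i i - G' j j))
      = ∑ k, sgnBidiag i j * q i j * q i k - ∑ k, sgnBidiag i j * q i j * q k j := by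
    intro i j
    rw [← Finset.mul_sum (f := fun k => q i k), ← Finset.mul_sum (f := fun k => q k j), hrow, hcol]
    ring
  -- antisymmetrising the row sums and column sums leaves only the squares
  have hR : ∑ i, ∑ j, ∑ k, sgnBidiag i j * q i j * q i k
      = ∑ i, ∑ j, sgnBidiag i j * q i j ^ 2 := by
    refine Finset.sum_congr rfl fun i _ => ?_
    have e : ∀ j k, sgnBidiag i j * q i j * q i k + sgnBidiag i k * q i k * q i j
        = if j = k then 2 * (sgnBidiag i j * q i j ^ 2) else 0 := by
      intro j k
      split_ifs with h
      · subst h; ring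
      · by_cases hj : q i j = 0
        · simp [hj]
        by_cases hk : q i k = 0
        · simp [hk]
        have h1 : i = j ∨ (i : ℕ) = j + 1 := by
          by_contra! hc; exact hj (hq0 i j hc.1 hc.2)
        have h2 : i = k ∨ (i : ℕ) = k + 1 := by
          by_contra! hc; exact hk (hq0 i k hc.1 hc.2)
        have : sgnBidiag i j + sgnBidiag i k = 0 := by
          simp only [sgnBidiag, Fin.ext_iff] at h h1 h2 ⊢
          split_ifs <;> first | omega | norm_num
        linear_combination (q i j * q i k) * this
    have e2 : (∑ j, ∑ k, sgnBidiag i j * q i j * q i k)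
        + ∑ j, ∑ k, sgnBidiag i k * q i k * q i j = 2 * ∑ j, sgnBidiag i j * q i j ^ 2 := by
      rw [← Finset.sum_add_distrib, Finset.mul_sum]
      refine Finset.sum_congr rfl fun j _ => ?_
      rw [← Finset.sum_add_distrib, Finset.sum_congr rfl fun k _ => e j k]
      simp
    have e3 : ∑ j, ∑ k, sgnBidiag i k * q i k * q i j
        = ∑ j, ∑ k, sgnBidiag i j * q i j * q i k := Finset.sum_comm
    rw [e3] at e2
    linear_combination e2 / 2
  have hC : ∑ i, ∑ j, ∑ k, sgnBidiag i j * q i j * q k j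
      = ∑ i, ∑ j, sgnBidiag i j * q i j ^ 2 := by
    rw [Finset.sum_comm, Finset.sum_comm (f := fun i j => sgnBidiag i j * q i j ^ 2)]
    refine Finset.sum_congr rfl fun j _ => ?_
    have e : ∀ i k, sgnBidiag i j * q i j * q k j + sgnBidiag k j * q k j * q i j
        = if i = k then 2 * (sgnBidiag i j * q i j ^ 2) else 0 := by
      intro i k
      split_ifs with h
      · subst h; ring
      · by_cases hi : q i j = 0
        · simp [hi]
        by_cases hk : q k j = 0
        · simp [hk]
        have h1 : i = j ∨ (i : ℕ) = j + 1 := by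
          by_contra! hc; exact hi (hq0 i j hc.1 hc.2)
        have h2 : k = j ∨ (k : ℕ) = j + 1 := by
          by_contra! hc; exact hk (hq0 k j hc.1 hc.2)
        have : sgnBidiag i j + sgnBidiag k j = 0 := by
          simp only [sgnBidiag, Fin.ext_iff] at h h1 h2 ⊢
          split_ifs <;> first | omega | norm_num
        linear_combination (q i j * q k j) * this
    have e2 : (∑ i, ∑ k, sgnBidiag i j * q i j * q k j)
        + ∑ i, ∑ k, sgnBidiag k j * q k j * q i j = 2 * ∑ i, sgnBidiag i j * q i j ^ 2 := by
      rw [← Finset.sum_add_distrib, Finset.mul_sum]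
      refine Finset.sum_congr rfl fun i _ => ?_
      rw [← Finset.sum_add_distrib, Finset.sum_congr rfl fun k _ => e i k]
      simp
    have e3 : ∑ i, ∑ k, sgnBidiag k j * q k j * q i j
        = ∑ i, ∑ k, sgnBidiag i j * q i j * q k j := Finset.sum_comm
    rw [e3] at e2
    linear_combination e2 / 2
  have hsum : z * ∑ i, ∑ j, (B i j : ℂ) * dflowRate c z i j B = 0 := by
    simp only [hterm, Finset.sum_neg_distrib, mul_neg, Finset.mul_sum, hz_term,
      Finset.sum_sub_distrib, hR, hC, sub_self, neg_zero]
  exact (mul_eq_zero.1 hsum).resolve_left hz0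

end Algebra

/-- The number of degrees of freedom of the `χ` variable in position `(i, j)` of the bidiagonal
model. -/
def chiParam (β a : ℝ) {m : ℕ} (i j : Fin m) : ℝ :=
  if i = j then 2 * a - β * (i : ℕ) else β * ((m : ℝ) - (i : ℕ))

/-- The weighted sum of the flow rates is the difference between the trace of the resolvent and
`m` times its corner entry: the parameters of the `χ` variables telescope. -/
theorem sum_chiParam_mul_flowRate (β a c : ℝ) {n : ℕ} (B : Matrix (Fin (n + 1)) (Fin (n + 1)) ℝ)
    {z : ℂ} (hz : z.im ≠ 0) :
    ∑ i, ∑ j, (chiParam β a i j : ℂ) * flowRate c z i j B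
      = β / 2 * ((n + 1) * res (gram c B) z 0 0 - (res (gram c B) z).trace) := by
  set G := res (gram c B) z with hG
  set G' := res (gram c Bᵀ) z with hG'
  have htr : G'.trace = G.trace := trace_res_gram_transpose hz
  have e1 : ∀ i : Fin (n + 1), ∑ j, sgnBidiag i j * (chiParam β a i j : ℂ)
      = (2 * a - β * (n + 1)) + if i = 0 then (β * (n + 1) : ℂ) else 0 := by
    intro i
    refine Fin.cases ?_ (fun k => ?_) i
    · rw [Finset.sum_eq_single 0]
      · simp [sgnBidiag, chiParam]
      · intro j _ hj
        simp [sgnBidiag, hj.symm]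
      · simp
    · have hne : k.succ ≠ k.castSucc := by simp [Fin.ext_iff]
      rw [Finset.sum_eq_add_of_mem k.succ k.castSucc (Finset.mem_univ _) (Finset.mem_univ _) hne]
      · simp [sgnBidiag, chiParam, hne]
        ring
      · intro j _ hj
        have h1 : ¬ (k.succ = j) := fun h => hj.1 h.symm
        have h2 : ¬ ((k.succ : ℕ) = j + 1) := by
          intro h; apply hj.2; ext; simp at h ⊢; omega
        simp only [sgnBidiag, h1, h2, if_false, zero_mul]
  have e2 : ∀ j : Fin (n + 1), ∑ i, sgnBidiag i j * (chiParam β a i j : ℂ)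
      = 2 * a - β * n := by
    intro j
    refine Fin.lastCases ?_ (fun k => ?_) j
    · rw [Finset.sum_eq_single (Fin.last n)]
      · simp [sgnBidiag, chiParam]
      · intro i _ hi
        have : ¬ ((i : ℕ) = n + 1) := by omega
        simp [sgnBidiag, hi, this]
      · simp
    · have hne : k.succ ≠ k.castSucc := by simp [Fin.ext_iff]
      rw [Finset.sum_eq_add_of_mem k.succ k.castSucc (Finset.mem_univ _) (Finset.mem_univ _) hne]
      · simp [sgnBidiag, chiParam, hne]
        ring
      · intro i _ hi
        have h2 : ¬ ((i : ℕ) = k.castSucc + 1) := by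
          intro h; apply hi.1; ext; simp at h ⊢; omega
        simp only [sgnBidiag, hi.2, h2, if_false, zero_mul]
  have e3 : ∑ i, ∑ j, (chiParam β a i j : ℂ) * flowRate c z i j B
      = 1 / 2 * (∑ i, (∑ j, sgnBidiag i j * (chiParam β a i j : ℂ)) * G i i
        - ∑ j, (∑ i, sgnBidiag i j * (chiParam β a i j : ℂ)) * G' j j) := by
    simp only [Finset.sum_mul]
    rw [Finset.sum_comm (f := fun j i => sgnBidiag i j * (chiParam β a i j : ℂ) * G' j j),
      ← Finset.sum_sub_distrib, Finset.mul_sum]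
    refine Finset.sum_congr rfl fun i _ => ?_
    rw [← Finset.sum_sub_distrib, Finset.mul_sum]
    refine Finset.sum_congr rfl fun j _ => ?_
    rw [flowRate]; ring
  rw [e3]
  simp only [e1, e2, add_mul, Finset.sum_add_distrib, ← Finset.mul_sum, ite_mul, zero_mul,
    Finset.sum_ite_eq', Finset.mem_univ, if_true]
  have t1 : ∑ i, G i i = G.trace := rfl
  have t2 : ∑ i, G' i i = G'.trace := rfl
  rw [t1, t2, htr]
  ring

/-! ### The chi distribution -/

section Chi

open Real Set Filter Topology

variable {r : ℝ}

theorem measurable_chiPDFReal (r : ℝ) : Measurable (chiPDFReal r) := by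
  unfold chiPDFReal
  refine Measurable.ite measurableSet_Ioi ?_ measurable_const
  fun_prop

theorem chiPDFReal_nonneg (hr : 0 < r) (x : ℝ) : 0 ≤ chiPDFReal r x := by
  unfold chiPDFReal
  split_ifs with h
  · have := Real.Gamma_pos_of_pos (half_pos hr)
    positivity
  · exact le_rfl

/-- The normalizing constant of the density of `χ_r`. -/
noncomputable def chiConst (r : ℝ) : ℝ := 2 ^ (1 - r / 2) / Real.Gamma (r / 2)

theorem chiPDFReal_smul {E : Type*} [AddCommGroup E] [Module ℝ E] (f : ℝ → E) :
    (fun x => chiPDFReal r x • f x)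
      = (Ioi 0).indicator fun x => chiConst r • (x ^ (r - 1) * exp (-(1 / 2) * x ^ 2)) • f x := by
  ext x
  by_cases hx : 0 < x
  · rw [indicator_of_mem (mem_Ioi.2 hx), chiPDFReal, if_pos hx, smul_smul, chiConst]
    congr 1
    rw [show -(x ^ 2) / 2 = -(1 / 2) * x ^ 2 by ring]
    ring
  · rw [indicator_of_notMem (by simpa using hx), chiPDFReal, if_neg hx, zero_smul]

theorem integral_chiMeasure {E : Type*} [NormedAddCommGroup E] [NormedSpace ℝ E] (hr : 0 < r)
    (f : ℝ → E) : ∫ x, f x ∂chiMeasure r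
      = chiConst r • ∫ x in Ioi 0, (x ^ (r - 1) * exp (-(1 / 2) * x ^ 2)) • f x := by
  rw [chiMeasure, integral_withDensity_eq_integral_toReal_smul
    (measurable_chiPDFReal r).ennreal_ofReal (by simp)]
  simp only [ENNReal.toReal_ofReal (chiPDFReal_nonneg hr _)]
  rw [chiPDFReal_smul, integral_indicator measurableSet_Ioi, integral_smul]

/-- Integrability against `χ_r` reduces to that against its density without the constant. -/
theorem integrable_chiMeasure {E : Type*} [NormedAddCommGroup E] [NormedSpace ℝ E] (hr : 0 < r)
    {f : ℝ → E}
    (hf : IntegrableOn (fun x => (x ^ (r - 1) * exp (-(1 / 2) * x ^ 2)) • f x) (Ioi 0)) :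
    Integrable f (chiMeasure r) := by
  rw [chiMeasure, integrable_withDensity_iff_integrable_smul'
    (measurable_chiPDFReal r).ennreal_ofReal (by simp)]
  simp only [ENNReal.toReal_ofReal (chiPDFReal_nonneg hr _)]
  rw [chiPDFReal_smul, integrable_indicator_iff measurableSet_Ioi]
  exact Integrable.smul _ hf

/-- The moment generating function of the square of a `χ_r` variable. -/
theorem integral_exp_mul_sq_chiMeasure (hr : 0 < r) {t : ℝ} (ht : t < 1 / 2) :
    Integrable (fun x => exp (t * x ^ 2)) (chiMeasure r) ∧
      ∫ x, exp (t * x ^ 2) ∂chiMeasure r = (1 - 2 * t) ^ (-(r / 2)) := by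
  have hb : 0 < 1 / 2 - t := by linarith
  have e : (fun x : ℝ => (x ^ (r - 1) * exp (-(1 / 2) * x ^ 2)) • exp (t * x ^ 2))
      = fun x => x ^ (r - 1) * exp (-(1 / 2 - t) * x ^ 2) := by
    ext x
    rw [smul_eq_mul, mul_assoc, ← Real.exp_add]
    ring_nf
  refine ⟨integrable_chiMeasure hr ?_, ?_⟩
  · rw [e]
    exact integrableOn_rpow_mul_exp_neg_mul_sq hb (by linarith)
  · rw [integral_chiMeasure hr, e]
    have h := integral_rpow_mul_exp_neg_mul_rpow (p := 2) (q := r - 1) two_pos (by linarith) hb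
    simp only [rpow_two] at h
    rw [h, chiConst, smul_eq_mul]
    have hG := (Real.Gamma_pos_of_pos (half_pos hr)).ne'
    have h1 : (1 / 2 - t) ^ (-(r - 1 + 1) / 2) = (1 - 2 * t) ^ (-(r / 2)) * 2 ^ (r / 2) := by
      rw [show 1 / 2 - t = (1 - 2 * t) * 2⁻¹ by ring, mul_rpow (by linarith) (by norm_num),
        inv_rpow (by norm_num), ← rpow_neg (by norm_num)]
      ring_nf
    have h2 : (2 : ℝ) ^ (1 - r / 2) = 2 / 2 ^ (r / 2) := by
      rw [rpow_sub two_pos, rpow_one]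
    rw [h1, h2, show (r - 1 + 1) / 2 = r / 2 by ring]
    have h3 : (0 : ℝ) < 2 ^ (r / 2) := by positivity
    field_simp

theorem isProbabilityMeasure_chiMeasure (hr : 0 < r) : IsProbabilityMeasure (chiMeasure r) := by
  obtain ⟨h1, h2⟩ := integral_exp_mul_sq_chiMeasure hr (t := 0) (by norm_num)
  simp only [zero_mul, exp_zero] at h1 h2
  have : IsFiniteMeasure (chiMeasure r) := (integrable_const_iff_isFiniteMeasure one_ne_zero).1 h1
  refine ⟨?_⟩
  have h3 : (chiMeasure r).real univ = 1 := by simpa using h2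
  rw [← ENNReal.ofReal_toReal (measure_ne_top (chiMeasure r) univ)]
  rw [Measure.real] at h3
  rw [h3, ENNReal.ofReal_one]

/-- Chernoff's bound for the square of a `χ_r` variable, with exponential parameter `± δ / 8`. -/
theorem chiMeasure_abs_sq_sub_ge_le (hr : 0 < r) {δ : ℝ} (hδ : 0 < δ) (hδ1 : δ ≤ 1) :
    (chiMeasure r).real {x | δ * r ≤ |x ^ 2 - r|} ≤ 2 * exp (-(δ ^ 2 / 16 * r)) := by
  have := isProbabilityMeasure_chiMeasure hr
  have key : ∀ t : ℝ, |t| ≤ 1 / 8 →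
      mgf (fun x => x ^ 2) (chiMeasure r) t ≤ exp (r * (t + 4 * t ^ 2)) := by
    intro t ht
    have ht' := abs_le.1 ht
    have hpos : 0 < 1 - 2 * t := by linarith
    rw [mgf, (integral_exp_mul_sq_chiMeasure hr (by linarith)).2, rpow_def_of_pos hpos]
    refine Real.exp_le_exp.2 ?_
    have h1 := Real.one_sub_inv_le_log_of_pos hpos
    have h2 : -(2 * t + 8 * t ^ 2) ≤ 1 - (1 - 2 * t)⁻¹ := by
      rw [← sub_nonneg]
      have : 1 - (1 - 2 * t)⁻¹ - -(2 * t + 8 * t ^ 2)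
          = (4 * t ^ 2 * (1 - 4 * t)) / (1 - 2 * t) := by
        field_simp
        ring
      rw [this]
      have : 0 ≤ 1 - 4 * t := by linarith
      positivity
    nlinarith
  have hint : ∀ t : ℝ, |t| ≤ 1 / 8 → Integrable (fun x => exp (t * x ^ 2)) (chiMeasure r) :=
    fun t ht => (integral_exp_mul_sq_chiMeasure hr (by linarith [(abs_le.1 ht).2])).1
  have hb : |δ / 8| ≤ 1 / 8 := by rw [abs_of_pos (by positivity)]; linarith
  have hb' : |-(δ / 8)| ≤ 1 / 8 := by rwa [abs_neg]
  have h1 := measure_ge_le_exp_mul_mgf (X := fun x : ℝ => x ^ 2) (μ := chiMeasure r)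
    ((1 + δ) * r) (by positivity) (hint (δ / 8) hb)
  have h2 := measure_le_le_exp_mul_mgf (X := fun x : ℝ => x ^ 2) (μ := chiMeasure r)
    ((1 - δ) * r) (by linarith : -(δ / 8) ≤ 0) (hint (-(δ / 8)) hb')
  have e1 : exp (-(δ / 8) * ((1 + δ) * r)) * mgf (fun x => x ^ 2) (chiMeasure r) (δ / 8)
      ≤ exp (-(δ ^ 2 / 16 * r)) := by
    refine (mul_le_mul_of_nonneg_left (key _ hb) (exp_pos _).le).trans ?_
    rw [← Real.exp_add]
    refine Real.exp_le_exp.2 (le_of_eq ?_)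
    ring
  have e2 : exp (-(-(δ / 8)) * ((1 - δ) * r)) * mgf (fun x => x ^ 2) (chiMeasure r) (-(δ / 8))
      ≤ exp (-(δ ^ 2 / 16 * r)) := by
    refine (mul_le_mul_of_nonneg_left (key _ hb') (exp_pos _).le).trans ?_
    rw [← Real.exp_add]
    refine Real.exp_le_exp.2 (le_of_eq ?_)
    ring
  have hsub : {x : ℝ | δ * r ≤ |x ^ 2 - r|}
      ⊆ {x | (1 + δ) * r ≤ x ^ 2} ∪ {x | x ^ 2 ≤ (1 - δ) * r} := by
    intro x hx
    simp only [mem_ofPred_eq, mem_union] at hx ⊢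
    rcases le_abs.1 hx with h | h
    · left; linarith
    · right; linarith
  refine (measureReal_mono hsub).trans ((measureReal_union_le _ _).trans ?_)
  linarith [h1.trans e1, h2.trans e2]

theorem integrable_chiMeasure_of_bound {f : ℝ → ℂ} (hr : 0 < r)
    (hf : AEStronglyMeasurable f (chiMeasure r)) {C : ℝ} (hC : ∀ x, ‖f x‖ ≤ C * (1 + x ^ 2)) :
    Integrable f (chiMeasure r) := by
  have h : Integrable (fun x : ℝ => C * (1 + x ^ 2)) (chiMeasure r) := by
    refine integrable_chiMeasure hr ?_
    have h1 := (integrableOn_rpow_mul_exp_neg_mul_sq (b := 1 / 2) (by norm_num)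
      (by linarith : -1 < r - 1)).const_mul C
    have h2 := (integrableOn_rpow_mul_exp_neg_mul_sq (b := 1 / 2) (by norm_num)
      (by linarith : -1 < r + 1)).const_mul C
    refine IntegrableOn.congr_fun (h1.add h2) (fun x hx => ?_) measurableSet_Ioi
    simp only [Pi.add_apply, smul_eq_mul]
    rw [show r + 1 = r - 1 + 2 by ring, rpow_add hx, rpow_two]
    ring
  exact h.mono' hf (Eventually.of_forall hC)

/-- Integration by parts for the `χ_r` distribution. -/
theorem integral_chiMeasure_stein (hr : 0 < r) {f f' : ℝ → ℂ} (hf : ∀ x, HasDerivAt f (f' x) x)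
    (hf' : Continuous f') {C : ℝ} (hC : ∀ x, ‖f x‖ ≤ C) (hC' : ∀ x, ‖f' x‖ ≤ C) :
    ∫ x, ((x : ℂ) * f' x + ((r : ℂ) - (x : ℂ) ^ 2) * f x) ∂chiMeasure r = 0 := by
  have hcont : Continuous f := continuous_iff_continuousAt.2 fun x => (hf x).continuousAt
  have hC0 : 0 ≤ C := (norm_nonneg _).trans (hC 0)
  let w : ℝ → ℝ := fun x => x ^ r * exp (-(1 / 2) * x ^ 2)
  let D : ℝ → ℂ := fun x => (x ^ (r - 1) * exp (-(1 / 2) * x ^ 2)) •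
    ((x : ℂ) * f' x + ((r : ℂ) - (x : ℂ) ^ 2) * f x)
  rw [integral_chiMeasure hr]
  have hderiv : ∀ x ∈ Ioi (0 : ℝ), HasDerivAt (fun x => (w x : ℂ) * f x) (D x) x := by
    intro x hx
    have hx0 : (0 : ℝ) < x := hx
    have h1 : HasDerivAt w (r * x ^ (r - 1) * exp (-(1 / 2) * x ^ 2)
        + x ^ r * (exp (-(1 / 2) * x ^ 2) * (-(1 / 2) * (2 * x)))) x := by
      refine (Real.hasDerivAt_rpow_const (Or.inl hx0.ne')).mul ?_
      refine HasDerivAt.exp ?_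
      simpa using (hasDerivAt_pow 2 x).const_mul (-(1 / 2) : ℝ)
    have h2 := (h1.ofReal_comp).mul (hf x)
    refine h2.congr_deriv ?_
    have e : x ^ r = x ^ (r - 1) * x := by
      rw [← rpow_add_one hx0.ne']; ring_nf
    simp only [D, w, Complex.real_smul, e]
    push_cast
    ring
  have hwint : ∀ s : ℝ, -1 < s →
      IntegrableOn (fun x : ℝ => x ^ s * exp (-(1 / 2) * x ^ 2)) (Ioi 0) :=
    fun s hs => integrableOn_rpow_mul_exp_neg_mul_sq (by norm_num) hs
  have hint : IntegrableOn D (Ioi 0) := by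
    have hb : IntegrableOn (fun x : ℝ => C * (x ^ r * exp (-(1 / 2) * x ^ 2))
        + (r * C * (x ^ (r - 1) * exp (-(1 / 2) * x ^ 2))
          + C * (x ^ (r + 1) * exp (-(1 / 2) * x ^ 2)))) (Ioi 0) :=
      ((hwint r (by linarith)).const_mul C).add
        (((hwint (r - 1) (by linarith)).const_mul (r * C)).add
          ((hwint (r + 1) (by linarith)).const_mul C))
    refine Integrable.mono' hb ?_ ?_
    · refine AEStronglyMeasurable.smul (f := fun x : ℝ => x ^ (r - 1) * exp (-(1 / 2) * x ^ 2))
        (hwint (r - 1) (by linarith)).aestronglyMeasurable ?_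
      fun_prop
    · filter_upwards [ae_restrict_mem measurableSet_Ioi] with x hx
      have hx0 : (0 : ℝ) < x := hx
      have e1 : x ^ r = x ^ (r - 1) * x := by
        rw [← rpow_add_one hx0.ne']; ring_nf
      have e2 : x ^ (r + 1) = x ^ (r - 1) * x ^ 2 := by
        rw [← rpow_two, ← rpow_add hx0]; ring_nf
      have hp : 0 ≤ x ^ (r - 1) * exp (-(1 / 2) * x ^ 2) := by positivity
      simp only [D]
      rw [norm_smul, Real.norm_of_nonneg hp, e1, e2]
      calc _ ≤ x ^ (r - 1) * exp (-(1 / 2) * x ^ 2) * (x * C + (r + x ^ 2) * C) := by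
            gcongr
            refine (norm_add_le _ _).trans ?_
            rw [norm_mul, norm_mul, Complex.norm_real, Real.norm_of_nonneg hx0.le]
            have : ‖(r : ℂ) - (x : ℂ) ^ 2‖ ≤ r + x ^ 2 := by
              refine (norm_sub_le _ _).trans ?_
              rw [norm_pow, Complex.norm_real, Complex.norm_real, Real.norm_of_nonneg hr.le,
                Real.norm_of_nonneg hx0.le]
            gcongr
            · exact hC' x
            · exact hC x
        _ = _ := by ring
  have hlim : Tendsto (fun x => (w x : ℂ) * f x) atTop (𝓝 0) := by
    rw [tendsto_zero_iff_norm_tendsto_zero]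
    have h1 : Tendsto (fun x : ℝ => x ^ r * exp (-(1 / 2) * x ^ 2)) atTop (𝓝 0) := by
      refine (rpow_mul_exp_neg_mul_sq_isLittleO_exp_neg (by norm_num) r).trans_tendsto ?_
      have := tendsto_rpow_mul_exp_neg_mul_atTop_nhds_zero 0 (1 / 2) (by norm_num)
      simpa using this
    have h2 : Tendsto (fun x : ℝ => x ^ r * exp (-(1 / 2) * x ^ 2) * C) atTop (𝓝 0) := by
      simpa using h1.mul_const C
    refine squeeze_zero' (Eventually.of_forall fun x => norm_nonneg _) ?_ h2
    filter_upwards [eventually_ge_atTop 0] with x hx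
    rw [norm_mul, Complex.norm_real, Real.norm_of_nonneg (by positivity)]
    gcongr
    exact hC x
  have hcw : ContinuousWithinAt (fun x => (w x : ℂ) * f x) (Ici 0) 0 := by
    refine Continuous.continuousWithinAt ?_
    have : Continuous w := by
      refine Continuous.mul (continuous_id.rpow_const fun x => Or.inr hr.le) (by fun_prop)
    fun_prop
  have h := integral_Ioi_of_hasDerivAt_of_tendsto hcw hderiv hint hlim
  have h0 : w 0 = 0 := by simp [w, hr.ne']
  rw [h, h0]
  simp

end Chi

/-! ### Integration by parts in one entry of the model -/

section Decoupling

variable {α : Type*} [Fintype α] [DecidableEq α]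

/-- Resampling one coordinate of a product probability measure does not change it. -/
theorem map_update_prod_pi (ν : α → Measure ℝ) [∀ a, IsProbabilityMeasure (ν a)] (p : α) :
    ((ν p).prod (Measure.pi ν)).map (fun x : ℝ × (α → ℝ) => Function.update x.2 p x.1)
      = Measure.pi ν := by
  have hm : Measurable (fun x : ℝ × (α → ℝ) => Function.update x.2 p x.1) := by
    refine measurable_pi_lambda _ fun a => ?_
    by_cases h : a = p
    · subst h; simpa using measurable_fst
    · simp only [Function.update_of_ne h]
      fun_prop
  refine (Measure.pi_eq fun s hs => ?_).symm
  rw [Measure.map_apply hm (MeasurableSet.univ_pi hs)]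
  have e : (fun x : ℝ × (α → ℝ) => Function.update x.2 p x.1) ⁻¹' (Set.univ.pi s)
      = s p ×ˢ (Set.univ.pi (Function.update s p Set.univ)) := by
    ext x
    simp only [Set.mem_preimage, Set.mem_univ_pi, Set.mem_prod]
    constructor
    · intro h
      refine ⟨by simpa using h p, fun a => ?_⟩
      by_cases ha : a = p
      · subst ha; simp
      · simpa [Function.update_of_ne ha] using h a
    · rintro ⟨h1, h2⟩ a
      by_cases ha : a = p
      · subst ha; simpa using h1
      · simpa [Function.update_of_ne ha] using h2 a
  rw [e, Measure.prod_prod, Measure.pi_pi, ← Finset.mul_prod_erase _ _ (Finset.mem_univ p),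
    ← Finset.mul_prod_erase _ _ (Finset.mem_univ p)]
  simp only [Function.update_self, measure_univ, one_mul]
  congr 1
  refine Finset.prod_congr rfl fun a ha => ?_
  rw [Function.update_of_ne (Finset.ne_of_mem_erase ha)]

/-- A function on a product space has integral zero if all its integrals over one coordinate
vanish. -/
theorem integral_pi_eq_zero_of_update (ν : α → Measure ℝ) [∀ a, IsProbabilityMeasure (ν a)]
    (p : α) {f : (α → ℝ) → ℂ} (hf : Integrable f (Measure.pi ν))
    (h : ∀ q, ∫ ξ, f (Function.update q p ξ) ∂ν p = 0) : ∫ q, f q ∂Measure.pi ν = 0 := by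
  have hm : Measurable (fun x : ℝ × (α → ℝ) => Function.update x.2 p x.1) := by
    refine measurable_pi_lambda _ fun a => ?_
    by_cases h : a = p
    · subst h; simpa using measurable_fst
    · simp only [Function.update_of_ne h]
      fun_prop
  have h1 := map_update_prod_pi ν p
  rw [← h1] at hf
  have h2 := (integrable_map_measure hf.aestronglyMeasurable hm.aemeasurable).1 hf
  rw [← h1, integral_map hm.aemeasurable hf.aestronglyMeasurable,
    integral_prod_symm (fun x => f (Function.update x.2 p x.1)) h2]
  simp [h]

end Decoupling

namespace IsBidiagonalModel

variable {Ω : Type*} [MeasurableSpace Ω] {P : Measure Ω} {β a : ℝ} {m : ℕ}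
  {B : Ω → Matrix (Fin m) (Fin m) ℝ}

theorem isLowerBidiagonal (hB : IsBidiagonalModel P β a B) (ω : Ω) : IsLowerBidiagonal (B ω) :=
  fun i j h1 h2 => hB.eq_zero i j h1 h2 ω

theorem hasLaw (hB : IsBidiagonalModel P β a B) {i j : Fin m} (h : i = j ∨ (i : ℕ) = j + 1) :
    HasLaw (fun ω => B ω i j) (chiMeasure (chiParam β a i j)) P := by
  rcases h with h | h
  · subst h
    simpa [chiParam] using hB.hasLaw_diag i
  · have : i ≠ j := by rintro rfl; omega
    simpa [chiParam, this] using hB.hasLaw_subdiag i j h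

theorem aemeasurable (hB : IsBidiagonalModel P β a B) (i j : Fin m) :
    AEMeasurable (fun ω => B ω i j) P := by
  by_cases h : i = j ∨ (i : ℕ) = j + 1
  · exact (hB.hasLaw h).aemeasurable
  · push Not at h
    simp only [hB.eq_zero i j h.1 h.2]
    exact aemeasurable_const

theorem aemeasurable_pi (hB : IsBidiagonalModel P β a B) :
    AEMeasurable (fun ω (p : Fin m × Fin m) => B ω p.1 p.2) P :=
  aemeasurable_pi_lambda _ fun p => hB.aemeasurable p.1 p.2

theorem chiParam_pos (hβ : 0 < β) (ha : β * (m - 1) < 2 * a) {i j : Fin m} :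
    0 < chiParam β a i j := by
  have hi : ((i : ℕ) : ℝ) + 1 ≤ m := by exact_mod_cast i.2
  unfold chiParam
  split_ifs
  · nlinarith
  · exact mul_pos hβ (by linarith)

theorem aestronglyMeasurable_comp [IsProbabilityMeasure P] (hB : IsBidiagonalModel P β a B)
    {E : Type*} [TopologicalSpace E] [TopologicalSpace.PseudoMetrizableSpace E]
    [SecondCountableTopology E] [MeasurableSpace E] [BorelSpace E]
    {f : Matrix (Fin m) (Fin m) ℝ → E} (hf : Continuous f) :
    AEStronglyMeasurable (fun ω => f (B ω)) P := by
  have h : Continuous fun q : Fin m × Fin m → ℝ => f (Matrix.of fun i j => q (i, j)) :=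
    hf.comp (continuous_matrix fun i j => by fun_prop)
  exact (h.measurable.comp_aemeasurable hB.aemeasurable_pi).aestronglyMeasurable

theorem integrable_comp_of_bound [IsProbabilityMeasure P] (hB : IsBidiagonalModel P β a B)
    {E : Type*} [NormedAddCommGroup E] [SecondCountableTopology E] [MeasurableSpace E]
    [BorelSpace E] {f : Matrix (Fin m) (Fin m) ℝ → E} (hf : Continuous f) {C : ℝ}
    (hC : ∀ M, ‖f M‖ ≤ C) : Integrable (fun ω => f (B ω)) P :=
  Integrable.of_bound (hB.aestronglyMeasurable_comp hf) C
    (Filter.Eventually.of_forall fun _ => hC _)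

/-- Integration by parts with respect to one entry of the bidiagonal model. -/
theorem integral_stein [IsProbabilityMeasure P] (hB : IsBidiagonalModel P β a B) (hβ : 0 < β)
    (ha : β * (m - 1) < 2 * a) {i j : Fin m} (hij : i = j ∨ (i : ℕ) = j + 1)
    {f f' : Matrix (Fin m) (Fin m) ℝ → ℂ} (hf : Continuous f) (hf' : Continuous f')
    (hd : ∀ M, HasDerivAt (fun s : ℝ => f (M + s • Matrix.single i j 1)) (f' M) 0)
    {C : ℝ} (hC : ∀ M, ‖f M‖ ≤ C) (hC' : ∀ M, ‖f' M‖ ≤ C) :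
    Integrable (fun ω => (B ω i j : ℂ) * f' (B ω)
        + ((chiParam β a i j : ℂ) - (B ω i j : ℂ) ^ 2) * f (B ω)) P ∧
      ∫ ω, ((B ω i j : ℂ) * f' (B ω)
        + ((chiParam β a i j : ℂ) - (B ω i j : ℂ) ^ 2) * f (B ω)) ∂P = 0 := by
  have hr : 0 < chiParam β a i j := chiParam_pos hβ ha
  have hC0 : 0 ≤ C := (norm_nonneg _).trans (hC 0)
  have hlaw := hB.hasLaw hij
  have := isProbabilityMeasure_chiMeasure hr
  set r := chiParam β a i j with hrdef
  let F : Matrix (Fin m) (Fin m) ℝ → ℂ := fun M => (M i j : ℂ) * f' M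
    + ((r : ℂ) - (M i j : ℂ) ^ 2) * f M
  have hFc : Continuous F := by
    have : Continuous fun M : Matrix (Fin m) (Fin m) ℝ => (M i j : ℂ) :=
      Complex.continuous_ofReal.comp (continuous_id.matrix_elem i j)
    exact (this.mul hf').add ((continuous_const.sub (this.pow 2)).mul hf)
  have hFb : ∀ M, ‖F M‖ ≤ (C * (2 + r)) * (1 + M i j ^ 2) := by
    intro M
    refine (norm_add_le _ _).trans ?_
    rw [norm_mul, norm_mul]
    have h1 : ‖(r : ℂ) - (M i j : ℂ) ^ 2‖ ≤ r + M i j ^ 2 := by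
      refine (norm_sub_le _ _).trans ?_
      rw [norm_pow, Complex.norm_real, Complex.norm_real, Real.norm_of_nonneg hr.le,
        Real.norm_eq_abs, sq_abs]
    have h2 : ‖(M i j : ℂ)‖ ≤ 1 + M i j ^ 2 := by
      rw [Complex.norm_real, Real.norm_eq_abs]
      nlinarith [sq_abs (M i j), sq_nonneg (|M i j| - 1), abs_nonneg (M i j)]
    calc _ ≤ (1 + M i j ^ 2) * C + (r + M i j ^ 2) * C := by
          gcongr
          · exact hC' M
          · exact hC M
      _ ≤ _ := by nlinarith [mul_nonneg hC0 (mul_nonneg hr.le (sq_nonneg (M i j))),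
          sq_nonneg (M i j)]
  have hint : Integrable (fun ω => F (B ω)) P := by
    have h1 : Integrable (fun x : ℝ => (((C * (2 + r)) * (1 + x ^ 2) : ℝ) : ℂ)) (chiMeasure r) := by
      refine integrable_chiMeasure_of_bound hr (by fun_prop) (C := C * (2 + r)) fun x => ?_
      rw [Complex.norm_real, Real.norm_of_nonneg (by positivity)]
    rw [← hlaw.map_eq] at h1
    have h2 := h1.comp_aemeasurable hlaw.aemeasurable
    refine h2.mono (hB.aestronglyMeasurable_comp hFc) (Filter.Eventually.of_forall fun ω => ?_)
    refine (hFb _).trans (le_of_eq ?_)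
    simp only [Function.comp_apply]
    rw [Complex.norm_real, Real.norm_of_nonneg (by positivity)]
  refine ⟨hint, ?_⟩
  have hmap := hB.indep.map_fun_eq_pi_map (fun p : Fin m × Fin m => hB.aemeasurable p.1 p.2)
  let Q : (Fin m × Fin m → ℝ) → Matrix (Fin m) (Fin m) ℝ := fun q => Matrix.of fun i j => q (i, j)
  have hQ : Continuous Q := continuous_matrix fun i j => by
    simp only [Q, Matrix.of_apply]; fun_prop
  have : ∀ p : Fin m × Fin m, IsProbabilityMeasure (P.map fun ω => B ω p.1 p.2) :=
    fun p => Measure.isProbabilityMeasure_map (hB.aemeasurable p.1 p.2)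
  have h1 : ∫ ω, F (B ω) ∂P = ∫ q, F (Q q) ∂(P.map fun ω (p : Fin m × Fin m) => B ω p.1 p.2) :=
    (integral_map hB.aemeasurable_pi (hFc.comp hQ).aestronglyMeasurable).symm
  have h2 : Integrable (fun q => F (Q q)) (P.map fun ω (p : Fin m × Fin m) => B ω p.1 p.2) :=
    (integrable_map_measure (hFc.comp hQ).aestronglyMeasurable hB.aemeasurable_pi).2 hint
  change ∫ ω, F (B ω) ∂P = 0
  rw [h1]
  rw [hmap] at h2 ⊢
  refine integral_pi_eq_zero_of_update _ (i, j) h2 fun q => ?_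
  simp only
  rw [hlaw.map_eq]
  have hupd : ∀ ξ s : ℝ, Q (Function.update q (i, j) ξ) + s • Matrix.single i j 1
      = Q (Function.update q (i, j) (ξ + s)) := by
    intro ξ s
    ext k l
    simp only [Q, Matrix.add_apply, Matrix.of_apply, Matrix.smul_apply, Matrix.single_apply,
      Function.update_apply, Prod.mk.injEq, smul_eq_mul]
    by_cases h : i = k ∧ j = l
    · simp [h]
    · have h' : ¬(k = i ∧ l = j) := fun h2 => h ⟨h2.1.symm, h2.2.symm⟩
      simp [h, h']
  have hQu : Continuous fun ξ : ℝ => Q (Function.update q (i, j) ξ) :=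
    hQ.comp (continuous_const.update (i, j) continuous_id)
  have h3 := integral_chiMeasure_stein hr (f := fun ξ => f (Q (Function.update q (i, j) ξ)))
    (f' := fun ξ => f' (Q (Function.update q (i, j) ξ))) (fun ξ => ?_) (hf'.comp hQu)
    (fun ξ => hC _) (fun ξ => hC' _)
  · simpa [F, Q] using h3
  · have h4 := hd (Q (Function.update q (i, j) ξ))
    simp only [hupd] at h4
    have h5 := HasDerivAt.comp_const_add (-ξ) ξ (by simpa using h4)
    simpa using h5

end IsBidiagonalModel

/-! ### The loop equation -/

/-- A function of a matrix is continuous and bounded. -/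
def IsBoundedCont {m : ℕ} (f : Matrix (Fin m) (Fin m) ℝ → ℂ) : Prop :=
  Continuous f ∧ ∃ C, ∀ M, ‖f M‖ ≤ C

namespace IsBoundedCont

variable {m : ℕ} {f g : Matrix (Fin m) (Fin m) ℝ → ℂ}

theorem const (x : ℂ) : IsBoundedCont fun _ : Matrix (Fin m) (Fin m) ℝ => x :=
  ⟨continuous_const, ‖x‖, fun _ => le_rfl⟩

theorem add (hf : IsBoundedCont f) (hg : IsBoundedCont g) : IsBoundedCont fun M => f M + g M := by
  obtain ⟨hf1, C, hC⟩ := hf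
  obtain ⟨hg1, D, hD⟩ := hg
  exact ⟨hf1.add hg1, C + D, fun M => (norm_add_le _ _).trans (add_le_add (hC M) (hD M))⟩

theorem mul (hf : IsBoundedCont f) (hg : IsBoundedCont g) : IsBoundedCont fun M => f M * g M := by
  obtain ⟨hf1, C, hC⟩ := hf
  obtain ⟨hg1, D, hD⟩ := hg
  refine ⟨hf1.mul hg1, C * D, fun M => (norm_mul_le _ _).trans ?_⟩
  exact mul_le_mul (hC M) (hD M) (norm_nonneg _) ((norm_nonneg _).trans (hC M))

theorem sub (hf : IsBoundedCont f) (hg : IsBoundedCont g) : IsBoundedCont fun M => f M - g M := by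
  simpa [sub_eq_add_neg] using hf.add ((const (-1)).mul hg)

theorem pow (hf : IsBoundedCont f) (k : ℕ) : IsBoundedCont fun M => f M ^ k := by
  induction k with
  | zero => simpa using const (m := m) 1
  | succ k ih => simpa [pow_succ] using ih.mul hf

theorem sum {ι : Type*} (s : Finset ι) {f : ι → Matrix (Fin m) (Fin m) ℝ → ℂ}
    (hf : ∀ i, IsBoundedCont (f i)) : IsBoundedCont fun M => ∑ i ∈ s, f i M := by
  classical
  induction s using Finset.induction_on with
  | empty => simpa using const (m := m) 0
  | insert a s ha ih => simpa [Finset.sum_insert ha] using (hf a).add ih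

theorem res_gram (c : ℝ) {z : ℂ} (hz : z.im ≠ 0) (k l : Fin m) :
    IsBoundedCont fun M => res (gram c M) z k l :=
  ⟨(continuous_res_gram continuous_id c hz).matrix_elem k l, _,
    fun M => norm_res_le (gram_isSymm c M) hz k l⟩

theorem comp_transpose (hf : IsBoundedCont f) : IsBoundedCont fun M => f Mᵀ := by
  obtain ⟨hf1, C, hC⟩ := hf
  exact ⟨hf1.comp continuous_id.matrix_transpose, C, fun M => hC _⟩

theorem dres {c : ℝ} (hc : 0 < c) {z : ℂ} (hz : z.im ≠ 0) (i j k l : Fin m) :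
    IsBoundedCont (dres c z i j k l) :=
  ⟨continuous_dres c hz i j k l, _, fun M => norm_dres_le hc hz i j k l M⟩

theorem flowRate (c : ℝ) {z : ℂ} (hz : z.im ≠ 0) (i j : Fin m) :
    IsBoundedCont (flowRate c z i j) :=
  (const _).mul ((res_gram c hz i i).sub (res_gram c hz j j).comp_transpose)

theorem dflowRate {c : ℝ} (hc : 0 < c) {z : ℂ} (hz : z.im ≠ 0) (i j : Fin m) :
    IsBoundedCont (dflowRate c z i j) :=
  (const _).mul ((dres hc hz i j i i).sub (dres hc hz j i j j).comp_transpose)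

end IsBoundedCont

theorem hasDerivAt_flowRate {m : ℕ} (c : ℝ) {z : ℂ} (hz : z.im ≠ 0) (i j : Fin m)
    (B : Matrix (Fin m) (Fin m) ℝ) :
    HasDerivAt (fun s : ℝ => flowRate c z i j (B + s • Matrix.single i j 1))
      (dflowRate c z i j B) 0 := by
  have h1 := hasDerivAt_res_gram c hz i j i i B
  have h2 := hasDerivAt_res_gram c hz j i j j Bᵀ
  have e : ∀ s : ℝ, (B + s • Matrix.single i j (1 : ℝ))ᵀ = Bᵀ + s • Matrix.single j i 1 := by
    intro s; simp
  unfold flowRate dflowRate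
  simp only [e]
  exact (h1.sub h2).const_mul _

section Defect

variable {n : ℕ}

/-- The difference between the trace of the resolvent of `c B Bᵀ` and `n + 1` times its corner
entry. -/
noncomputable def cornerDefect (c : ℝ) (w : ℂ) (B : Matrix (Fin (n + 1)) (Fin (n + 1)) ℝ) : ℂ :=
  (res (gram c B) w).trace - (n + 1) * res (gram c B) w 0 0

/-- The partial derivative of `cornerDefect` with respect to `B i j`. -/
noncomputable def dcornerDefect (c : ℝ) (w : ℂ) (i j : Fin (n + 1))
    (B : Matrix (Fin (n + 1)) (Fin (n + 1)) ℝ) : ℂ :=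
  (∑ k, dres c w i j k k B) - (n + 1) * dres c w i j 0 0 B

theorem hasDerivAt_cornerDefect (c : ℝ) {w : ℂ} (hw : w.im ≠ 0) (i j : Fin (n + 1))
    (B : Matrix (Fin (n + 1)) (Fin (n + 1)) ℝ) :
    HasDerivAt (fun s : ℝ => cornerDefect c w (B + s • Matrix.single i j 1))
      (dcornerDefect c w i j B) 0 := by
  unfold cornerDefect dcornerDefect
  refine HasDerivAt.sub ?_ ((hasDerivAt_res_gram c hw i j 0 0 B).const_mul _)
  simp only [Matrix.trace, Matrix.diag]
  exact HasDerivAt.fun_sum fun k _ => hasDerivAt_res_gram c hw i j k k B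

theorem isBoundedCont_cornerDefect (c : ℝ) {w : ℂ} (hw : w.im ≠ 0) :
    IsBoundedCont (cornerDefect (n := n) c w) :=
  (IsBoundedCont.sum _ fun k => IsBoundedCont.res_gram c hw k k).sub
    ((IsBoundedCont.const _).mul (IsBoundedCont.res_gram c hw 0 0))

theorem isBoundedCont_dcornerDefect {c : ℝ} (hc : 0 < c) {w : ℂ} (hw : w.im ≠ 0)
    (i j : Fin (n + 1)) : IsBoundedCont (dcornerDefect c w i j) :=
  (IsBoundedCont.sum _ fun k => IsBoundedCont.dres hc hw i j k k).sub
    ((IsBoundedCont.const _).mul (IsBoundedCont.dres hc hw i j 0 0))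

theorem cornerDefect_conj (c : ℝ) (w : ℂ) (B : Matrix (Fin (n + 1)) (Fin (n + 1)) ℝ) :
    cornerDefect c (starRingEnd ℂ w) B = starRingEnd ℂ (cornerDefect c w B) := by
  simp [cornerDefect, Matrix.trace, res_conj (gram_isSymm c B)]

/-- Along the flow generated by the resolvent at `z` the trace of the resolvent at `w` is constant,
and its corner entry moves with a speed controlled by the first rows of the two resolvents. -/
theorem norm_sum_flowVel_mul_dcornerDefect_le {c : ℝ} {z w : ℂ} (hz : z.im ≠ 0) (hw : w.im ≠ 0)
    {B : Matrix (Fin (n + 1)) (Fin (n + 1)) ℝ} (hB : IsLowerBidiagonal B) :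
    ‖∑ i, ∑ j, flowVel c z B i j * dcornerDefect c w i j B‖
      ≤ (n + 1) * ∑ j, ‖res (gram c B) z 0 j‖ * ‖res (gram c B) w 0 j‖ := by
  set S := flowGen c z B with hS
  set G := res (gram c B) w with hG
  have h1 : ∑ i, ∑ j, flowVel c z B i j * dcornerDefect c w i j B
      = (S * G - G * S).trace - (n + 1) * (S * G - G * S) 0 0 := by
    rw [Matrix.trace]
    simp only [Matrix.diag, hS, hG, ← sum_flowVel_mul_dres hB hz hw]
    simp only [dcornerDefect, mul_sub, Finset.sum_sub_distrib]
    congr 1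
    · simp only [Finset.mul_sum]
      rw [Finset.sum_comm (s := Finset.univ (α := Fin (n + 1))) (t := Finset.univ)
        (f := fun k i => ∑ j, flowVel c z B i j * dres c w i j k k B)]
      refine Finset.sum_congr rfl fun i _ => ?_
      rw [Finset.sum_comm]
    · simp only [Finset.mul_sum]
      refine Finset.sum_congr rfl fun i _ => Finset.sum_congr rfl fun j _ => ?_
      ring
  have h2 : (S * G - G * S).trace = 0 := by
    rw [Matrix.trace_sub, Matrix.trace_mul_comm, sub_self]
  rw [h1, h2, zero_sub, norm_neg, norm_mul]
  have h3 : ‖((n : ℂ) + 1)‖ = n + 1 := by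
    have : ((n : ℂ) + 1) = ((n + 1 : ℕ) : ℂ) := by push_cast; rfl
    rw [this, Complex.norm_natCast]; push_cast; rfl
  rw [h3]
  gcongr
  rw [Matrix.sub_apply, Matrix.mul_apply, Matrix.mul_apply, ← Finset.sum_sub_distrib]
  refine (norm_sum_le _ _).trans (Finset.sum_le_sum fun j _ => ?_)
  have e1 : S 0 j * G j 0 - G 0 j * S j 0
      = 1 / 2 * (sgnLower 0 j - sgnLower j 0) * (res (gram c B) z 0 j * G 0 j) := by
    simp only [hS, flowGen, Matrix.of_apply, hG]
    rw [res_symm (gram_isSymm c B) j 0, res_symm (gram_isSymm c B) j 0]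
    ring
  rw [e1, norm_mul, norm_mul (res (gram c B) z 0 j)]
  have e2 : ‖1 / 2 * (sgnLower 0 j - sgnLower j 0)‖ ≤ 1 := by
    unfold sgnLower
    split_ifs with h1 h2 h2 <;> norm_num
  calc _ ≤ 1 * (‖res (gram c B) z 0 j‖ * ‖G 0 j‖) := by gcongr
    _ = _ := one_mul _

end Defect

namespace IsBidiagonalModel

variable {Ω : Type*} [MeasurableSpace Ω] {P : Measure Ω} [IsProbabilityMeasure P] {β a : ℝ} {n : ℕ}
  {B : Ω → Matrix (Fin (n + 1)) (Fin (n + 1)) ℝ}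

/-- The loop equation of the bidiagonal model: integration by parts along the isospectral flow.
The condition `β n < 2a` makes all the `χ` parameters positive. -/
theorem loop_equation (hB : IsBidiagonalModel P β a B) (hβ : 0 < β) (ha : β * n < 2 * a) {c : ℝ}
    (hc : 0 < c) {z : ℂ} (hz : z.im ≠ 0) {F : Matrix (Fin (n + 1)) (Fin (n + 1)) ℝ → ℂ}
    {dF : Fin (n + 1) → Fin (n + 1) → Matrix (Fin (n + 1)) (Fin (n + 1)) ℝ → ℂ}
    (hF : IsBoundedCont F) (hdF : ∀ i j, IsBoundedCont (dF i j))
    (hd : ∀ i j M, HasDerivAt (fun s : ℝ => F (M + s • Matrix.single i j 1)) (dF i j M) 0) :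
    ∫ ω, ∑ i, ∑ j, flowVel c z (B ω) i j * dF i j (B ω) ∂P
      = β / 2 * ∫ ω, F (B ω) * cornerDefect c z (B ω) ∂P := by
  have ha' : β * (((n + 1 : ℕ) : ℝ) - 1) < 2 * a := by push_cast; simpa using ha
  let T : Fin (n + 1) → Fin (n + 1) → Ω → ℂ := fun i j ω =>
    (B ω i j : ℂ) * (dF i j (B ω) * flowRate c z i j (B ω) + F (B ω) * dflowRate c z i j (B ω))
      + ((chiParam β a i j : ℂ) - (B ω i j : ℂ) ^ 2) * (F (B ω) * flowRate c z i j (B ω))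
  have hT : ∀ i j, Integrable (T i j) P ∧ ∫ ω, T i j ω ∂P = 0 := by
    intro i j
    by_cases hij : i = j ∨ (i : ℕ) = j + 1
    · have h1 := hF.mul (IsBoundedCont.flowRate c hz i j)
      have h2 := ((hdF i j).mul (IsBoundedCont.flowRate c hz i j)).add
        (hF.mul (IsBoundedCont.dflowRate hc hz i j))
      obtain ⟨C, hC⟩ := h1.2
      obtain ⟨D, hD⟩ := h2.2
      refine hB.integral_stein hβ ha' hij h1.1 h2.1 (fun M => ?_) (C := max C D)
        (fun M => (hC M).trans (le_max_left _ _)) (fun M => (hD M).trans (le_max_right _ _))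
      refine ((hd i j M).mul (hasDerivAt_flowRate c hz i j M)).congr_deriv ?_
      simp
    · have h0 : sgnBidiag i j = 0 := by
        push Not at hij
        simp [sgnBidiag, hij.1, hij.2]
      have : T i j = fun _ => 0 := by
        ext ω
        simp [T, flowRate, dflowRate, h0]
      rw [this]
      simp
  have hsum : ∫ ω, ∑ i, ∑ j, T i j ω ∂P = 0 := by
    rw [integral_finsetSum _ fun i _ => integrable_finsetSum _ fun j _ => (hT i j).1]
    refine Finset.sum_eq_zero fun i _ => ?_
    rw [integral_finsetSum _ fun j _ => (hT i j).1]
    exact Finset.sum_eq_zero fun j _ => (hT i j).2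
  have hpt : ∀ ω, ∑ i, ∑ j, T i j ω = ∑ i, ∑ j, flowVel c z (B ω) i j * dF i j (B ω)
      - β / 2 * (F (B ω) * cornerDefect c z (B ω)) := by
    intro ω
    have hlb := hB.isLowerBidiagonal ω
    have e1 := sum_sq_mul_flowRate (c := c) hlb hz
    have e2 := sum_mul_dflowRate (c := c) hlb hz
    have e3 := sum_chiParam_mul_flowRate β a c (B ω) hz
    have e4 : ∑ i, ∑ j, T i j ω = ∑ i, ∑ j, flowVel c z (B ω) i j * dF i j (B ω)
        + F (B ω) * (∑ i, ∑ j, (B ω i j : ℂ) * dflowRate c z i j (B ω))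
        + F (B ω) * (∑ i, ∑ j, (chiParam β a i j : ℂ) * flowRate c z i j (B ω))
        - F (B ω) * (∑ i, ∑ j, (B ω i j : ℂ) ^ 2 * flowRate c z i j (B ω)) := by
      simp only [Finset.mul_sum, ← Finset.sum_add_distrib, ← Finset.sum_sub_distrib]
      refine Finset.sum_congr rfl fun i _ => Finset.sum_congr rfl fun j _ => ?_
      simp only [T, flowVel, Matrix.of_apply]
      ring
    rw [e4, e1, e2, e3, cornerDefect]
    ring
  have hFX : Integrable (fun ω => F (B ω) * cornerDefect c z (B ω)) P := by
    obtain ⟨h1, C, hC⟩ := hF.mul (isBoundedCont_cornerDefect c hz)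
    exact hB.integrable_comp_of_bound h1 hC
  have hV : Integrable (fun ω => ∑ i, ∑ j, flowVel c z (B ω) i j * dF i j (B ω)) P := by
    have h1 : Integrable (fun ω => ∑ i, ∑ j, T i j ω) P :=
      integrable_finsetSum _ fun i _ => integrable_finsetSum _ fun j _ => (hT i j).1
    refine (h1.add (hFX.const_mul (β / 2 : ℂ))).congr (Filter.Eventually.of_forall fun ω => ?_)
    simp only [Pi.add_apply, hpt]
    ring
  simp only [hpt] at hsum
  rw [integral_sub hV (hFX.const_mul _), integral_const_mul] at hsum
  exact sub_eq_zero.1 hsum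

/-- Moment form of the loop equation: the even moments of the corner defect are controlled by
lower moments and the imaginary part of the corner entry of the resolvent. -/
theorem integral_norm_cornerDefect_pow_le (hB : IsBidiagonalModel P β a B) (hβ : 0 < β)
    (ha : β * n < 2 * a) {c : ℝ} (hc : 0 < c) {z : ℂ} (hz : 0 < z.im) (k : ℕ) :
    ∫ ω, ‖cornerDefect c z (B ω)‖ ^ (2 * k + 2) ∂P
      ≤ 2 / β * ((2 * k + 1) * (n + 1) / z.im)
        * ∫ ω, ‖cornerDefect c z (B ω)‖ ^ (2 * k) * (res (gram c (B ω)) z 0 0).im ∂P := by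
  have hz0 := hz.ne'
  have hw : (starRingEnd ℂ z).im ≠ 0 := by simpa using hz0
  set w := starRingEnd ℂ z with hwdef
  let X := cornerDefect (n := n) c z
  let Y := cornerDefect (n := n) c w
  have hX : IsBoundedCont X := isBoundedCont_cornerDefect c hz0
  have hY : IsBoundedCont Y := isBoundedCont_cornerDefect c hw
  have hXY : ∀ M, Y M = starRingEnd ℂ (X M) := fun M => cornerDefect_conj c z M
  have hYn : ∀ M, ‖Y M‖ = ‖X M‖ := fun M => by rw [hXY, RCLike.norm_conj]
  -- the test function for which `F * X = ‖X‖ ^ (2 * k + 2)`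
  let F : Matrix (Fin (n + 1)) (Fin (n + 1)) ℝ → ℂ := fun M => X M ^ k * Y M ^ (k + 1)
  let dF : Fin (n + 1) → Fin (n + 1) → Matrix (Fin (n + 1)) (Fin (n + 1)) ℝ → ℂ := fun i j M =>
    (k * X M ^ (k - 1) * dcornerDefect c z i j M) * Y M ^ (k + 1)
      + X M ^ k * (((k + 1 : ℕ) : ℂ) * Y M ^ k * dcornerDefect c w i j M)
  have hF : IsBoundedCont F := (hX.pow k).mul (hY.pow (k + 1))
  have hdF : ∀ i j, IsBoundedCont (dF i j) := fun i j =>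
    ((((IsBoundedCont.const _).mul (hX.pow (k - 1))).mul
      (isBoundedCont_dcornerDefect hc hz0 i j)).mul (hY.pow (k + 1))).add
      ((hX.pow k).mul (((IsBoundedCont.const _).mul (hY.pow k)).mul
        (isBoundedCont_dcornerDefect hc hw i j)))
  have hd : ∀ i j M, HasDerivAt (fun s : ℝ => F (M + s • Matrix.single i j 1)) (dF i j M) 0 := by
    intro i j M
    have h1 := (hasDerivAt_cornerDefect c hz0 i j M).pow k
    have h2 := (hasDerivAt_cornerDefect c hw i j M).pow (k + 1)
    refine (h1.mul h2).congr_deriv ?_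
    simp [dF, X, Y]
  have h := hB.loop_equation hβ ha hc hz0 hF hdF hd
  have hFX : ∀ ω, F (B ω) * cornerDefect c z (B ω)
      = ((‖cornerDefect c z (B ω)‖ ^ (2 * k + 2) : ℝ) : ℂ) := by
    intro ω
    have e : X (B ω) * Y (B ω) = ((‖X (B ω)‖ ^ 2 : ℝ) : ℂ) := by
      rw [hXY, Complex.mul_conj, Complex.normSq_eq_norm_sq]
    calc F (B ω) * cornerDefect c z (B ω) = (X (B ω) * Y (B ω)) ^ (k + 1) := by
          simp only [F, X]; ring
      _ = _ := by rw [e, ← Complex.ofReal_pow, ← pow_mul]; ring_nf; rfl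
  simp only [hFX] at h
  rw [integral_complex_ofReal] at h
  have hb : ∀ ω, ‖∑ i, ∑ j, flowVel c z (B ω) i j * dF i j (B ω)‖
      ≤ ((2 * k + 1) * (n + 1) / z.im)
        * (‖X (B ω)‖ ^ (2 * k) * (res (gram c (B ω)) z 0 0).im) := by
    intro ω
    have hlb := hB.isLowerBidiagonal ω
    set M := B ω with hM
    have e1 : ∑ i, ∑ j, flowVel c z M i j * dF i j M
        = (k * X M ^ (k - 1) * Y M ^ (k + 1))
            * ∑ i, ∑ j, flowVel c z M i j * dcornerDefect c z i j M
          + (((k + 1 : ℕ) : ℂ) * X M ^ k * Y M ^ k)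
            * ∑ i, ∑ j, flowVel c z M i j * dcornerDefect c w i j M := by
      simp only [Finset.mul_sum, ← Finset.sum_add_distrib]
      refine Finset.sum_congr rfl fun i _ => Finset.sum_congr rfl fun j _ => ?_
      simp only [dF]
      ring
    have hs : ∑ j, ‖res (gram c M) z 0 j‖ * ‖res (gram c M) z 0 j‖
        = (res (gram c M) z 0 0).im / z.im := by
      rw [res_diag_im (gram_isSymm c M) hz0, mul_div_cancel_left₀ _ hz0]
      refine Finset.sum_congr rfl fun j _ => ?_
      rw [sq]
    have b1 := norm_sum_flowVel_mul_dcornerDefect_le (c := c) hz0 hz0 hlb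
    have b2 := norm_sum_flowVel_mul_dcornerDefect_le (c := c) hz0 hw hlb
    simp only [hwdef, res_conj (gram_isSymm c M), RCLike.norm_conj] at b2
    rw [hs] at b1 b2
    have p1 : ‖(k * X M ^ (k - 1) * Y M ^ (k + 1))‖ = k * ‖X M‖ ^ (2 * k) := by
      rw [norm_mul, norm_mul, Complex.norm_natCast, norm_pow, norm_pow, hYn]
      rcases k with _ | k
      · simp
      · rw [mul_assoc, ← pow_add]
        congr 2
        omega
    have p2 : ‖(((k + 1 : ℕ) : ℂ) * X M ^ k * Y M ^ k)‖ = (k + 1) * ‖X M‖ ^ (2 * k) := by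
      rw [norm_mul, norm_mul, Complex.norm_natCast, norm_pow, norm_pow, hYn, mul_assoc, ← pow_add]
      push_cast
      ring_nf
    rw [e1]
    refine (norm_add_le _ _).trans ?_
    rw [norm_mul (_ * Y M ^ (k + 1)), norm_mul (_ * Y M ^ k), p1, p2]
    calc _ ≤ k * ‖X M‖ ^ (2 * k) * ((n + 1) * ((res (gram c M) z 0 0).im / z.im))
          + (k + 1) * ‖X M‖ ^ (2 * k) * ((n + 1) * ((res (gram c M) z 0 0).im / z.im)) := by
          gcongr
      _ = _ := by ring
  have hint : Integrable (fun ω => ‖X (B ω)‖ ^ (2 * k) * (res (gram c (B ω)) z 0 0).im) P := by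
    obtain ⟨h1, C, hC⟩ := (hX.pow (2 * k)).mul (IsBoundedCont.res_gram c hz0 0 0)
    have hc1 : Continuous fun M : Matrix (Fin (n + 1)) (Fin (n + 1)) ℝ =>
        ‖X M‖ ^ (2 * k) * (res (gram c M) z 0 0).im :=
      (hX.1.norm.pow _).mul (Complex.continuous_im.comp (IsBoundedCont.res_gram c hz0 0 0).1)
    refine Integrable.of_bound (hB.aestronglyMeasurable_comp hc1) C
      (Filter.Eventually.of_forall fun ω => (le_trans ?_ (hC (B ω))))
    rw [norm_mul, norm_mul, norm_pow, norm_norm, norm_pow]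
    gcongr
    exact Complex.abs_im_le_norm _
  have h2 : ‖∫ ω, ∑ i, ∑ j, flowVel c z (B ω) i j * dF i j (B ω) ∂P‖
      ≤ ((2 * k + 1) * (n + 1) / z.im)
        * ∫ ω, ‖X (B ω)‖ ^ (2 * k) * (res (gram c (B ω)) z 0 0).im ∂P := by
    rw [← integral_const_mul]
    exact norm_integral_le_of_norm_le (hint.const_mul _) (Filter.Eventually.of_forall hb)
  rw [h, norm_mul, Complex.norm_real, Real.norm_eq_abs] at h2
  have h3 : ‖(β / 2 : ℂ)‖ = β / 2 := by
    have : (β / 2 : ℂ) = ((β / 2 : ℝ) : ℂ) := by push_cast; rfl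
    rw [this, Complex.norm_real, Real.norm_of_nonneg (by positivity)]
  rw [h3] at h2
  have h4 := le_abs_self (∫ ω, ‖cornerDefect c z (B ω)‖ ^ (2 * k + 2) ∂P)
  calc ∫ ω, ‖cornerDefect c z (B ω)‖ ^ (2 * k + 2) ∂P
      ≤ |∫ ω, ‖cornerDefect c z (B ω)‖ ^ (2 * k + 2) ∂P| := h4
    _ = 2 / β * (β / 2 * |∫ ω, ‖cornerDefect c z (B ω)‖ ^ (2 * k + 2) ∂P|) := by
        field_simp
    _ ≤ 2 / β * (((2 * k + 1) * (n + 1) / z.im)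
        * ∫ ω, ‖X (B ω)‖ ^ (2 * k) * (res (gram c (B ω)) z 0 0).im ∂P) := by gcongr
    _ = _ := by ring

end IsBidiagonalModel

/-! ### Removing the first row and column -/

section Pad

variable {n : ℕ}

/-- The block matrix `0 ⊕ A`. -/
def pad (A : Matrix (Fin n) (Fin n) ℝ) : Matrix (Fin (n + 1)) (Fin (n + 1)) ℝ :=
  Matrix.of (Fin.cons 0 fun i => Fin.cons 0 (A i))

@[simp] theorem pad_zero_left (A : Matrix (Fin n) (Fin n) ℝ) (j : Fin (n + 1)) :
    pad A 0 j = 0 := rfl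

@[simp] theorem pad_zero_right (A : Matrix (Fin n) (Fin n) ℝ) (i : Fin (n + 1)) :
    pad A i 0 = 0 := by
  refine Fin.cases rfl (fun i => rfl) i

@[simp] theorem pad_succ (A : Matrix (Fin n) (Fin n) ℝ) (i j : Fin n) :
    pad A i.succ j.succ = A i j := rfl

theorem pad_isSymm {A : Matrix (Fin n) (Fin n) ℝ} (hA : A.IsSymm) : (pad A).IsSymm := by
  refine Matrix.IsSymm.ext fun i j => ?_
  refine Fin.cases ?_ (fun i => ?_) i <;> refine Fin.cases ?_ (fun j => ?_) j <;> simp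
  exact hA.apply _ _

/-- The resolvent of `0 ⊕ A` is `(-z⁻¹) ⊕ (A - z)⁻¹`. -/
theorem res_pad {A : Matrix (Fin n) (Fin n) ℝ} (hA : A.IsSymm) {z : ℂ} (hz : z.im ≠ 0) :
    res (pad A) z = Matrix.of (Fin.cons (Fin.cons (-z⁻¹) 0) fun i => Fin.cons 0 (res A z i)) := by
  have hz0 : z ≠ 0 := by rintro rfl; simp at hz
  have h := sub_mul_res hA hz
  refine Matrix.inv_eq_right_inv ?_
  ext i j
  refine Fin.cases ?_ (fun i => ?_) i <;> refine Fin.cases ?_ (fun j => ?_) j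
  · simp [Matrix.mul_apply, hz0, Matrix.one_apply]
  · simp [Matrix.mul_apply, Matrix.one_apply, eq_comm]
  · simp [Matrix.mul_apply, Fin.sum_univ_succ, Matrix.one_apply]
  · have := congrFun (congrFun h i) j
    simpa [Matrix.mul_apply, Fin.sum_univ_succ, Matrix.one_apply] using this

theorem trace_res_pad {A : Matrix (Fin n) (Fin n) ℝ} (hA : A.IsSymm) {z : ℂ} (hz : z.im ≠ 0) :
    (res (pad A) z).trace = -z⁻¹ + (res A z).trace := by
  rw [res_pad hA hz]
  simp [Matrix.trace, Fin.sum_univ_succ]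

/-- The matrix with the first row and column removed. -/
def minor (B : Matrix (Fin (n + 1)) (Fin (n + 1)) ℝ) : Matrix (Fin n) (Fin n) ℝ :=
  B.submatrix Fin.succ Fin.succ

/-- Removing the first column of a lower bidiagonal matrix is a rank one perturbation of the Gram
matrix. -/
theorem gram_eq_pad_add {B : Matrix (Fin (n + 1)) (Fin (n + 1)) ℝ} (hB : IsLowerBidiagonal B)
    (c : ℝ) :
    gram c B = pad (gram c (minor B)) + c • vecMulVec (fun i => B i 0) fun i => B i 0 := by
  have h0 : ∀ k : Fin n, B 0 k.succ = 0 := fun k =>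
    hB 0 k.succ (Fin.succ_ne_zero k).symm (by simp)
  ext i j
  refine Fin.cases ?_ (fun i => ?_) i <;> refine Fin.cases ?_ (fun j => ?_) j <;>
    simp [gram, Matrix.mul_apply, Fin.sum_univ_succ, vecMulVec_apply, h0, minor]
  ring

theorem norm_trace_res_sub_minor_le {B : Matrix (Fin (n + 1)) (Fin (n + 1)) ℝ}
    (hB : IsLowerBidiagonal B) (c : ℝ) {z : ℂ} (hz : z.im ≠ 0) :
    ‖(res (gram c B) z).trace - (res (gram c (minor B)) z).trace‖ ≤ 2 * |z.im|⁻¹ := by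
  have h1 := norm_trace_res_rankOne_sub_le (b := fun i => B i 0) (t := c)
    (pad_isSymm (gram_isSymm c (minor B))) hz
  rw [← gram_eq_pad_add hB, trace_res_pad (gram_isSymm c _) hz] at h1
  have h2 : ‖z⁻¹‖ ≤ |z.im|⁻¹ := by
    rw [norm_inv]
    exact inv_anti₀ (abs_pos.2 hz) (Complex.abs_im_le_norm z)
  have e : (res (gram c B) z).trace - (res (gram c (minor B)) z).trace
      = ((res (gram c B) z).trace - (-z⁻¹ + (res (gram c (minor B)) z).trace)) + -z⁻¹ := by ring
  rw [e]
  refine (norm_add_le _ _).trans ?_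
  rw [norm_neg]
  linarith

end Pad

/-- The corner entry of the resolvent in terms of that of the minor: a Schur complement. -/
theorem corner_equation {n : ℕ} {B : Matrix (Fin (n + 2)) (Fin (n + 2)) ℝ}
    (hB : IsLowerBidiagonal B) (c : ℝ) {z : ℂ} (hz : z.im ≠ 0) :
    z * (c * B 1 0 ^ 2) * res (gram c (minor B)) z 0 0 * res (gram c B) z 0 0
      + (z - c * B 0 0 ^ 2) * res (gram c B) z 0 0
      + (c * B 1 0 ^ 2) * res (gram c (minor B)) z 0 0 + 1 = 0 := by
  have hz0 : z ≠ 0 := by rintro rfl; simp at hz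
  have hA := gram_isSymm c (minor B)
  have hK := pad_isSymm hA
  set b : Fin (n + 2) → ℝ := fun i => B i 0 with hb
  have hb0 : ∀ k : Fin n, B k.succ.succ 0 = 0 := fun k => hB _ _ (Fin.succ_ne_zero _) (by simp)
  have h1 := congrFun (congrFun (res_sub_res_rankOne (b := b) (t := c) hK hz) 0) 0
  have h2 := congrFun (rankOneDenom_smul (b := b) (t := c) hK hz) 0
  rw [← gram_eq_pad_add hB] at h1 h2
  have e1 : (res (pad (gram c (minor B))) z *ᵥ fun i => (b i : ℂ)) 0 = -z⁻¹ * B 0 0 := by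
    rw [res_pad hA hz]
    simp [Matrix.mulVec, dotProduct, Fin.sum_univ_succ, hb]
  have e2 : rankOneDenom (pad (gram c (minor B))) b c z
      = 1 + c * (-z⁻¹ * B 0 0 ^ 2 + res (gram c (minor B)) z 0 0 * B 1 0 ^ 2) := by
    rw [rankOneDenom, res_pad hA hz]
    simp [Matrix.mulVec, dotProduct, Fin.sum_univ_succ, hb, hb0]
    left
    ring
  have e3 : res (pad (gram c (minor B))) z 0 0 = -z⁻¹ := by
    rw [res_pad hA hz]; rfl
  rw [Matrix.sub_apply, Matrix.smul_apply, vecMulVec_apply, e1, e3] at h1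
  rw [Pi.smul_apply, e1, e2] at h2
  simp only [smul_eq_mul] at h1 h2
  set u := res (gram c B) z 0 0
  set g := res (gram c (minor B)) z 0 0
  set v := (res (gram c B) z *ᵥ fun i => (b i : ℂ)) 0
  have hzi : z * z⁻¹ = 1 := mul_inv_cancel₀ hz0
  have hu : u = -z⁻¹ + c * z⁻¹ * B 0 0 * v := by linear_combination -h1
  have hv : (z - c * B 0 0 ^ 2 + z * c * g * B 1 0 ^ 2) * v = -B 0 0 := by
    linear_combination z * h2 - (B 0 0 - c * B 0 0 ^ 2 * v) * hzi
  have hv' : (z * (c * B 1 0 ^ 2) * g + (z - c * B 0 0 ^ 2)) * u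
      = z⁻¹ * (-(z * (c * B 1 0 ^ 2) * g + (z - c * B 0 0 ^ 2)) - c * B 0 0 ^ 2) := by
    rw [hu]
    linear_combination c * z⁻¹ * B 0 0 * hv
  linear_combination hv' - (c * B 1 0 ^ 2 * g + 1) * hzi

namespace IsBidiagonalModel

/-- The first minor of a bidiagonal model is again a bidiagonal model, with one row less and
`2a` replaced by `2a - β`. -/
theorem minor {Ω : Type*} [MeasurableSpace Ω] {P : Measure Ω} {β a : ℝ} {n : ℕ}
    {B : Ω → Matrix (Fin (n + 1)) (Fin (n + 1)) ℝ} (hB : IsBidiagonalModel P β a B) :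
    IsBidiagonalModel P β (a - β / 2) fun ω => minor (B ω) where
  hasLaw_diag i := by
    have h := hB.hasLaw_diag i.succ
    have e : 2 * a - β * (i.succ : ℕ) = 2 * (a - β / 2) - β * (i : ℕ) := by
      simp; ring
    rw [e] at h
    exact h
  hasLaw_subdiag i j hij := by
    have h := hB.hasLaw_subdiag i.succ j.succ (by simp [hij])
    have e : β * (((n + 1 : ℕ) : ℝ) - (i.succ : ℕ)) = β * ((n : ℝ) - (i : ℕ)) := by
      simp
    rw [e] at h
    exact h
  eq_zero i j h1 h2 ω := hB.eq_zero i.succ j.succ (by simpa using h1) (by simpa using h2) ω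
  indep := by
    have hinj : Function.Injective fun p : Fin n × Fin n => (p.1.succ, p.2.succ) := by
      intro p q h
      simpa [Prod.ext_iff] using h
    exact hB.indep.precomp hinj

end IsBidiagonalModel

/-! ### The Marchenko–Pastur transform and its stability -/

section MarchenkoPastur

open Real Set

theorem integral_cos_nat_mul {k : ℕ} (hk : k ≠ 0) :
    ∫ θ in (0 : ℝ)..π, cos (k * θ) = 0 := by
  have hk' : (k : ℝ) ≠ 0 := by exact_mod_cast hk
  rw [intervalIntegral.integral_comp_mul_left (fun x => cos x) hk', integral_cos]
  simp [Real.sin_nat_mul_pi]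

theorem integral_sin_nat_mul_sin (n : ℕ) :
    ∫ θ in (0 : ℝ)..π, sin ((n + 1 : ℕ) * θ) * sin θ = if n = 0 then π / 2 else 0 := by
  have e : ∀ θ : ℝ, sin ((n + 1 : ℕ) * θ) * sin θ
      = 1 / 2 * (cos (n * θ) - cos ((n + 2 : ℕ) * θ)) := by
    intro θ
    have h1 : cos (n * θ) = cos ((n + 1 : ℕ) * θ - θ) := by push_cast; ring_nf
    have h2 : cos ((n + 2 : ℕ) * θ) = cos ((n + 1 : ℕ) * θ + θ) := by push_cast; ring_nf
    rw [h1, h2, cos_sub, cos_add]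
    ring
  simp only [e]
  rw [intervalIntegral.integral_const_mul, intervalIntegral.integral_sub
    (Continuous.intervalIntegrable (by fun_prop) _ _)
    (Continuous.intervalIntegrable (by fun_prop) _ _), integral_cos_nat_mul (k := n + 2) (by omega)]
  split_ifs with h
  · subst h; simp; ring
  · rw [integral_cos_nat_mul h]; simp

/-- Generating function of `sin ((n + 1) θ)`. -/
theorem hasSum_pow_mul_sin {w : ℂ} (hw : ‖w‖ < 1) (θ : ℝ) :
    HasSum (fun n : ℕ => w ^ n * ((sin ((n + 1 : ℕ) * θ) : ℝ) : ℂ))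
      (((sin θ : ℝ) : ℂ) / (1 - 2 * w * ((cos θ : ℝ) : ℂ) + w ^ 2)) := by
  set E := Complex.exp (θ * Complex.I) with hE
  set E' := Complex.exp (-(θ * Complex.I)) with hE'
  have hEE : E * E' = 1 := by rw [hE, hE', ← Complex.exp_add]; simp
  have hn1 : ‖w * E‖ < 1 := by rw [norm_mul, hE, Complex.norm_exp_ofReal_mul_I, mul_one]; exact hw
  have hn2 : ‖w * E'‖ < 1 := by
    have : ‖E'‖ = 1 := by
      rw [hE', show -(θ * Complex.I) = ((-θ : ℝ) : ℂ) * Complex.I by push_cast; ring,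
        Complex.norm_exp_ofReal_mul_I]
    rw [norm_mul, this, mul_one]; exact hw
  have h1 := (hasSum_geometric_of_norm_lt_one hn1).mul_left E
  have h2 := (hasSum_geometric_of_norm_lt_one hn2).mul_left E'
  have h3 := (h2.sub h1).mul_right (Complex.I / 2)
  have hne1 : 1 - w * E ≠ 0 := by
    intro h; rw [sub_eq_zero] at h; rw [← h] at hn1; simp at hn1
  have hne2 : 1 - w * E' ≠ 0 := by
    intro h; rw [sub_eq_zero] at h; rw [← h] at hn2; simp at hn2
  have hs : ((sin θ : ℝ) : ℂ) = (E' - E) * (Complex.I / 2) := by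
    rw [Complex.ofReal_sin, Complex.sin, hE, hE']; ring_nf
  have hc : ((cos θ : ℝ) : ℂ) = (E + E') / 2 := by
    rw [Complex.ofReal_cos, Complex.cos, hE, hE']; ring_nf
  have hD : 1 - 2 * w * ((cos θ : ℝ) : ℂ) + w ^ 2 = (1 - w * E) * (1 - w * E') := by
    rw [hc]; linear_combination -w ^ 2 * hEE
  have hf : (fun n : ℕ => w ^ n * ((sin ((n + 1 : ℕ) * θ) : ℝ) : ℂ))
      = fun n => (E' * (w * E') ^ n - E * (w * E) ^ n) * (Complex.I / 2) := by
    ext1 n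
    have hs' : ((sin ((n + 1 : ℕ) * θ) : ℝ) : ℂ)
        = (E' ^ (n + 1) - E ^ (n + 1)) * (Complex.I / 2) := by
      rw [Complex.ofReal_sin, Complex.sin, hE, hE', ← Complex.exp_nat_mul, ← Complex.exp_nat_mul]
      push_cast
      ring_nf
    rw [hs', mul_pow, mul_pow]
    ring
  have hv : ((sin θ : ℝ) : ℂ) / ((1 - w * E) * (1 - w * E'))
      = (E' * (1 - w * E')⁻¹ - E * (1 - w * E)⁻¹) * (Complex.I / 2) := by
    rw [hs, div_eq_iff (mul_ne_zero hne1 hne2)]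
    have p1 := mul_inv_cancel₀ hne1
    have p2 := mul_inv_cancel₀ hne2
    linear_combination -(Complex.I / 2) * (E' * (1 - w * E) * p2 - E * (1 - w * E') * p1)
  rw [hD, hf, hv]
  exact h3

theorem one_sub_two_mul_cos_add_sq_ne_zero {w : ℂ} (hw : ‖w‖ < 1) (θ : ℝ) :
    1 - 2 * w * ((cos θ : ℝ) : ℂ) + w ^ 2 ≠ 0 := by
  set E := Complex.exp (θ * Complex.I) with hE
  set E' := Complex.exp (-(θ * Complex.I)) with hE'
  have hEE : E * E' = 1 := by rw [hE, hE', ← Complex.exp_add]; simp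
  have hn1 : ‖w * E‖ < 1 := by rw [norm_mul, hE, Complex.norm_exp_ofReal_mul_I, mul_one]; exact hw
  have hn2 : ‖w * E'‖ < 1 := by
    have : ‖E'‖ = 1 := by
      rw [hE', show -(θ * Complex.I) = ((-θ : ℝ) : ℂ) * Complex.I by push_cast; ring,
        Complex.norm_exp_ofReal_mul_I]
    rw [norm_mul, this, mul_one]; exact hw
  have hc : ((cos θ : ℝ) : ℂ) = (E + E') / 2 := by
    rw [Complex.ofReal_cos, Complex.cos, hE, hE']; ring_nf
  have hD : 1 - 2 * w * ((cos θ : ℝ) : ℂ) + w ^ 2 = (1 - w * E) * (1 - w * E') := by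
    rw [hc]; linear_combination -w ^ 2 * hEE
  rw [hD]
  refine mul_ne_zero ?_ ?_
  · intro h; rw [sub_eq_zero] at h; rw [← h] at hn1; simp at hn1
  · intro h; rw [sub_eq_zero] at h; rw [← h] at hn2; simp at hn2

theorem continuous_sin_sq_div {w : ℂ} (hw : ‖w‖ < 1) :
    Continuous fun θ : ℝ => ((sin θ : ℝ) : ℂ) ^ 2 / (1 - 2 * w * ((cos θ : ℝ) : ℂ) + w ^ 2) :=
  Continuous.div (by fun_prop) (by fun_prop) (one_sub_two_mul_cos_add_sq_ne_zero hw)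

/-- The semicircle integral at the Joukowski image of a point of the open unit disc. -/
theorem integral_sin_sq_div {w : ℂ} (hw : ‖w‖ < 1) :
    ∫ θ in (0 : ℝ)..π, ((sin θ : ℝ) : ℂ) ^ 2 / (1 - 2 * w * ((cos θ : ℝ) : ℂ) + w ^ 2)
      = (π / 2 : ℂ) := by
  let f : ℕ → C(ℝ, ℂ) := fun n =>
    ⟨fun θ => w ^ n * ((sin ((n + 1 : ℕ) * θ) : ℝ) : ℂ) * ((sin θ : ℝ) : ℂ), by fun_prop⟩
  have hb : ∀ n θ, ‖f n θ‖ ≤ ‖w‖ ^ n := by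
    intro n θ
    simp only [f, ContinuousMap.coe_mk]
    rw [norm_mul, norm_mul, norm_pow, Complex.norm_real, Complex.norm_real]
    have h1 := Real.abs_sin_le_one ((n + 1 : ℕ) * θ)
    have h2 := Real.abs_sin_le_one θ
    calc ‖w‖ ^ n * ‖sin ((n + 1 : ℕ) * θ)‖ * ‖sin θ‖ ≤ ‖w‖ ^ n * 1 * 1 := by gcongr <;> assumption
      _ = _ := by ring
  have hsum : Summable fun n => ‖(f n).restrict (⟨uIcc 0 π, isCompact_uIcc⟩ :
      TopologicalSpace.Compacts ℝ)‖ := by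
    refine Summable.of_nonneg_of_le (fun n => norm_nonneg _) (fun n => ?_)
      (summable_geometric_of_lt_one (norm_nonneg w) hw)
    rw [ContinuousMap.norm_le _ (by positivity)]
    exact fun x => hb n x
  have h := intervalIntegral.hasSum_intervalIntegral_of_summable_norm hsum
  have h1 : ∀ n, ∫ θ in (0 : ℝ)..π, f n θ = if n = 0 then (π / 2 : ℂ) else 0 := by
    intro n
    have e : ∀ θ : ℝ, f n θ = w ^ n * ((sin ((n + 1 : ℕ) * θ) * sin θ : ℝ) : ℂ) := by
      intro θ; simp only [f, ContinuousMap.coe_mk]; push_cast; ring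
    simp only [e]
    rw [intervalIntegral.integral_const_mul, intervalIntegral.integral_ofReal,
      integral_sin_nat_mul_sin]
    split_ifs with hn
    · subst hn; simp
    · simp
  have h2 : ∀ θ : ℝ, ∑' n, f n θ
      = ((sin θ : ℝ) : ℂ) ^ 2 / (1 - 2 * w * ((cos θ : ℝ) : ℂ) + w ^ 2) := by
    intro θ
    have h3 := (hasSum_pow_mul_sin hw θ).mul_right ((sin θ : ℝ) : ℂ)
    have h4 := h3.tsum_eq
    simp only [f, ContinuousMap.coe_mk]
    rw [h4]
    ring
  simp only [h1, h2] at h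
  have h5 := hasSum_ite_eq (0 : ℕ) (π / 2 : ℂ)
  exact h.unique h5

/-- The semicircle integral at the Joukowski image of a point `-t` of `[-1, 0)`. At `t = 1` the
integrand has the junk value `0` at `θ = π`, which does not affect the integral. -/
theorem integral_sin_sq_div_neg {t : ℝ} (ht : 0 < t) (ht1 : t ≤ 1) :
    IntervalIntegrable (fun θ : ℝ =>
      ((sin θ : ℝ) : ℂ) ^ 2 / (1 + 2 * t * ((cos θ : ℝ) : ℂ) + t ^ 2)) volume
      0 π ∧
    ∫ θ in (0 : ℝ)..π, ((sin θ : ℝ) : ℂ) ^ 2 / (1 + 2 * t * ((cos θ : ℝ) : ℂ) + t ^ 2)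
      = (π / 2 : ℂ) := by
  rcases ht1.lt_or_eq with h | h
  · have hw : ‖(-t : ℂ)‖ < 1 := by rwa [norm_neg, Complex.norm_real, Real.norm_of_nonneg ht.le]
    have h1 := integral_sin_sq_div hw
    have h2 := continuous_sin_sq_div hw
    have e : ∀ θ : ℝ, (1 - 2 * (-t : ℂ) * ((cos θ : ℝ) : ℂ) + (-t : ℂ) ^ 2)
        = 1 + 2 * t * ((cos θ : ℝ) : ℂ) + t ^ 2 := by intro θ; ring
    simp only [e] at h1 h2
    exact ⟨h2.intervalIntegrable _ _, h1⟩
  · subst h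
    have e : ∀ θ ∈ uIoo (0 : ℝ) π, ((1 - (cos θ : ℝ)) / 2 : ℂ)
        = ((sin θ : ℝ) : ℂ) ^ 2 / (1 + 2 * (1 : ℝ) * ((cos θ : ℝ) : ℂ) + (1 : ℝ) ^ 2) := by
      intro θ hθ
      rw [uIoo_of_le pi_pos.le] at hθ
      have hc : (cos θ : ℝ) ≠ -1 := by
        intro hc
        have hs := Real.sin_pos_of_pos_of_lt_pi hθ.1 hθ.2
        have := Real.sin_sq_add_cos_sq θ
        rw [hc] at this
        nlinarith
      have hs : ((sin θ : ℝ) : ℂ) ^ 2 = 1 - (cos θ : ℝ) ^ 2 := by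
        rw [← Complex.ofReal_pow, Real.sin_sq]; push_cast; ring
      have hne : (1 + (cos θ : ℝ) : ℂ) ≠ 0 := by
        intro h0
        apply hc
        have : ((1 + cos θ : ℝ) : ℂ) = 0 := by push_cast; exact_mod_cast h0
        have := Complex.ofReal_eq_zero.1 this
        linarith
      rw [hs]
      have e2 : (1 + 2 * ((1 : ℝ) : ℂ) * (cos θ : ℝ) + ((1 : ℝ) : ℂ) ^ 2 : ℂ)
          = 2 * (1 + (cos θ : ℝ)) := by
        push_cast; ring
      rw [e2, eq_div_iff (mul_ne_zero two_ne_zero hne)]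
      push_cast
      ring
    have hcont : Continuous fun θ : ℝ => ((1 - (cos θ : ℝ)) / 2 : ℂ) := by fun_prop
    refine ⟨(hcont.intervalIntegrable 0 π).congr_uIoo e, ?_⟩
    rw [← intervalIntegral.integral_congr_uIoo e]
    have e3 : ∀ θ : ℝ, ((1 - (cos θ : ℝ)) / 2 : ℂ) = (((1 - cos θ) / 2 : ℝ) : ℂ) := by
      intro θ; push_cast; ring
    simp only [e3]
    rw [intervalIntegral.integral_ofReal, intervalIntegral.integral_div,
      intervalIntegral.integral_sub (by simp) (Continuous.intervalIntegrable (by fun_prop) _ _)]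
    simp

/-- The Marchenko–Pastur integral after the substitution `x = 1 + t² + 2 t cos θ`. -/
theorem integral_sin_sq_div_mul {t : ℝ} (ht : 0 < t) (ht1 : t ≤ 1) {w : ℂ} (hw : ‖w‖ < 1)
    (hw0 : w ≠ -t) :
    ∫ θ in (0 : ℝ)..π, ((sin θ : ℝ) : ℂ) ^ 2 / ((1 + 2 * t * ((cos θ : ℝ) : ℂ) + t ^ 2)
      * (1 - 2 * w * ((cos θ : ℝ) : ℂ) + w ^ 2)) = (π / 2 / (1 + t * w) : ℂ) := by
  obtain ⟨h1, h2⟩ := integral_sin_sq_div_neg ht ht1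
  have h3 := integral_sin_sq_div hw
  have h4 := (continuous_sin_sq_div hw).intervalIntegrable (μ := volume) 0 π
  have hwt : w + t ≠ 0 := fun h => hw0 (eq_neg_of_add_eq_zero_left h)
  have htw : 1 + t * w ≠ 0 := by
    intro h
    have : ‖(t : ℂ) * w‖ = 1 := by
      rw [eq_neg_of_add_eq_zero_right h, norm_neg, norm_one]
    rw [norm_mul, Complex.norm_real, Real.norm_of_nonneg ht.le] at this
    nlinarith [norm_nonneg w]
  have e : ∀ θ ∈ uIoo (0 : ℝ) π, ((sin θ : ℝ) : ℂ) ^ 2 / ((1 + 2 * t * ((cos θ : ℝ) : ℂ) + t ^ 2)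
      * (1 - 2 * w * ((cos θ : ℝ) : ℂ) + w ^ 2))
      = ((w + t) * (1 + t * w))⁻¹ * (w * (((sin θ : ℝ) : ℂ) ^ 2
          / (1 - 2 * w * ((cos θ : ℝ) : ℂ) + w ^ 2))
        + t * (((sin θ : ℝ) : ℂ) ^ 2 / (1 + 2 * t * ((cos θ : ℝ) : ℂ) + t ^ 2))) := by
    intro θ hθ
    rw [uIoo_of_le pi_pos.le] at hθ
    have hs := Real.sin_pos_of_pos_of_lt_pi hθ.1 hθ.2
    have hd1 := one_sub_two_mul_cos_add_sq_ne_zero hw θ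
    have hd2 : (1 + 2 * t * ((cos θ : ℝ) : ℂ) + t ^ 2 : ℂ) ≠ 0 := by
      have : (1 + 2 * t * ((cos θ : ℝ) : ℂ) + t ^ 2 : ℂ)
          = (((t + cos θ) ^ 2 + sin θ ^ 2 : ℝ) : ℂ) := by
        rw [Real.sin_sq]; push_cast; ring
      rw [this, Complex.ofReal_ne_zero]
      positivity
    set D1 := 1 - 2 * w * ((cos θ : ℝ) : ℂ) + w ^ 2 with hD1
    set D2 : ℂ := 1 + 2 * t * ((cos θ : ℝ) : ℂ) + t ^ 2 with hD2
    have key : w * D2 + t * D1 = (w + t) * (1 + t * w) := by rw [hD1, hD2]; ring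
    rw [eq_inv_mul_iff_mul_eq₀ (mul_ne_zero hwt htw), ← key]
    field_simp
  rw [intervalIntegral.integral_congr_uIoo e, intervalIntegral.integral_const_mul,
    intervalIntegral.integral_add (h4.const_mul w) (h1.const_mul (t : ℂ)),
    intervalIntegral.integral_const_mul, intervalIntegral.integral_const_mul, h2, h3]
  field_simp

theorem lambdaMinus_eq {d : ℝ} (hd : 0 < d) : lambdaMinus d = 1 + d - 2 * √d := by
  rw [lambdaMinus]; nlinarith [Real.sq_sqrt hd.le]

theorem lambdaPlus_eq {d : ℝ} (hd : 0 < d) : lambdaPlus d = 1 + d + 2 * √d := by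
  rw [lambdaPlus]; nlinarith [Real.sq_sqrt hd.le]

theorem measurable_rhoMP (d : ℝ) : Measurable (rhoMP d) := by
  unfold rhoMP
  exact Measurable.indicator (by fun_prop) measurableSet_Icc

theorem rhoMP_nonneg {d : ℝ} (hd : 0 < d) (x : ℝ) : 0 ≤ rhoMP d x := by
  unfold rhoMP
  refine indicator_nonneg (fun x hx => ?_) x
  have : 0 ≤ x := le_trans (by rw [lambdaMinus]; positivity) hx.1
  positivity

theorem stieltjesMP_eq_integral {d : ℝ} (hd : 0 < d) (z : ℂ) :
    stieltjesMP d z = ∫ θ in (0 : ℝ)..π, (2 / π : ℂ) * (((sin θ : ℝ) : ℂ) ^ 2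
      / (1 + 2 * (√d : ℝ) * ((cos θ : ℝ) : ℂ) + ((√d : ℝ) : ℂ) ^ 2)
        * (1 + 2 * (√d : ℝ) * ((cos θ : ℝ) : ℂ) + ((√d : ℝ) : ℂ) ^ 2 - z)⁻¹) := by
  set t := √d with ht
  have ht0 : 0 < t := Real.sqrt_pos.2 hd
  have htd : t ^ 2 = d := Real.sq_sqrt hd.le
  let φ : ℝ → ℝ := fun θ => 1 + d + 2 * t * cos θ
  have hres : ∀ x : ℝ, resolvent z x = ((x : ℂ) - z)⁻¹ := by
    intro x
    rw [resolvent, Ring.inverse_eq_inv']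
    rfl
  have h1 : stieltjesMP d z = ∫ x in Icc (lambdaMinus d) (lambdaPlus d),
      (1 / (2 * d * π * x) * √((lambdaPlus d - x) * (x - lambdaMinus d))) • ((x : ℂ) - z)⁻¹ := by
    rw [stieltjesMP, resolventTransform_apply, marchenkoPastur,
      integral_withDensity_eq_integral_toReal_smul (measurable_rhoMP d).ennreal_ofReal (by simp)]
    simp only [ENNReal.toReal_ofReal (rhoMP_nonneg hd _), hres]
    rw [← integral_indicator measurableSet_Icc]
    refine integral_congr_ae (Filter.Eventually.of_forall fun x => ?_)
    simp only [rhoMP, indicator]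
    split_ifs <;> simp
  have himg : Icc (lambdaMinus d) (lambdaPlus d) = φ '' Icc 0 π := by
    have : φ '' Icc 0 π = (fun y => 1 + d + 2 * t * y) '' (cos '' Icc 0 π) := by
      rw [image_image]
    rw [this, Real.bijOn_cos.image_eq, lambdaMinus_eq hd, lambdaPlus_eq hd]
    ext x
    simp only [mem_image, mem_Icc]
    constructor
    · rintro ⟨h1, h2⟩
      refine ⟨(x - (1 + d)) / (2 * t), ⟨?_, ?_⟩, by field_simp; ring⟩
      · rw [le_div_iff₀ (by positivity)]; linarith
      · rw [div_le_iff₀ (by positivity)]; linarith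
    · rintro ⟨y, ⟨h1, h2⟩, rfl⟩
      constructor <;> nlinarith
  have hinj : InjOn φ (Icc 0 π) := by
    intro x hx y hy hxy
    refine Real.injOn_cos hx hy ?_
    have : 2 * t * cos x = 2 * t * cos y := by simpa [φ] using hxy
    exact mul_left_cancel₀ (by positivity) this
  have hder : ∀ θ ∈ Icc 0 π, HasDerivWithinAt φ (2 * t * -sin θ) (Icc 0 π) θ := fun θ _ =>
    (((Real.hasDerivAt_cos θ).const_mul (2 * t)).const_add (1 + d)).hasDerivWithinAt
  rw [h1, himg, integral_image_eq_integral_abs_deriv_smul measurableSet_Icc hder hinj,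
    intervalIntegral.integral_of_le pi_pos.le, ← integral_Icc_eq_integral_Ioc]
  refine setIntegral_congr_fun measurableSet_Icc fun θ hθ => ?_
  have hs : 0 ≤ sin θ := Real.sin_nonneg_of_mem_Icc hθ
  have e1 : (lambdaPlus d - φ θ) * (φ θ - lambdaMinus d) = (2 * t * sin θ) ^ 2 := by
    rw [lambdaMinus_eq hd, lambdaPlus_eq hd, mul_pow, Real.sin_sq]
    simp only [φ]; ring
  have e2 : |2 * t * -sin θ| = 2 * t * sin θ := by
    rw [mul_neg, abs_neg, abs_of_nonneg (by positivity)]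
  have e3 : (1 + 2 * (t : ℂ) * ((cos θ : ℝ) : ℂ) + (t : ℂ) ^ 2) = ((φ θ : ℝ) : ℂ) := by
    simp only [φ, ← htd]; push_cast; ring
  rw [e1, Real.sqrt_sq (by positivity), e2, e3, smul_smul, Complex.real_smul]
  have e4 : 2 * t * sin θ * (1 / (2 * d * π * φ θ) * (2 * t * sin θ))
      = 2 / π * (sin θ ^ 2 / φ θ) := by
    rw [← htd]
    by_cases h0 : φ θ = 0
    · simp [h0]
    · field_simp
  rw [e4]
  push_cast
  ring

/-- Every point of the upper half plane is `1 + d + √d (w + w⁻¹)` for some `w ≠ 0` in the open unit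
disc. -/
theorem exists_joukowski {d : ℝ} (hd : 0 < d) {z : ℂ} (hz : 0 < z.im) :
    ∃ w : ℂ, w ≠ 0 ∧ ‖w‖ < 1 ∧ z = 1 + d + (√d : ℝ) * (w + w⁻¹) := by
  set t := √d with ht
  have ht0 : 0 < t := Real.sqrt_pos.2 hd
  have htc : (t : ℂ) ≠ 0 := by exact_mod_cast ht0.ne'
  set ζ : ℂ := (z - 1 - d) / t with hζ
  obtain ⟨s, hs⟩ := IsAlgClosed.exists_pow_nat_eq (ζ ^ 2 - 4) two_pos
  have hprod : ((ζ - s) / 2) * ((ζ + s) / 2) = 1 := by linear_combination -hs / 4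
  have hw0 : (ζ - s) / 2 ≠ 0 := left_ne_zero_of_mul_eq_one hprod
  have hinv : ((ζ - s) / 2)⁻¹ = (ζ + s) / 2 := inv_eq_of_mul_eq_one_right hprod
  set w := (ζ - s) / 2 with hw
  have hsum : w + w⁻¹ = ζ := by rw [hinv, hw]; ring
  have hzw : z = 1 + d + t * (w + w⁻¹) := by
    rw [hsum, hζ]; field_simp; ring
  rcases lt_trichotomy ‖w‖ 1 with h | h | h
  · exact ⟨w, hw0, h, hzw⟩
  · exfalso
    have h1 : w⁻¹ = starRingEnd ℂ w := Complex.inv_eq_conj h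
    rw [h1, Complex.add_conj] at hzw
    have := congrArg Complex.im hzw
    simp at this
    linarith
  · refine ⟨w⁻¹, inv_ne_zero hw0, ?_, ?_⟩
    · rw [norm_inv]; exact inv_lt_one_of_one_lt₀ h
    · rw [inv_inv, add_comm w⁻¹]; exact hzw

/-- The Stieltjes transform of the Marchenko–Pastur distribution in the Joukowski coordinate. -/
theorem stieltjesMP_eq {d : ℝ} (hd : 0 < d) (hd1 : d ≤ 1) {z w : ℂ} (hz : 0 < z.im) (hw0 : w ≠ 0)
    (hw : ‖w‖ < 1) (hzw : z = 1 + d + (√d : ℝ) * (w + w⁻¹)) :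
    stieltjesMP d z = -w / ((√d : ℝ) * (1 + (√d : ℝ) * w)) := by
  rw [stieltjesMP_eq_integral hd]
  set t := √d with ht
  have ht0 : 0 < t := Real.sqrt_pos.2 hd
  have ht1 : t ≤ 1 := Real.sqrt_le_one.2 hd1
  have htd : t ^ 2 = d := Real.sq_sqrt hd.le
  have htc : (t : ℂ) ≠ 0 := by exact_mod_cast ht0.ne'
  have hwt : w ≠ -t := by
    rintro rfl
    have : z.im = 0 := by
      rw [hzw, show (-(t : ℂ)) + (-(t : ℂ))⁻¹ = ((-t + (-t)⁻¹ : ℝ) : ℂ) by push_cast; rfl]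
      rw [← Complex.ofReal_mul]
      simp
    exact hz.ne' this
  have e : ∀ θ : ℝ, (2 / π : ℂ) * (((sin θ : ℝ) : ℂ) ^ 2
      / (1 + 2 * t * ((cos θ : ℝ) : ℂ) + (t : ℂ) ^ 2)
      * (1 + 2 * t * ((cos θ : ℝ) : ℂ) + (t : ℂ) ^ 2 - z)⁻¹)
      = (2 / π * (-w / t)) * (((sin θ : ℝ) : ℂ) ^ 2 / ((1 + 2 * t * ((cos θ : ℝ) : ℂ) + t ^ 2)
      * (1 - 2 * w * ((cos θ : ℝ) : ℂ) + w ^ 2))) := by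
    intro θ
    have e1 : 1 + 2 * t * ((cos θ : ℝ) : ℂ) + (t : ℂ) ^ 2 - z
        = -(t / w) * (1 - 2 * w * ((cos θ : ℝ) : ℂ) + w ^ 2) := by
      rw [hzw, ← htd]
      push_cast
      field_simp
      ring
    rw [e1, mul_inv, neg_div, ← inv_div, inv_neg]
    simp only [div_eq_mul_inv, mul_inv, inv_inv]
    ring
  simp only [e]
  rw [intervalIntegral.integral_const_mul, integral_sin_sq_div_mul ht0 ht1 hw hwt]
  have hpi : (π : ℂ) ≠ 0 := by exact_mod_cast pi_ne_zero
  simp only [div_eq_mul_inv, mul_inv]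
  field_simp

/-- In the bulk the inverse Joukowski coordinate stays away from the real axis. -/
theorem joukowski_inv_im_ge {d κ : ℝ} (hd : 0 < d) (hd1 : d ≤ 1) (hκ : 0 < κ) {z w : ℂ}
    (hz : 0 < z.im) (hz1 : lambdaMinus d + κ < z.re) (hz2 : z.re < lambdaPlus d - κ) (hw0 : w ≠ 0)
    (hw : ‖w‖ < 1) (hzw : z = 1 + d + (√d : ℝ) * (w + w⁻¹)) : √(κ / 2) ≤ (w⁻¹).im := by
  rw [lambdaMinus_eq hd] at hz1
  rw [lambdaPlus_eq hd] at hz2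
  set t := √d with ht
  have ht0 : 0 < t := Real.sqrt_pos.2 hd
  have ht1 : t ≤ 1 := Real.sqrt_le_one.2 hd1
  set v := w⁻¹ with hv
  have hwv : w = v⁻¹ := by rw [hv, inv_inv]
  set N := Complex.normSq v with hN
  have hN1 : 1 < N := by
    rw [hN, Complex.normSq_eq_norm_sq, hv, norm_inv]
    exact one_lt_pow₀ ((one_lt_inv₀ (norm_pos_iff.2 hw0)).2 hw) two_ne_zero
  have hN0 : 0 < N := by linarith
  have hNe : N = v.re * v.re + v.im * v.im := Complex.normSq_apply v
  set y := 1 / N with hy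
  have hyN : y * N = 1 := by rw [hy]; field_simp
  have hy0 : 0 < y := by positivity
  have hy1 : y < 1 := by rw [hy, div_lt_one hN0]; exact hN1
  have hre : z.re = 1 + d + t * (v.re * (1 + y)) := by
    rw [hzw, hwv]
    simp only [Complex.add_re, Complex.one_re, Complex.ofReal_re, Complex.mul_re,
      Complex.ofReal_im, zero_mul, sub_zero, Complex.inv_re]
    rw [hy, hN]
    ring
  have him : z.im = t * (v.im * (1 - y)) := by
    rw [hzw, hwv]
    simp only [Complex.add_im, Complex.one_im, Complex.ofReal_re, Complex.mul_im,
      Complex.ofReal_im, zero_mul, add_zero, zero_add, Complex.inv_im]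
    rw [hy, hN]
    ring
  have hb : 0 < v.im := by
    rw [him] at hz
    have h1 : 0 < v.im * (1 - y) := pos_of_mul_pos_right hz ht0.le
    exact pos_of_mul_pos_left h1 (by linarith)
  refine Real.sqrt_le_iff.2 ⟨hb.le, ?_⟩
  have h1 : κ ≤ t * (2 - v.re * (1 + y)) := by nlinarith
  have h2 : κ ≤ t * (2 + v.re * (1 + y)) := by nlinarith
  set p := v.re * (1 + y) with hp
  -- `κ ≤ κ / t ≤ 2 - |p|`, and `p² = (N - b²) (1 + 1/N)² ≥ 4 - 4 b²` where `b` is the imaginary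
  -- part of `v`
  have h3 : κ ≤ 2 - p := by nlinarith
  have h4 : κ ≤ 2 + p := by nlinarith
  have h5 : p ^ 2 = (N - v.im ^ 2) * (1 + y) ^ 2 := by rw [hp, hNe]; ring
  have h6 : 4 ≤ N * (1 + y) ^ 2 := by
    have : N * (1 + y) ^ 2 = N + 2 * (y * N) + y * (y * N) := by ring
    rw [this, hyN]
    nlinarith [sq_nonneg (N - 1), mul_pos hy0 hN0]
  have h7 : (1 + y) ^ 2 ≤ 4 := by nlinarith
  have h8 : 4 - 4 * v.im ^ 2 ≤ p ^ 2 := by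
    rw [h5]
    nlinarith [mul_le_mul_of_nonneg_left h7 (sq_nonneg v.im)]
  have h9 : p ^ 2 ≤ (2 - κ) ^ 2 := by
    refine sq_le_sq' (by linarith) (by linarith)
  nlinarith

/-- Stability of the self-consistent equation in the bulk: an approximate solution `u` with
`Im (z u) ≥ 0` is close to the Marchenko–Pastur transform. -/
theorem norm_sub_stieltjesMP_le {d κ : ℝ} (hd : 0 < d) (hd1 : d ≤ 1) (hκ : 0 < κ) {z : ℂ}
    (hz : 0 < z.im) (hz1 : lambdaMinus d + κ < z.re) (hz2 : z.re < lambdaPlus d - κ) {u : ℂ}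
    (hu : 0 ≤ (z * u).im) :
    √d * √(κ / 2) * ‖u - stieltjesMP d z‖ ≤ ‖d * z * u ^ 2 + (z + d - 1) * u + 1‖ := by
  obtain ⟨w, hw0, hw, hzw⟩ := exists_joukowski hd hz
  have hb := joukowski_inv_im_ge hd hd1 hκ hz hz1 hz2 hw0 hw hzw
  rw [stieltjesMP_eq hd hd1 hz hw0 hw hzw]
  set t := √d with ht
  have ht0 : 0 < t := Real.sqrt_pos.2 hd
  have ht1 : t ≤ 1 := Real.sqrt_le_one.2 hd1
  have htd : t ^ 2 = d := Real.sq_sqrt hd.le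
  have htc : (t : ℂ) ≠ 0 := by exact_mod_cast ht0.ne'
  have htw : 1 + t * w ≠ 0 := by
    intro h
    have : ‖(t : ℂ) * w‖ = 1 := by
      rw [eq_neg_of_add_eq_zero_right h, norm_neg, norm_one]
    rw [norm_mul, Complex.norm_real, Real.norm_of_nonneg ht0.le] at this
    nlinarith [norm_nonneg w]
  -- the second factor is `z` times the distance to the other root of the quadratic equation
  have e : d * z * u ^ 2 + (z + d - 1) * u + 1
      = (t : ℂ) * ((u - -w / (t * (1 + t * w))) * (t * (z * u + 1) + w⁻¹)) := by
    rw [hzw, ← htd]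
    push_cast
    field_simp
    ring
  rw [e, norm_mul, norm_mul, Complex.norm_real, Real.norm_of_nonneg ht0.le]
  have h1 : √(κ / 2) ≤ ‖t * (z * u + 1) + w⁻¹‖ := by
    refine hb.trans (le_trans ?_ ((le_abs_self _).trans (Complex.abs_im_le_norm _)))
    have : (t * (z * u + 1) + w⁻¹ : ℂ).im = t * (z * u).im + (w⁻¹).im := by
      simp [Complex.add_im, Complex.mul_im]
    rw [this]
    nlinarith
  rw [mul_assoc, mul_comm (√(κ / 2))]
  gcongr

end MarchenkoPastur

/-! ### From small corner defects to the Stieltjes transform -/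

section Deterministic

variable {n : ℕ}

/-- The distances between the normalized trace and the corner entry of the resolvent of `c B Bᵀ` at
`z`, for `B` and for its minor, added up. -/
noncomputable def defectSum (c : ℝ) (z : ℂ) (B : Matrix (Fin (n + 2)) (Fin (n + 2)) ℝ) : ℝ :=
  ‖cornerDefect c z B‖ / (n + 2) + ‖cornerDefect c z (minor B)‖ / (n + 1)

theorem defectSum_nonneg (c : ℝ) (z : ℂ) (B : Matrix (Fin (n + 2)) (Fin (n + 2)) ℝ) :
    0 ≤ defectSum c z B := by
  unfold defectSum; positivity

theorem norm_trace_res_le {m : ℕ} {A : Matrix (Fin m) (Fin m) ℝ} (hA : A.IsSymm) {z : ℂ}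
    (hz : z.im ≠ 0) : ‖(res A z).trace‖ ≤ m * |z.im|⁻¹ := by
  calc _ ≤ ∑ _i : Fin m, |z.im|⁻¹ :=
        norm_sum_le_of_le _ fun i _ => norm_res_diag_le hA hz i
    _ = _ := by simp

theorem norm_cornerDefect_le (c : ℝ) {z : ℂ} (hz : z.im ≠ 0)
    (B : Matrix (Fin (n + 1)) (Fin (n + 1)) ℝ) :
    ‖cornerDefect c z B‖ ≤ (n + 1) * (2 * |z.im|⁻¹) := by
  unfold cornerDefect
  refine (norm_sub_le _ _).trans ?_
  have h1 := norm_trace_res_le (gram_isSymm c B) hz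
  have h2 := norm_res_diag_le (gram_isSymm c B) hz 0
  have h3 : ‖((n : ℂ) + 1)‖ = n + 1 := by
    rw [← Nat.cast_succ, Complex.norm_natCast]; push_cast; rfl
  rw [norm_mul, h3]
  push_cast at h1
  nlinarith [mul_le_mul_of_nonneg_left h2 (by positivity : (0 : ℝ) ≤ n + 1)]

theorem defectSum_le (c : ℝ) {z : ℂ} (hz : z.im ≠ 0)
    (B : Matrix (Fin (n + 2)) (Fin (n + 2)) ℝ) : defectSum c z B ≤ 4 * |z.im|⁻¹ := by
  have h1 := norm_cornerDefect_le c hz B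
  have h2 := norm_cornerDefect_le c hz (minor B)
  have e1 : ‖cornerDefect c z B‖ / (n + 2) ≤ 2 * |z.im|⁻¹ := by
    rw [div_le_iff₀ (by positivity)]; push_cast at h1; linarith
  have e2 : ‖cornerDefect c z (minor B)‖ / (n + 1) ≤ 2 * |z.im|⁻¹ := by
    rw [div_le_iff₀ (by positivity)]; linarith
  unfold defectSum; linarith

/-- The corner entries of the resolvents of `B` and of its minor are close, because the traces
are. -/
theorem norm_corner_sub_le {B : Matrix (Fin (n + 2)) (Fin (n + 2)) ℝ} (hB : IsLowerBidiagonal B)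
    (c : ℝ) {z : ℂ} (hz : 0 < z.im) :
    ‖res (gram c B) z 0 0 - res (gram c (minor B)) z 0 0‖
      ≤ defectSum c z B + 3 / ((n + 2) * z.im) := by
  have h1 := norm_trace_res_sub_minor_le hB c hz.ne'
  have h2 := norm_trace_res_le (gram_isSymm c (minor B)) hz.ne'
  rw [abs_of_pos hz] at h1 h2
  set T := (res (gram c B) z).trace
  set T' := (res (gram c (minor B)) z).trace
  set u := res (gram c B) z 0 0
  set g := res (gram c (minor B)) z 0 0
  have hn2 : ‖((n : ℂ) + 2)‖ = n + 2 := by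
    have : ((n : ℂ) + 2) = ((n + 2 : ℕ) : ℂ) := by push_cast; rfl
    rw [this, Complex.norm_natCast]; push_cast; rfl
  have hn1 : ‖((n : ℂ) + 1)‖ = n + 1 := by
    rw [← Nat.cast_succ, Complex.norm_natCast]; push_cast; rfl
  have hz2 : ((n : ℂ) + 2) ≠ 0 := by
    rw [← norm_ne_zero_iff, hn2]; positivity
  have hz1 : ((n : ℂ) + 1) ≠ 0 := by
    rw [← norm_ne_zero_iff, hn1]; positivity
  have e : u - g = -(cornerDefect c z B / (n + 2)) + cornerDefect c z (minor B) / (n + 1)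
      + ((T - T') / (n + 2) - T' / ((n + 2) * (n + 1))) := by
    have a1 : cornerDefect c z B = T - (n + 2) * u := by
      simp only [cornerDefect, T, u]; push_cast; ring
    have a2 : cornerDefect c z (minor B) = T' - (n + 1) * g := rfl
    rw [a1, a2]
    field_simp
    ring
  rw [e]
  refine (norm_add_le _ _).trans (add_le_add ((norm_add_le _ _).trans ?_) ?_)
  · rw [norm_neg, norm_div, norm_div, hn2, hn1]; rfl
  · refine (norm_sub_le _ _).trans ?_
    rw [norm_div, norm_div, norm_mul, hn2, hn1]
    have : (3 : ℝ) / ((n + 2) * z.im)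
        = 2 * z.im⁻¹ / (n + 2) + ((n + 1 : ℕ) * z.im⁻¹) / ((n + 2) * (n + 1)) := by
      push_cast; field_simp; norm_num
    rw [this]
    gcongr

/-- In terms of the corner entry `u` of `B` and its distance from the corner entry `g` of the minor,
the Schur complement formula is a quadratic equation for `u`. Away from `z = 0` its leading
coefficient is bounded below, so `u` is bounded however close `z` is to the real axis. -/
theorem norm_corner_le {d κ : ℝ} (hd : 0 < d) (hd1 : d ≤ 1) (hκ : 0 < κ) {z u g : ℂ} {α γ : ℝ}
    (hz : κ ≤ z.re) (hz6 : ‖z‖ ≤ 6) (hα : |α - 1| ≤ d / 2) (hγ : |γ - d| ≤ d / 2)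
    (h : z * γ * g * u + (z - α) * u + γ * g + 1 = 0) :
    ‖u‖ ≤ (1 + 48 / (κ * d)) * (1 + ‖u - g‖) := by
  have hzκ : κ ≤ ‖z‖ := hz.trans ((le_abs_self _).trans (Complex.abs_re_le_norm z))
  rw [abs_le] at hα hγ
  have hα0 : ‖(α : ℂ)‖ ≤ 2 := by
    rw [Complex.norm_real, Real.norm_eq_abs, abs_le]; constructor <;> linarith
  have hγ0 : ‖(γ : ℂ)‖ ≤ 2 := by
    rw [Complex.norm_real, Real.norm_eq_abs, abs_le]; constructor <;> linarith
  have hγ1 : d / 2 ≤ ‖(γ : ℂ)‖ := by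
    rw [Complex.norm_real, Real.norm_eq_abs]
    exact le_trans (by linarith) (le_abs_self _)
  set t := ‖u - g‖ with ht
  have ht0 : 0 ≤ t := norm_nonneg _
  have hU0 : 0 ≤ ‖u‖ := norm_nonneg _
  have hb : 0 < 48 / (κ * d) := by positivity
  rcases le_or_gt ‖u‖ 1 with h1 | h1
  · nlinarith
  have e : z * γ * (u * u) = z * γ * (u - g) * u - (z - α + γ) * u + γ * (u - g) - 1 := by
    linear_combination h
  have e1 : ‖z‖ * ‖(γ : ℂ)‖ * (‖u‖ * ‖u‖)
      ≤ 6 * 2 * t * ‖u‖ + (6 + 2 + 2) * ‖u‖ + 2 * t + 1 := by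
    rw [← norm_mul, ← norm_mul, ← norm_mul, e]
    refine (norm_sub_le _ _).trans (add_le_add ((norm_add_le _ _).trans (add_le_add
      ((norm_sub_le _ _).trans (add_le_add ?_ ?_)) ?_)) (by simp))
    · rw [norm_mul, norm_mul, norm_mul]; gcongr
    · rw [norm_mul]
      gcongr
      exact (norm_add_le _ _).trans (add_le_add ((norm_sub_le _ _).trans (add_le_add hz6 hα0)) hγ0)
    · rw [norm_mul]; gcongr
  have e2 : κ * (d / 2) * (‖u‖ * ‖u‖) ≤ ‖z‖ * ‖(γ : ℂ)‖ * (‖u‖ * ‖u‖) := by gcongr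
  have e3 : κ * (d / 2) * (‖u‖ * ‖u‖) ≤ 24 * (1 + t) * ‖u‖ := by nlinarith
  have e4 : κ * (d / 2) * ‖u‖ ≤ 24 * (1 + t) := by
    by_contra! hc
    nlinarith
  have e5 : ‖u‖ ≤ 48 / (κ * d) * (1 + t) := by
    rw [div_mul_eq_mul_div, le_div_iff₀ (by positivity)]; linarith
  nlinarith

/-- The constant in `norm_selfConsistent_le`. -/
noncomputable def selfConsistentConst (d κ : ℝ) : ℝ :=
  (12 * (1 + 48 / (κ * d)) + 1) * (2 * (1 + 48 / (κ * d)) + 2) + 2 * (1 + 48 / (κ * d))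

theorem selfConsistentConst_nonneg {d κ : ℝ} (hd : 0 < d) (hκ : 0 < κ) :
    0 ≤ selfConsistentConst d κ := by
  unfold selfConsistentConst; positivity

/-- If the two corner entries are close and the coefficients are close to their means, then the
corner entry nearly solves the self-consistent equation of the Marchenko–Pastur law. -/
theorem norm_selfConsistent_le {d κ δ : ℝ} (hd : 0 < d) (hd1 : d ≤ 1) (hκ : 0 < κ) {z u g : ℂ}
    {α γ : ℝ} (hδ : δ ≤ d / 2)
    (hz : κ ≤ z.re) (hz6 : ‖z‖ ≤ 6) (hα : |α - 1| ≤ δ) (hγ : |γ - d| ≤ δ)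
    (hug : ‖u - g‖ ≤ δ)
    (h : z * γ * g * u + (z - α) * u + γ * g + 1 = 0) :
    ‖d * z * u ^ 2 + (z + d - 1) * u + 1‖
      ≤ selfConsistentConst d κ * δ := by
  have hu := norm_corner_le hd hd1 hκ hz hz6 (hα.trans hδ) (hγ.trans hδ) h
  unfold selfConsistentConst
  have hδ0 : 0 ≤ δ := (abs_nonneg _).trans hα
  set K := 1 + 48 / (κ * d)
  have hK0 : 0 ≤ K := by positivity
  have hu' : ‖u‖ ≤ 2 * K := by nlinarith
  have hγ0 : ‖(γ : ℂ)‖ ≤ 2 := by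
    rw [Complex.norm_real, Real.norm_eq_abs]
    rw [abs_le] at hγ ⊢; constructor <;> linarith
  have hα' : ‖(α : ℂ) - 1‖ ≤ δ := by
    rw [← Complex.ofReal_one, ← Complex.ofReal_sub, Complex.norm_real]; exact hα
  have hγ' : ‖(d : ℂ) - γ‖ ≤ δ := by
    rw [← Complex.ofReal_sub, Complex.norm_real, Real.norm_eq_abs, abs_sub_comm]; exact hγ
  have e : d * z * u ^ 2 + (z + d - 1) * u + 1
      = (z * u + 1) * ((d - γ) * u + γ * (u - g)) + (α - 1) * u := by
    linear_combination h
  have e1 : ‖((d : ℂ) - γ) * u + γ * (u - g)‖ ≤ (2 * K + 2) * δ := by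
    refine (norm_add_le _ _).trans ?_
    rw [norm_mul, norm_mul]
    calc _ ≤ δ * (2 * K) + 2 * δ := by gcongr
      _ = _ := by ring
  have e2 : ‖z * u + 1‖ ≤ 12 * K + 1 := by
    refine (norm_add_le _ _).trans ?_
    rw [norm_mul, norm_one]
    calc _ ≤ 6 * (2 * K) + 1 := by gcongr
      _ = _ := by ring
  rw [e]
  refine (norm_add_le _ _).trans ?_
  rw [norm_mul, norm_mul]
  calc _ ≤ (12 * K + 1) * ((2 * K + 2) * δ) + δ * (2 * K) := by gcongr
    _ = _ := by ring

/-- The deterministic part of the argument: if the corner defects are small and the first column has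
entries close to their means, then the Stieltjes transform is close to the Marchenko–Pastur
transform. -/
theorem norm_stieltjes_sub_le {d κ δ β : ℝ} (hd : 0 < d) (hd1 : d ≤ 1) (hκ : 0 < κ)
    {B : Matrix (Fin (n + 2)) (Fin (n + 2)) ℝ} (hB : IsLowerBidiagonal B) {z : ℂ}
    (hβ : 0 < β) (hz : 0 < z.im) (hz1 : lambdaMinus d + κ < z.re) (hz2 : z.re < lambdaPlus d - κ)
    (hz6 : ‖z‖ ≤ 6) (hδ : δ ≤ d / 2)
    (hα : |d / (β * (n + 2)) * B 0 0 ^ 2 - 1| ≤ δ) (hγ : |d / (β * (n + 2)) * B 1 0 ^ 2 - d| ≤ δ)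
    (hY : defectSum (d / (β * (n + 2))) z B + 3 / ((n + 2) * z.im) ≤ δ) :
    ‖stieltjes (laguerreMatrix β d B) z - stieltjesMP d z‖
      ≤ δ + selfConsistentConst d κ * δ / (√d * √(κ / 2)) := by
  set c := d / (β * (n + 2)) with hc
  have hc0 : 0 ≤ c := by positivity
  have hzκ : κ ≤ z.re := by
    have : 0 ≤ lambdaMinus d := sq_nonneg _
    linarith
  have h3 : 0 ≤ 3 / ((n + 2) * z.im) := by positivity
  have hdef := defectSum_nonneg c z B
  have hself := norm_selfConsistent_le hd hd1 hκ (u := res (gram c B) z 0 0)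
    (g := res (gram c (minor B)) z 0 0) hδ hzκ hz6 hα hγ
    ((norm_corner_sub_le hB c hz).trans hY)
    (by have := corner_equation hB c hz.ne'; push_cast; exact this)
  have hmp := norm_sub_stieltjesMP_le hd hd1 hκ hz hz1 hz2
    (res_gram_mul_im_nonneg hc0 hz 0 (B := B))
  set u := res (gram c B) z 0 0
  have e : stieltjes (laguerreMatrix β d B) z = cornerDefect c z B / (n + 2) + u := by
    have hl : laguerreMatrix β d B = gram c B := by
      simp [laguerreMatrix, gram, hc]
    have h2 : ((n : ℂ) + 2) ≠ 0 := by
      have : ((n : ℂ) + 2) = ((n + 2 : ℕ) : ℂ) := by push_cast; rfl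
      rw [this]; exact Nat.cast_ne_zero.2 (by omega)
    have a1 : cornerDefect c z B = (res (gram c B) z).trace - (n + 2) * u := by
      simp only [cornerDefect, u]; push_cast; ring
    rw [a1, stieltjes, hl]
    change _ * (res (gram c B) z).trace = _
    push_cast
    field_simp
    ring
  have hY' : ‖cornerDefect c z B / (n + 2)‖ ≤ δ := by
    have : ‖((n : ℂ) + 2)‖ = n + 2 := by
      have : ((n : ℂ) + 2) = ((n + 2 : ℕ) : ℂ) := by push_cast; rfl
      rw [this, Complex.norm_natCast]; push_cast; rfl
    rw [norm_div, this]
    refine le_trans ?_ (le_trans (le_add_of_nonneg_right h3) hY)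
    unfold defectSum
    exact le_add_of_nonneg_right (by positivity)
  have e2 : ‖u - stieltjesMP d z‖ ≤ selfConsistentConst d κ * δ / (√d * √(κ / 2)) := by
    rw [le_div_iff₀ (by positivity), mul_comm]
    exact hmp.trans hself
  rw [e, add_sub_assoc]
  exact (norm_add_le _ _).trans (add_le_add hY' e2)

/-- Lipschitz dependence on the spectral parameter, which makes a net of spectral parameters
sufficient. -/
theorem defectSum_le_add (c : ℝ) {z w : ℂ} (hz : z.im ≠ 0) (hw : w.im ≠ 0)
    (B : Matrix (Fin (n + 2)) (Fin (n + 2)) ℝ) :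
    defectSum c z B ≤ defectSum c w B + 4 * (‖z - w‖ * (|z.im|⁻¹ * |w.im|⁻¹)) := by
  have key : ∀ {k : ℕ} (M : Matrix (Fin (k + 1)) (Fin (k + 1)) ℝ),
      ‖cornerDefect c z M‖ / (k + 1)
        ≤ ‖cornerDefect c w M‖ / (k + 1) + 2 * (‖z - w‖ * (|z.im|⁻¹ * |w.im|⁻¹)) := by
    intro k M
    set D := ‖z - w‖ * (|z.im|⁻¹ * |w.im|⁻¹)
    have hl := fun i => norm_res_sub_res_le (gram_isSymm c M) hz hw i i
    have h1 : ‖cornerDefect c z M - cornerDefect c w M‖ ≤ (k + 1) * (2 * D) := by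
      have e : cornerDefect c z M - cornerDefect c w M
          = ∑ i, (res (gram c M) z i i - res (gram c M) w i i)
            - (k + 1) * (res (gram c M) z 0 0 - res (gram c M) w 0 0) := by
        simp only [cornerDefect, Matrix.trace, Matrix.diag_apply, Finset.sum_sub_distrib]; ring
      rw [e]
      refine (norm_sub_le _ _).trans ?_
      have hk : ‖((k : ℂ) + 1)‖ = k + 1 := by
        rw [← Nat.cast_succ, Complex.norm_natCast]; push_cast; rfl
      rw [norm_mul, hk]
      have a1 : ‖∑ i, (res (gram c M) z i i - res (gram c M) w i i)‖ ≤ ∑ _i : Fin (k + 1), D :=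
        norm_sum_le_of_le _ fun i _ => hl i
      simp only [Finset.sum_const, Finset.card_univ, Fintype.card_fin, nsmul_eq_mul] at a1
      push_cast at a1
      nlinarith [mul_le_mul_of_nonneg_left (hl 0) (by positivity : (0 : ℝ) ≤ k + 1)]
    have h2 := norm_le_norm_add_norm_sub' (cornerDefect c z M) (cornerDefect c w M)
    rw [div_add' _ _ _ (by positivity)]
    gcongr
    linarith
  have h1 := key B
  have h2 := key (minor B)
  have e : (((n + 1 : ℕ) : ℝ) + 1) = n + 2 := by push_cast; ring
  rw [e] at h1
  unfold defectSum
  linarith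

end Deterministic

/-! ### Moments of the corner defects -/

section Moments

variable {n : ℕ}

/-- The matrices whose two entries in the first column have normalized squares close to their
means, which are `1` and, up to `O(1 / n)`, `d`. -/
def cornerEvent (c d δ : ℝ) : Set (Matrix (Fin (n + 2)) (Fin (n + 2)) ℝ) :=
  {B | |c * B 0 0 ^ 2 - 1| ≤ δ ∧ |c * B 1 0 ^ 2 - d| ≤ δ}

theorem continuous_minor :
    Continuous (minor : Matrix (Fin (n + 1)) (Fin (n + 1)) ℝ → Matrix (Fin n) (Fin n) ℝ) :=
  continuous_matrix fun i j => by
    simp only [minor, submatrix_apply]; fun_prop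

theorem continuous_defectSum (c : ℝ) {z : ℂ} (hz : z.im ≠ 0) :
    Continuous (defectSum (n := n) c z) := by
  unfold defectSum
  have h1 := (isBoundedCont_cornerDefect (n := n + 1) c hz).1
  have h2 := (isBoundedCont_cornerDefect (n := n) c hz).1
  exact (h1.norm.div_const _).add ((h2.comp continuous_minor).norm.div_const _)

/-- Splits `x ^ (2k) (1 + x)` at `x² = τ`: below, both factors are bounded by powers of `τ`, and
above, `τ (1 + x)` is absorbed by `x²`. -/
theorem pow_mul_one_add_le {x τ : ℝ} (hx : 0 ≤ x) (hτ0 : 0 < τ) (hτ1 : τ ≤ 1) (k : ℕ) :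
    τ / 16 * ((x ^ 2) ^ k * (1 + x)) ≤ 1 / 2 * x ^ (2 * k + 2) + 1 / 2 * τ ^ (k + 1) := by
  have ex : x ^ (2 * k + 2) = (x ^ 2) ^ k * x ^ 2 := by rw [← pow_mul, ← pow_add]
  rw [ex]
  have hxk : 0 ≤ (x ^ 2) ^ k := by positivity
  rcases le_or_gt τ (x ^ 2) with hτx | hτx
  · have h3 : τ / 16 * (1 + x) ≤ 1 / 2 * x ^ 2 := by
      rcases le_or_gt x 1 with hx1 | hx1 <;> nlinarith
    have h4 : 0 ≤ τ ^ (k + 1) := by positivity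
    nlinarith [mul_le_mul_of_nonneg_left h3 hxk]
  · have hx1 : x ≤ 1 := by nlinarith
    have h5 : (x ^ 2) ^ k ≤ τ ^ k := pow_le_pow_left₀ (sq_nonneg x) hτx.le k
    have h6 : τ / 16 * ((x ^ 2) ^ k * (1 + x)) ≤ τ / 16 * (τ ^ k * (1 + 1)) := by gcongr
    have h7 : 0 ≤ τ ^ k * τ := by positivity
    rw [pow_succ τ]
    nlinarith [mul_nonneg hxk (sq_nonneg x)]

variable {Ω : Type*} [MeasurableSpace Ω] {P : Measure Ω}
  {β d : ℝ} {B : Ω → Matrix (Fin (n + 2)) (Fin (n + 2)) ℝ}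

namespace IsBidiagonalModel

/-- The condition on `n` lets `δ / 2` absorb the difference `d / (n + 2)` between `d` and the mean
of the normalized square of the subdiagonal entry. -/
theorem measureReal_cornerEvent_compl_le [IsProbabilityMeasure P]
    (hB : IsBidiagonalModel P β ((n + 2) * β / (2 * d)) B) (hβ : 0 < β) (hd : 0 < d) (hd1 : d ≤ 1)
    {δ : ℝ} (hδ : 0 < δ) (hδ1 : δ ≤ 1) (hn : 2 / δ ≤ n + 2) :
    P.real {ω | B ω ∉ cornerEvent (d / (β * (n + 2))) d δ}
      ≤ 4 * Real.exp (-(δ ^ 2 * β / 128 * (n + 2))) := by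
  have hn0 : (0 : ℝ) ≤ n := n.cast_nonneg
  have hl0 := hB.hasLaw_diag 0
  have hl1 := hB.hasLaw_subdiag 1 0 (by simp)
  set r0 := 2 * ((n + 2) * β / (2 * d)) - β * (((0 : Fin (n + 2)) : ℕ) : ℝ) with hr0
  set r1 := β * (((n + 2 : ℕ) : ℝ) - (((1 : Fin (n + 2)) : ℕ) : ℝ)) with hr1
  have er0 : r0 = (n + 2) * β / d := by rw [hr0]; simp; field_simp
  have er1 : r1 = β * (n + 1) := by rw [hr1, Fin.val_one]; push_cast; ring
  clear_value r0 r1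
  have hr0p : 0 < r0 := by rw [er0]; positivity
  have hr1p : 0 < r1 := by rw [er1]; positivity
  have hms : ∀ r t : ℝ, MeasurableSet {x : ℝ | t ≤ |x ^ 2 - r|} := fun r t =>
    measurableSet_le measurable_const (by fun_prop)
  have b0 := chiMeasure_abs_sq_sub_ge_le hr0p hδ hδ1
  have b1 := chiMeasure_abs_sq_sub_ge_le hr1p (half_pos hδ) (by linarith)
  have c0 : P.real {ω | δ * r0 ≤ |B ω 0 0 ^ 2 - r0|}
      = (chiMeasure r0).real {x : ℝ | δ * r0 ≤ |x ^ 2 - r0|} := by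
    rw [← hl0.map_eq, map_measureReal_apply_of_aemeasurable hl0.aemeasurable (hms _ _)]; rfl
  have c1 : P.real {ω | δ / 2 * r1 ≤ |B ω 1 0 ^ 2 - r1|}
      = (chiMeasure r1).real {x : ℝ | δ / 2 * r1 ≤ |x ^ 2 - r1|} := by
    rw [← hl1.map_eq, map_measureReal_apply_of_aemeasurable hl1.aemeasurable (hms _ _)]; rfl
  have hsub : {ω | B ω ∉ cornerEvent (d / (β * (n + 2))) d δ}
      ⊆ {ω | δ * r0 ≤ |B ω 0 0 ^ 2 - r0|} ∪ {ω | δ / 2 * r1 ≤ |B ω 1 0 ^ 2 - r1|} := by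
    intro ω hω
    simp only [cornerEvent, Set.mem_ofPred_eq, not_and_or, not_le] at hω
    refine hω.imp (fun h => ?_) fun h => ?_
    · have e : d / (β * (n + 2)) * B ω 0 0 ^ 2 - 1 = (B ω 0 0 ^ 2 - r0) / r0 := by
        rw [er0]; field_simp
      rw [e, abs_div, abs_of_pos hr0p, lt_div_iff₀ hr0p] at h
      exact h.le
    · have e : d / (β * (n + 2)) * B ω 1 0 ^ 2 - d
          = d / (β * (n + 2)) * (B ω 1 0 ^ 2 - r1) - d / (n + 2) := by
        rw [er1]; field_simp; ring
      have e1 : d / (n + 2) ≤ δ / 2 := by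
        rw [div_le_iff₀ hδ] at hn
        rw [div_le_iff₀ (by positivity)]; nlinarith
      have h2 := abs_sub (d / (β * (n + 2)) * (B ω 1 0 ^ 2 - r1)) (d / (n + 2))
      rw [e] at h
      rw [abs_of_nonneg (by positivity : 0 ≤ d / ((n : ℝ) + 2)), abs_mul,
        abs_of_nonneg (by positivity : 0 ≤ d / (β * ((n : ℝ) + 2)))] at h2
      have h3 : δ / 2 < d / (β * (n + 2)) * |B ω 1 0 ^ 2 - r1| := by linarith
      have h4 : d / (β * (n + 2)) * r1 ≤ 1 := by
        rw [er1, div_mul_eq_mul_div, div_le_one (by positivity)]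
        have : d * (β * (n + 1)) ≤ 1 * (β * (n + 1)) := by gcongr
        nlinarith
      have h5 : 0 < d / (β * (n + 2)) := by positivity
      change δ / 2 * r1 ≤ _
      by_contra! hc
      nlinarith [mul_lt_mul_of_pos_left hc h5]
  have hexp0 : Real.exp (-(δ ^ 2 / 16 * r0)) ≤ Real.exp (-(δ ^ 2 * β / 128 * (n + 2))) := by
    rw [Real.exp_le_exp, neg_le_neg_iff]
    have : (n + 2) * β ≤ r0 := by
      rw [er0, le_div_iff₀ hd]
      have : 0 ≤ (n + 2) * β := by positivity
      nlinarith
    have := mul_le_mul_of_nonneg_left this (by positivity : 0 ≤ δ ^ 2 / 16)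
    nlinarith [(by positivity : 0 ≤ δ ^ 2 * ((n + 2) * β))]
  have hexp1 : Real.exp (-((δ / 2) ^ 2 / 16 * r1)) ≤ Real.exp (-(δ ^ 2 * β / 128 * (n + 2))) := by
    rw [Real.exp_le_exp, neg_le_neg_iff, er1]
    nlinarith [(by positivity : 0 ≤ δ ^ 2 * β * n)]
  calc _ ≤ P.real _ := measureReal_mono hsub
    _ ≤ P.real _ + P.real _ := measureReal_union_le _ _
    _ ≤ 2 * Real.exp (-(δ ^ 2 / 16 * r0)) + 2 * Real.exp (-((δ / 2) ^ 2 / 16 * r1)) := by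
        rw [c0, c1]; exact add_le_add b0 b1
    _ ≤ _ := by linarith

/-- The loop equation for `B` and for its minor, combined. -/
theorem integral_defectSum_pow_le [IsProbabilityMeasure P]
    (hB : IsBidiagonalModel P β ((n + 2) * β / (2 * d)) B)
    (hβ : 0 < β) (hd : 0 < d) (hd1 : d ≤ 1) {z : ℂ} (hz : 0 < z.im) {c : ℝ} (hc : 0 < c) (k : ℕ) :
    ∫ ω, defectSum c z (B ω) ^ (2 * k + 2) ∂P
      ≤ 2 ^ (2 * k + 3) * (2 * k + 1) * (2 / β) / ((n + 2) * z.im)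
        * ∫ ω, defectSum c z (B ω) ^ (2 * k) * ((res (gram c (B ω)) z 0 0).im
          + (res (gram c (BetaLaguerre.minor (B ω))) z 0 0).im) ∂P := by
  have hn0 : (0 : ℝ) ≤ n := n.cast_nonneg
  have hz0 := hz.ne'
  have hm := hB.minor
  have hmin := continuous_minor (n := n + 1)
  have hmβ : (n + 2) * β ≤ 2 * ((n + 2) * β / (2 * d)) := by
    have : 2 * ((n + 2) * β / (2 * d)) = (n + 2) * β / d := by field_simp
    rw [this, le_div_iff₀ hd]
    have : 0 ≤ (n + 2) * β := by positivity
    nlinarith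
  have i1 := hB.integral_norm_cornerDefect_pow_le hβ (by push_cast; nlinarith) hc hz k
  have i2 := hm.integral_norm_cornerDefect_pow_le hβ (by nlinarith) hc hz k
  -- continuity and boundedness of all the integrands
  have cu : Continuous fun M : Matrix (Fin (n + 2)) (Fin (n + 2)) ℝ => (res (gram c M) z 0 0).im :=
    Complex.continuous_im.comp (IsBoundedCont.res_gram c hz0 0 0).1
  have cg : Continuous fun M : Matrix (Fin (n + 2)) (Fin (n + 2)) ℝ =>
      (res (gram c (BetaLaguerre.minor M)) z 0 0).im :=
    (Complex.continuous_im.comp (IsBoundedCont.res_gram c hz0 0 0).1).comp hmin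
  have bu : ∀ M : Matrix (Fin (n + 2)) (Fin (n + 2)) ℝ,
      (res (gram c M) z 0 0).im ≤ |z.im|⁻¹ := fun M =>
    (le_abs_self _).trans ((Complex.abs_im_le_norm _).trans
      (norm_res_diag_le (gram_isSymm c M) hz0 0))
  have bg : ∀ M : Matrix (Fin (n + 2)) (Fin (n + 2)) ℝ,
      (res (gram c (BetaLaguerre.minor M)) z 0 0).im ≤ |z.im|⁻¹ := fun M =>
    (le_abs_self _).trans ((Complex.abs_im_le_norm _).trans
      (norm_res_diag_le (gram_isSymm c _) hz0 0))
  have pu : ∀ M : Matrix (Fin (n + 2)) (Fin (n + 2)) ℝ, 0 ≤ (res (gram c M) z 0 0).im := fun M =>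
    res_diag_im_nonneg (gram_isSymm c M) hz 0
  have pg : ∀ M : Matrix (Fin (n + 2)) (Fin (n + 2)) ℝ,
      0 ≤ (res (gram c (BetaLaguerre.minor M)) z 0 0).im :=
    fun M => res_diag_im_nonneg (gram_isSymm c _) hz 0
  set Y : Matrix (Fin (n + 2)) (Fin (n + 2)) ℝ → ℝ := fun M => ‖cornerDefect c z M‖ with hY
  set Y' : Matrix (Fin (n + 2)) (Fin (n + 2)) ℝ → ℝ := fun M =>
    ‖cornerDefect c z (BetaLaguerre.minor M)‖ with hY'
  have cY : Continuous Y := (isBoundedCont_cornerDefect (n := n + 1) c hz0).1.norm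
  have cY' : Continuous Y' := ((isBoundedCont_cornerDefect (n := n) c hz0).1.comp hmin).norm
  have pY : ∀ M, 0 ≤ Y M := fun M => norm_nonneg _
  have pY' : ∀ M, 0 ≤ Y' M := fun M => norm_nonneg _
  have hZe : ∀ M, defectSum c z M = Y M / (n + 2) + Y' M / (n + 1) := fun M => rfl
  have hZY : ∀ M, Y M / (n + 2) ≤ defectSum c z M := fun M => by
    rw [hZe]; exact le_add_of_nonneg_right (div_nonneg (pY' M) (by positivity))
  have hZY' : ∀ M, Y' M / (n + 1) ≤ defectSum c z M := fun M => by
    rw [hZe]; exact le_add_of_nonneg_left (div_nonneg (pY M) (by positivity))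
  have bZ : ∀ M : Matrix (Fin (n + 2)) (Fin (n + 2)) ℝ, defectSum c z M ≤ 4 * |z.im|⁻¹ :=
    defectSum_le c hz0
  have cZ := continuous_defectSum (n := n) c hz0
  have pZ : ∀ M : Matrix (Fin (n + 2)) (Fin (n + 2)) ℝ, 0 ≤ defectSum c z M := defectSum_nonneg c z
  have J1 : ∀ l : ℕ, Integrable (fun ω => defectSum c z (B ω) ^ l) P := fun l =>
    hB.integrable_comp_of_bound (f := fun M => defectSum c z M ^ l) (cZ.pow l)
      (C := (4 * |z.im|⁻¹) ^ l) fun M => by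
      rw [Real.norm_of_nonneg (pow_nonneg (pZ M) _)]
      exact pow_le_pow_left₀ (pZ M) (bZ M) _
  have J2 : Integrable (fun ω => defectSum c z (B ω) ^ (2 * k) * (res (gram c (B ω)) z 0 0).im) P :=
    hB.integrable_comp_of_bound
      (f := fun M => defectSum c z M ^ (2 * k) * (res (gram c M) z 0 0).im)
      ((cZ.pow _).mul cu) (C := (4 * |z.im|⁻¹) ^ (2 * k) * |z.im|⁻¹)
      fun M => by
        rw [Real.norm_of_nonneg (mul_nonneg (pow_nonneg (pZ M) _) (pu M))]
        exact mul_le_mul (pow_le_pow_left₀ (pZ M) (bZ M) _) (bu M) (pu M) (by positivity)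
  have J3 : Integrable (fun ω => defectSum c z (B ω) ^ (2 * k)
      * (res (gram c (BetaLaguerre.minor (B ω))) z 0 0).im) P :=
    hB.integrable_comp_of_bound
      (f := fun M => defectSum c z M ^ (2 * k) * (res (gram c (BetaLaguerre.minor M)) z 0 0).im)
      ((cZ.pow _).mul cg) (C := (4 * |z.im|⁻¹) ^ (2 * k) * |z.im|⁻¹)
      fun M => by
        rw [Real.norm_of_nonneg (mul_nonneg (pow_nonneg (pZ M) _) (pg M))]
        exact mul_le_mul (pow_le_pow_left₀ (pZ M) (bZ M) _) (bg M) (pg M) (by positivity)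
  have J4 : Integrable (fun ω => (Y (B ω) / (n + 2)) ^ (2 * k + 2)) P :=
    hB.integrable_comp_of_bound (f := fun M => (Y M / (n + 2)) ^ (2 * k + 2))
      ((cY.div_const _).pow _) (C := (4 * |z.im|⁻¹) ^ (2 * k + 2)) fun M => by
        have := pY M
        rw [Real.norm_of_nonneg (by positivity)]
        exact pow_le_pow_left₀ (by positivity) ((hZY M).trans (bZ M)) _
  have J5 : Integrable (fun ω => (Y' (B ω) / (n + 1)) ^ (2 * k + 2)) P :=
    hB.integrable_comp_of_bound (f := fun M => (Y' M / (n + 1)) ^ (2 * k + 2))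
      ((cY'.div_const _).pow _) (C := (4 * |z.im|⁻¹) ^ (2 * k + 2)) fun M => by
        have := pY' M
        rw [Real.norm_of_nonneg (by positivity)]
        exact pow_le_pow_left₀ (by positivity) ((hZY' M).trans (bZ M)) _
  -- the moment bounds, normalized
  have k1 : ∫ ω, (Y (B ω) / (n + 2)) ^ (2 * k + 2) ∂P
      ≤ 2 * (2 * k + 1) * (2 / β) / ((n + 2) * z.im)
        * ∫ ω, defectSum c z (B ω) ^ (2 * k) * (res (gram c (B ω)) z 0 0).im ∂P := by
    have e1 : ∫ ω, (Y (B ω) / (n + 2)) ^ (2 * k + 2) ∂P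
        = (∫ ω, Y (B ω) ^ (2 * k + 2) ∂P) / (n + 2) ^ (2 * k + 2) := by
      rw [← integral_div]; simp only [div_pow]
    have e2 : (∫ ω, Y (B ω) ^ (2 * k) * (res (gram c (B ω)) z 0 0).im ∂P) / (n + 2) ^ (2 * k)
        ≤ ∫ ω, defectSum c z (B ω) ^ (2 * k) * (res (gram c (B ω)) z 0 0).im ∂P := by
      rw [← integral_div]
      refine integral_mono_of_nonneg (Filter.Eventually.of_forall fun ω => ?_) J2
        (Filter.Eventually.of_forall fun ω => ?_)
      · have := pY (B ω); have := pu (B ω); dsimp only [Pi.zero_apply]; positivity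
      · have h1 := hZY (B ω)
        have := pY (B ω); have := pu (B ω)
        dsimp only
        rw [mul_div_right_comm, ← div_pow]
        gcongr
    have hI0 : 0 ≤ ∫ ω, defectSum c z (B ω) ^ (2 * k) * (res (gram c (B ω)) z 0 0).im ∂P :=
      integral_nonneg fun ω => mul_nonneg (pow_nonneg (pZ _) _) (pu _)
    rw [e1]
    have i1' : (∫ ω, Y (B ω) ^ (2 * k + 2) ∂P) / (n + 2) ^ (2 * k + 2)
        ≤ 2 / β * ((2 * k + 1) / ((n + 2) * z.im)) *
          ((∫ ω, Y (B ω) ^ (2 * k) * (res (gram c (B ω)) z 0 0).im ∂P) / (n + 2) ^ (2 * k)) := by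
      rw [div_le_iff₀ (by positivity)]
      refine i1.trans (le_of_eq ?_)
      simp only [hY]
      push_cast
      field_simp
      ring
    refine i1'.trans ((mul_le_mul_of_nonneg_left e2 (by positivity)).trans ?_)
    gcongr ?_ * _
    rw [mul_div_assoc', div_le_div_iff_of_pos_right (by positivity)]
    have : 0 ≤ 2 / β * (2 * k + 1) := by positivity
    nlinarith
  have k2 : ∫ ω, (Y' (B ω) / (n + 1)) ^ (2 * k + 2) ∂P
      ≤ 2 * (2 * k + 1) * (2 / β) / ((n + 2) * z.im)
        * ∫ ω, defectSum c z (B ω) ^ (2 * k)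
          * (res (gram c (BetaLaguerre.minor (B ω))) z 0 0).im ∂P := by
    have e1 : ∫ ω, (Y' (B ω) / (n + 1)) ^ (2 * k + 2) ∂P
        = (∫ ω, Y' (B ω) ^ (2 * k + 2) ∂P) / (n + 1) ^ (2 * k + 2) := by
      rw [← integral_div]; simp only [div_pow]
    have e2 : (∫ ω, Y' (B ω) ^ (2 * k) * (res (gram c (BetaLaguerre.minor (B ω))) z 0 0).im ∂P)
          / (n + 1) ^ (2 * k)
        ≤ ∫ ω, defectSum c z (B ω) ^ (2 * k)
          * (res (gram c (BetaLaguerre.minor (B ω))) z 0 0).im ∂P := by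
      rw [← integral_div]
      refine integral_mono_of_nonneg (Filter.Eventually.of_forall fun ω => ?_) J3
        (Filter.Eventually.of_forall fun ω => ?_)
      · have := pY' (B ω); have := pg (B ω); dsimp only [Pi.zero_apply]; positivity
      · have h1 := hZY' (B ω)
        have := pY' (B ω); have := pg (B ω)
        dsimp only
        rw [mul_div_right_comm, ← div_pow]
        gcongr
    have hI0 : 0 ≤ ∫ ω, defectSum c z (B ω) ^ (2 * k)
        * (res (gram c (BetaLaguerre.minor (B ω))) z 0 0).im ∂P :=
      integral_nonneg fun ω => mul_nonneg (pow_nonneg (pZ _) _) (pg _)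
    rw [e1]
    have i2' : (∫ ω, Y' (B ω) ^ (2 * k + 2) ∂P) / (n + 1) ^ (2 * k + 2)
        ≤ 2 / β * ((2 * k + 1) / ((n + 1) * z.im)) *
          ((∫ ω, Y' (B ω) ^ (2 * k) * (res (gram c (BetaLaguerre.minor (B ω))) z 0 0).im ∂P)
            / (n + 1) ^ (2 * k)) := by
      rw [div_le_iff₀ (by positivity)]
      refine i2.trans (le_of_eq ?_)
      simp only [hY']
      field_simp
      ring
    refine i2'.trans ((mul_le_mul_of_nonneg_left e2 (by positivity)).trans ?_)
    gcongr ?_ * _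
    rw [mul_div_assoc', div_le_div_iff₀ (by positivity) (by positivity)]
    have : 0 ≤ 2 / β * (2 * k + 1) * z.im := by positivity
    nlinarith
  have hpt : ∀ ω, defectSum c z (B ω) ^ (2 * k + 2) ≤ 2 ^ (2 * k + 2)
      * ((Y (B ω) / (n + 2)) ^ (2 * k + 2) + (Y' (B ω) / (n + 1)) ^ (2 * k + 2)) := by
    intro ω
    have a := div_nonneg (pY (B ω)) (by positivity : (0 : ℝ) ≤ n + 2)
    have b := div_nonneg (pY' (B ω)) (by positivity : (0 : ℝ) ≤ n + 1)
    rw [hZe]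
    refine (add_pow_le a b (2 * k + 2)).trans ?_
    gcongr
    · norm_num
    · simp
  calc ∫ ω, defectSum c z (B ω) ^ (2 * k + 2) ∂P
      ≤ ∫ ω, 2 ^ (2 * k + 2) * ((Y (B ω) / (n + 2)) ^ (2 * k + 2)
          + (Y' (B ω) / (n + 1)) ^ (2 * k + 2)) ∂P :=
        integral_mono (J1 _) ((J4.add J5).const_mul _) hpt
    _ = 2 ^ (2 * k + 2) * (∫ ω, (Y (B ω) / (n + 2)) ^ (2 * k + 2) ∂P
          + ∫ ω, (Y' (B ω) / (n + 1)) ^ (2 * k + 2) ∂P) := by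
        rw [integral_const_mul, integral_add J4 J5]
    _ ≤ 2 ^ (2 * k + 2) * (2 * (2 * k + 1) * (2 / β) / ((n + 2) * z.im)
            * (∫ ω, defectSum c z (B ω) ^ (2 * k) * (res (gram c (B ω)) z 0 0).im ∂P)
          + 2 * (2 * k + 1) * (2 / β) / ((n + 2) * z.im)
            * ∫ ω, defectSum c z (B ω) ^ (2 * k)
              * (res (gram c (BetaLaguerre.minor (B ω))) z 0 0).im ∂P) := by gcongr
    _ = _ := by
        simp only [mul_add]
        rw [integral_add J2 J3]
        ring

theorem nullMeasurableSet_cornerEvent_compl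
    (hB : IsBidiagonalModel P β ((n + 2) * β / (2 * d)) B) (c δ : ℝ) :
    NullMeasurableSet {ω | B ω ∉ cornerEvent c d δ} P := by
  have h0 := hB.aemeasurable 0 0
  have h1 := hB.aemeasurable 1 0
  refine NullMeasurableSet.compl (s := {ω | B ω ∈ cornerEvent c d δ}) ?_
  exact (nullMeasurableSet_le (f := fun ω => |c * B ω 0 0 ^ 2 - 1|)
    (by fun_prop) aemeasurable_const).inter
    (nullMeasurableSet_le (f := fun ω => |c * B ω 1 0 ^ 2 - d|) (by fun_prop) aemeasurable_const)

set_option maxHeartbeats 800000 in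
/-- The self-improving moment bound: where the first column is typical, the corner entries are at
most `C (1 + defectSum)`, so that the loop equation bounds the moment of order `2k + 2` by
`1 / N` times lower ones, with `N = (n + 2) Im z`. -/
theorem integral_defectSum_pow_le_of_large [IsProbabilityMeasure P] {κ : ℝ}
    (hB : IsBidiagonalModel P β ((n + 2) * β / (2 * d)) B)
    (hβ : 0 < β) (hd : 0 < d) (hd1 : d ≤ 1) (hκ : 0 < κ) {z : ℂ} (hz : 0 < z.im) (hzκ : κ ≤ z.re)
    (hz6 : ‖z‖ ≤ 6) (hN : 1 ≤ (n + 2) * z.im) (k : ℕ) {A : ℝ}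
    (hA : 2 ^ (2 * k + 3) * (2 * k + 1) * (2 / β) * (8 * (3 + 96 / (κ * d))) ≤ A)
    (hAN : 8 * A ≤ (n + 2) * z.im) :
    ∫ ω, defectSum (d / (β * (n + 2))) z (B ω) ^ (2 * k + 2) ∂P
      ≤ (8 * A / ((n + 2) * z.im)) ^ (k + 1)
        + (4 * z.im⁻¹) ^ (2 * k + 1)
          * P.real {ω | B ω ∉ cornerEvent (d / (β * (n + 2))) d (d / 2)} := by
  have hn0 : (0 : ℝ) ≤ n := n.cast_nonneg
  have hc : 0 < d / (β * ((n : ℝ) + 2)) := by positivity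
  set c := d / (β * ((n : ℝ) + 2))
  have hz0 := hz.ne'
  have hmom := hB.integral_defectSum_pow_le hβ hd hd1 hz hc k
  have hbad := hB.nullMeasurableSet_cornerEvent_compl c (d / 2)
  set bad := {ω | B ω ∉ cornerEvent c d (d / 2)}
  set N := (n + 2) * z.im with hNdef
  have hN0 : 0 < N := by linarith
  set A0 := 2 ^ (2 * k + 3) * (2 * k + 1) * (2 / β) with hA0
  have hA0p : 0 < A0 := by positivity
  have hK : 0 < 96 / (κ * d) := by positivity
  set K := 96 / (κ * d) with hKdef
  set τ := 8 * A / N with hτ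
  have hA0A : 24 * A0 ≤ A := by nlinarith
  have hAp : 0 < A := by linarith
  have hτ0 : 0 < τ := by positivity
  have hτ1 : τ ≤ 1 := by rw [hτ, div_le_one hN0]; exact hAN
  have hθ : A0 / N * (8 * (3 + K)) ≤ τ / 8 := by
    have : τ / 8 = A / N := by rw [hτ]; ring
    rw [this, div_mul_eq_mul_div]
    gcongr
  have hθ' : A0 / N ≤ 1 / 8 := by
    rw [div_le_iff₀ hN0]; linarith
  set Z : Ω → ℝ := fun ω => defectSum c z (B ω) with hZ
  have pZ : ∀ ω, 0 ≤ Z ω := fun ω => defectSum_nonneg c z _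
  have bZ : ∀ ω, Z ω ≤ 4 * z.im⁻¹ := fun ω => by
    have := defectSum_le c hz0 (B ω); rwa [abs_of_pos hz] at this
  have JZ : Integrable (fun ω => Z ω ^ (2 * k + 2)) P :=
    hB.integrable_comp_of_bound (f := fun M => defectSum c z M ^ (2 * k + 2))
      ((continuous_defectSum c hz0).pow _) (C := (4 * |z.im|⁻¹) ^ (2 * k + 2)) fun M => by
      rw [Real.norm_of_nonneg (pow_nonneg (defectSum_nonneg c z M) _)]
      exact pow_le_pow_left₀ (defectSum_nonneg c z M) (defectSum_le c hz0 M) _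
  have hpt : ∀ ω, A0 / N * (Z ω ^ (2 * k) * ((res (gram c (B ω)) z 0 0).im
        + (res (gram c (BetaLaguerre.minor (B ω))) z 0 0).im))
      ≤ 1 / 2 * Z ω ^ (2 * k + 2)
        + (1 / 2 * τ ^ (k + 1)
          + bad.indicator (fun _ => 1 / 2 * (4 * z.im⁻¹) ^ (2 * k + 1)) ω) := by
    intro ω
    have hz2 := pZ ω
    have hz4 := bZ ω
    have u1 := (Complex.abs_im_le_norm _).trans
      (norm_res_diag_le (gram_isSymm c (B ω)) hz0 0)
    have g1 := (Complex.abs_im_le_norm _).trans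
      (norm_res_diag_le (gram_isSymm c (BetaLaguerre.minor (B ω))) hz0 0)
    have u2 := (le_abs_self _).trans (Complex.abs_im_le_norm (res (gram c (B ω)) z 0 0))
    have g2 := (le_abs_self _).trans
      (Complex.abs_im_le_norm (res (gram c (BetaLaguerre.minor (B ω))) z 0 0))
    have u3 := res_diag_im_nonneg (gram_isSymm c (B ω)) hz 0
    have g3 := res_diag_im_nonneg (gram_isSymm c (BetaLaguerre.minor (B ω))) hz 0
    have hh := norm_corner_sub_le (hB.isLowerBidiagonal ω) c hz
    have heq := corner_equation (hB.isLowerBidiagonal ω) c hz0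
    rw [abs_of_nonneg u3, abs_of_pos hz] at u1
    rw [abs_of_nonneg g3, abs_of_pos hz] at g1
    change _ ≤ Z ω + 3 / N at hh
    set u := res (gram c (B ω)) z 0 0
    set g := res (gram c (BetaLaguerre.minor (B ω))) z 0 0
    generalize Z ω = x at *
    have h3N : 3 / N ≤ 3 := by rw [div_le_iff₀ hN0]; linarith
    have hηp : 0 < z.im⁻¹ := inv_pos.2 hz
    by_cases hω : ω ∈ bad
    · rw [Set.indicator_of_mem hω]
      have h1 : A0 / N * (x ^ (2 * k) * (u.im + g.im))
          ≤ 1 / 8 * ((4 * z.im⁻¹) ^ (2 * k) * (z.im⁻¹ + z.im⁻¹)) := by gcongr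
      have h2 : 0 ≤ x ^ (2 * k + 2) := by positivity
      have h3 : 0 ≤ τ ^ (k + 1) := by positivity
      have h4 : 0 ≤ (4 * z.im⁻¹) ^ (2 * k) := by positivity
      rw [pow_succ (4 * z.im⁻¹)]
      nlinarith [mul_nonneg h4 hηp.le]
    · rw [Set.indicator_of_notMem hω, add_zero]
      have hgood : B ω ∈ cornerEvent c d (d / 2) := by simpa [bad] using hω
      have hu := norm_corner_le (u := u) (g := g) hd hd1 hκ hzκ hz6 hgood.1 hgood.2
        (by push_cast; exact heq)
      have hg : ‖g‖ ≤ ‖u‖ + ‖u - g‖ := by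
        have := norm_sub_le u (u - g); simpa using this
      have e48 : 48 / (κ * d) = K / 2 := by rw [hKdef]; ring
      rw [e48] at hu
      have h0 : 0 ≤ ‖u - g‖ := norm_nonneg _
      have h1 : u.im + g.im ≤ (3 + K) * (4 * (1 + x)) := by
        have h3 : u.im + g.im ≤ (3 + K) * (1 + ‖u - g‖) := by linarith
        exact h3.trans (mul_le_mul_of_nonneg_left (by linarith) (by linarith))
      have h2 : A0 / N * (x ^ (2 * k) * (u.im + g.im)) ≤ τ / 16 * ((x ^ 2) ^ k * (1 + x)) := by
        calc _ ≤ A0 / N * (x ^ (2 * k) * ((3 + K) * (4 * (1 + x)))) := by gcongr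
          _ = (A0 / N * (8 * (3 + K))) / 2 * ((x ^ 2) ^ k * (1 + x)) := by rw [pow_mul]; ring
          _ ≤ (τ / 8) / 2 * ((x ^ 2) ^ k * (1 + x)) := by gcongr
          _ = _ := by ring
      refine h2.trans ?_
      exact pow_mul_one_add_le hz2 hτ0 hτ1 k
  have hI : Integrable (bad.indicator (fun _ => 1 / 2 * (4 * z.im⁻¹) ^ (2 * k + 1)) : Ω → ℝ) P :=
    (integrable_const _).indicator₀ hbad
  have hint : A0 / N * ∫ ω, Z ω ^ (2 * k) * ((res (gram c (B ω)) z 0 0).im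
        + (res (gram c (BetaLaguerre.minor (B ω))) z 0 0).im) ∂P
      ≤ ∫ ω, (1 / 2 * Z ω ^ (2 * k + 2) + (1 / 2 * τ ^ (k + 1)
        + bad.indicator (fun _ => 1 / 2 * (4 * z.im⁻¹) ^ (2 * k + 1)) ω)) ∂P := by
    rw [← integral_const_mul]
    refine integral_mono_of_nonneg (Filter.Eventually.of_forall fun ω => ?_)
      ((JZ.const_mul _).add ((integrable_const _).add hI)) (Filter.Eventually.of_forall hpt)
    have u3 := res_diag_im_nonneg (gram_isSymm c (B ω)) hz 0
    have g3 := res_diag_im_nonneg (gram_isSymm c (BetaLaguerre.minor (B ω))) hz 0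
    have := pZ ω
    dsimp only [Pi.zero_apply]
    positivity
  have hsum : ∫ ω, (1 / 2 * Z ω ^ (2 * k + 2) + (1 / 2 * τ ^ (k + 1)
        + bad.indicator (fun _ => 1 / 2 * (4 * z.im⁻¹) ^ (2 * k + 1)) ω)) ∂P
      = 1 / 2 * ∫ ω, Z ω ^ (2 * k + 2) ∂P + (1 / 2 * τ ^ (k + 1)
        + P.real bad * (1 / 2 * (4 * z.im⁻¹) ^ (2 * k + 1))) := by
    have hI' : Integrable (fun ω => 1 / 2 * τ ^ (k + 1)
        + bad.indicator (fun _ => 1 / 2 * (4 * z.im⁻¹) ^ (2 * k + 1)) ω) P :=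
      (integrable_const _).add hI
    rw [integral_add (JZ.const_mul _) hI', integral_const_mul,
      integral_add (integrable_const _) hI, integral_indicator₀ hbad]
    simp
  rw [hsum] at hint
  have := hmom.trans hint
  change ∫ ω, Z ω ^ (2 * k + 2) ∂P ≤ _ at this
  change ∫ ω, Z ω ^ (2 * k + 2) ∂P ≤ _
  linarith

end IsBidiagonalModel

end Moments

/-! ### Tail bounds at a fixed spectral parameter -/

section Tail

/-- Exponential decay beats every power. -/
theorem exp_neg_mul_le {b x : ℝ} (hb : 0 < b) (hx : 0 < x) (q : ℕ) :
    Real.exp (-(b * x)) ≤ q.factorial / b ^ q / x ^ q := by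
  have h := Real.pow_div_factorial_le_exp (b * x) (by positivity) q
  rw [Real.exp_neg, div_div, ← mul_pow, ← inv_div]
  exact inv_anti₀ (by positivity) h

theorem one_le_div_pow {M x : ℝ} (hx : 0 < x) (hM : x ≤ M) (r : ℕ) : 1 ≤ M ^ r / x ^ r := by
  rw [← div_pow]
  exact one_le_pow₀ ((one_le_div hx).2 hM)

theorem exists_measureReal_cornerEvent_compl_le {β d δ : ℝ} (hβ : 0 < β) (hd : 0 < d)
    (hd1 : d ≤ 1) (hδ : 0 < δ) (hδ1 : δ ≤ 1) (r : ℕ) :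
    ∃ C : ℝ, 0 ≤ C ∧ ∀ (n : ℕ) (Ω : Type u) [MeasurableSpace Ω] (P : Measure Ω)
      [IsProbabilityMeasure P] (B : Ω → Matrix (Fin (n + 2)) (Fin (n + 2)) ℝ),
      IsBidiagonalModel P β ((n + 2) * β / (2 * d)) B →
      P.real {ω | B ω ∉ cornerEvent (d / (β * (n + 2))) d δ} ≤ C / (n + 2) ^ r := by
  set b := δ ^ 2 * β / 128 with hb
  have hb0 : 0 < b := by positivity
  refine ⟨(2 / δ) ^ r + 4 * (r.factorial / b ^ r), by positivity, fun n Ω _ P _ B hB => ?_⟩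
  rw [add_div]
  rcases le_or_gt (2 / δ) (n + 2) with hn | hn
  · refine (hB.measureReal_cornerEvent_compl_le hβ hd hd1 hδ hδ1 hn).trans ?_
    have h := exp_neg_mul_le hb0 (by positivity : (0 : ℝ) < n + 2) r
    have h0 : 0 ≤ (2 / δ) ^ r / ((n : ℝ) + 2) ^ r := by positivity
    rw [← hb, mul_div_assoc (4 : ℝ)]
    linarith
  · refine measureReal_le_one.trans ((one_le_div_pow (by positivity) hn.le r).trans ?_)
    exact le_add_of_nonneg_right (by positivity)

/-- The corner defects are small with overwhelming probability, uniformly in the spectral parameter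
as long as its imaginary part is at least `(n + 2) ^ (-1 + ε)`. The order `2k + 2` of the moment is
chosen so that `((n + 2) ^ ε) ^ (k + 1) ≥ (n + 2) ^ r`. -/
theorem exists_measureReal_defectSum_ge_le {β d ε κ δ : ℝ} (hβ : 0 < β) (hd : 0 < d) (hd1 : d ≤ 1)
    (hε : 0 < ε) (hκ : 0 < κ) (hδ : 0 < δ) (r : ℕ) :
    ∃ C : ℝ, 0 ≤ C ∧ ∀ (n : ℕ) (Ω : Type u) [MeasurableSpace Ω] (P : Measure Ω)
      [IsProbabilityMeasure P] (B : Ω → Matrix (Fin (n + 2)) (Fin (n + 2)) ℝ),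
      IsBidiagonalModel P β ((n + 2) * β / (2 * d)) B →
      ∀ z : ℂ, κ ≤ z.re → ‖z‖ ≤ 6 → ((n : ℝ) + 2) ^ (-1 + ε) ≤ z.im →
      P.real {ω | δ ≤ defectSum (d / (β * (n + 2))) z (B ω)} ≤ C / (n + 2) ^ r := by
  set k := ⌈(r : ℝ) / ε⌉₊ with hk
  set A := 2 ^ (2 * k + 3) * (2 * k + 1) * (2 / β) * (8 * (3 + 96 / (κ * d))) with hA
  have hA0 : 0 < A := by positivity
  obtain ⟨C0, hC0, hcorner⟩ := exists_measureReal_cornerEvent_compl_le.{u} hβ hd hd1 (half_pos hd)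
    (by linarith) (2 * k + 1 + r)
  -- the first summand makes the bound trivial as long as `(n + 2) ^ ε < 8 * A`
  refine ⟨((8 * A) ^ (1 / ε)) ^ r
    + ((8 * A) ^ (k + 1) + 4 ^ (2 * k + 1) * C0) / δ ^ (2 * k + 2), by positivity,
    fun n Ω _ P _ B hB z hzκ hz6 hzi => ?_⟩
  have hm0 : (0 : ℝ) < n + 2 := by positivity
  have hm1 : (1 : ℝ) ≤ n + 2 := by linarith [(n.cast_nonneg : (0 : ℝ) ≤ n)]
  have hcor := hcorner n Ω P B hB
  set m : ℝ := n + 2 with hm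
  have hz : 0 < z.im := (Real.rpow_pos_of_pos hm0 _).trans_le hzi
  have hmN : m ^ ε ≤ m * z.im := by
    calc m ^ ε = m * m ^ (-1 + ε) := by
          rw [Real.rpow_add hm0, Real.rpow_neg_one]; field_simp
      _ ≤ _ := by gcongr
  have hmε : 1 ≤ m ^ ε := Real.one_le_rpow hm1 hε.le
  have hinv : z.im⁻¹ ≤ m := by
    rw [inv_le_iff_one_le_mul₀ hz]
    exact hmε.trans hmN
  rw [add_div]
  rcases le_or_gt (8 * A) (m ^ ε) with h8 | h8
  · refine le_trans ?_ (le_add_of_nonneg_left (by positivity))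
    have hmom := hB.integral_defectSum_pow_le_of_large hβ hd hd1 hκ hz hzκ hz6 (hmε.trans hmN) k
      le_rfl (h8.trans hmN)
    rw [← hm] at hmom
    set c := d / (β * m)
    have hJ : Integrable (fun ω => defectSum c z (B ω) ^ (2 * k + 2)) P :=
      hB.integrable_comp_of_bound (f := fun M => defectSum c z M ^ (2 * k + 2))
        ((continuous_defectSum c hz.ne').pow _) (C := (4 * |z.im|⁻¹) ^ (2 * k + 2)) fun M => by
        rw [Real.norm_of_nonneg (pow_nonneg (defectSum_nonneg c z M) _)]
        exact pow_le_pow_left₀ (defectSum_nonneg c z M) (defectSum_le c hz.ne' M) _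
    have hmarkov := mul_meas_ge_le_integral_of_nonneg
      (Filter.Eventually.of_forall fun ω => pow_nonneg (defectSum_nonneg c z (B ω)) _) hJ
      (δ ^ (2 * k + 2))
    have hset : P.real {ω | δ ≤ defectSum c z (B ω)}
        ≤ P.real {ω | δ ^ (2 * k + 2) ≤ defectSum c z (B ω) ^ (2 * k + 2)} :=
      measureReal_mono fun ω (hω : δ ≤ _) => pow_le_pow_left₀ hδ.le hω _
    have hkr : m ^ r ≤ (m * z.im) ^ (k + 1) := by
      calc m ^ r = m ^ (r : ℝ) := (Real.rpow_natCast m r).symm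
        _ ≤ m ^ (ε * ((k + 1 : ℕ) : ℝ)) := by
            refine Real.rpow_le_rpow_of_exponent_le hm1 ?_
            have := Nat.le_ceil ((r : ℝ) / ε)
            rw [div_le_iff₀ hε, ← hk] at this
            push_cast
            nlinarith
        _ = (m ^ ε) ^ (k + 1) := by rw [Real.rpow_mul hm0.le, Real.rpow_natCast]
        _ ≤ _ := by gcongr
    have t1 : (8 * A / (m * z.im)) ^ (k + 1) ≤ (8 * A) ^ (k + 1) / m ^ r := by
      rw [div_pow]; gcongr
    have t2 : (4 * z.im⁻¹) ^ (2 * k + 1) * P.real {ω | B ω ∉ cornerEvent c d (d / 2)}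
        ≤ 4 ^ (2 * k + 1) * C0 / m ^ r := by
      calc _ ≤ (4 * m) ^ (2 * k + 1) * (C0 / m ^ (2 * k + 1 + r)) := by gcongr
        _ = 4 ^ (2 * k + 1) * C0 / m ^ r := by
            rw [mul_pow, pow_add m (2 * k + 1) r]; field_simp
    rw [div_div, mul_comm (δ ^ _), ← div_div, le_div_iff₀ (by positivity), add_div, mul_comm]
    calc _ ≤ _ := mul_le_mul_of_nonneg_left hset (by positivity)
      _ ≤ _ := hmarkov
      _ ≤ _ := hmom
      _ ≤ _ := add_le_add t1 t2
  · refine measureReal_le_one.trans (le_trans ?_ (le_add_of_nonneg_right (by positivity)))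
    refine one_le_div_pow hm0 ?_ r
    calc m = (m ^ ε) ^ (1 / ε) := by
          rw [← Real.rpow_mul hm0.le, mul_one_div_cancel hε.ne', Real.rpow_one]
      _ ≤ _ := by gcongr

end Tail

/-! ### The net argument -/

section Net

/-- The points of the grid `(L⁻¹ ℕ)²` in the first quadrant of `ℂ`. -/
noncomputable def gridPoint (L : ℕ) (p : ℕ × ℕ) : ℂ := ⟨p.1 / L, p.2 / L⟩

/-- Rounding up to the grid increases the real and imaginary parts, so it does not leave the region
where the tail bound applies. -/
theorem exists_gridPoint_near {L : ℕ} (hL : 1 ≤ L) {z : ℂ} (hr : 0 ≤ z.re) (hi : 0 ≤ z.im)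
    (hz : ‖z‖ ≤ 4) :
    ∃ p ∈ Finset.range (4 * L + 1) ×ˢ Finset.range (4 * L + 1),
      z.re ≤ (gridPoint L p).re ∧ z.im ≤ (gridPoint L p).im ∧ ‖z - gridPoint L p‖ ≤ 2 / L := by
  have hL0 : (0 : ℝ) < L := by exact_mod_cast hL
  have key : ∀ x : ℝ, 0 ≤ x → x ≤ 4 → ⌈L * x⌉₊ < 4 * L + 1 ∧ x ≤ ⌈L * x⌉₊ / (L : ℝ)
      ∧ |x - ⌈L * x⌉₊ / (L : ℝ)| ≤ 1 / L := by
    intro x hx hx4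
    have h1 : L * x ≤ ⌈L * x⌉₊ := Nat.le_ceil _
    have h2 : (⌈L * x⌉₊ : ℝ) < L * x + 1 := Nat.ceil_lt_add_one (by positivity)
    refine ⟨Nat.lt_succ_of_le (Nat.ceil_le.2 ?_), ?_, ?_⟩
    · push_cast; nlinarith
    · rw [le_div_iff₀ hL0]; linarith
    · have e : x - ⌈L * x⌉₊ / (L : ℝ) = (L * x - ⌈L * x⌉₊) / L := by field_simp
      rw [e, abs_div, abs_of_pos hL0]
      gcongr
      rw [abs_le]; constructor <;> linarith
  have a := key z.re hr ((le_abs_self _).trans ((Complex.abs_re_le_norm z).trans hz))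
  have b := key z.im hi ((le_abs_self _).trans ((Complex.abs_im_le_norm z).trans hz))
  refine ⟨(⌈L * z.re⌉₊, ⌈L * z.im⌉₊),
    Finset.mem_product.2 ⟨Finset.mem_range.2 a.1, Finset.mem_range.2 b.1⟩,
    a.2.1, b.2.1, ?_⟩
  refine (Complex.norm_le_abs_re_add_abs_im _).trans ?_
  simp only [Complex.sub_re, Complex.sub_im, gridPoint]
  calc _ ≤ 1 / (L : ℝ) + 1 / L := add_le_add a.2.2 b.2.2
    _ = _ := by ring

open Classical in
/-- The points of the grid in the region where the tail bound is available. -/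
noncomputable def net (κ η : ℝ) (L : ℕ) : Finset (ℕ × ℕ) :=
  (Finset.range (4 * L + 1) ×ˢ Finset.range (4 * L + 1)).filter fun p =>
    κ ≤ (gridPoint L p).re ∧ ‖gridPoint L p‖ ≤ 6 ∧ η ≤ (gridPoint L p).im

theorem card_net_le (κ η : ℝ) (L : ℕ) : (net κ η L).card ≤ (4 * L + 1) ^ 2 := by
  unfold net
  refine (Finset.card_filter_le _ _).trans ?_
  simp [sq]

/-- On the complement of finitely many bad events, the Stieltjes transform is close to the
Marchenko–Pastur transform on the whole domain. The mesh `(n + 2) ^ (-3)` compensates the Lipschitz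
constant `O((n + 2) ^ 2)`. -/
theorem norm_stieltjes_sub_le_of_net {β d ε κ δ : ℝ} (hβ : 0 < β) (hd : 0 < d) (hd1 : d ≤ 1)
    (hε : 0 < ε) (hκ : 0 < κ) {n : ℕ} {B : Matrix (Fin (n + 2)) (Fin (n + 2)) ℝ}
    (hB : IsLowerBidiagonal B) (hδ : 0 < δ) (hδd : δ ≤ d / 2)
    (hn1 : 24 / δ ≤ n + 2) (hn2 : 9 / δ ≤ ((n : ℝ) + 2) ^ ε)
    (hc : B ∈ cornerEvent (d / (β * (n + 2))) d δ)
    (hnet : ∀ p ∈ net κ (((n : ℝ) + 2) ^ (-1 + ε)) ((n + 2) ^ 3),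
      defectSum (d / (β * (n + 2))) (gridPoint ((n + 2) ^ 3) p) B < δ / 3)
    {z : ℂ} (hz : z ∈ domain d ε κ (n + 2)) :
    ‖stieltjes (laguerreMatrix β d B) z - stieltjesMP d z‖
      ≤ δ + selfConsistentConst d κ * δ / (√d * √(κ / 2)) := by
  obtain ⟨hzi, hz1, hz2, hz4⟩ := hz
  push_cast at hzi
  have hm0 : (0 : ℝ) < n + 2 := by positivity
  have hm1 : (1 : ℝ) ≤ n + 2 := by linarith [(n.cast_nonneg : (0 : ℝ) ≤ n)]
  have hL1 : 1 ≤ (n + 2) ^ 3 := Nat.one_le_pow _ _ (by omega)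
  have hLm : (((n + 2) ^ 3 : ℕ) : ℝ) = (n + 2) ^ 3 := by push_cast; rfl
  set L := (n + 2) ^ 3
  set m : ℝ := n + 2 with hm
  have hz : 0 < z.im := (Real.rpow_pos_of_pos hm0 _).trans hzi
  have hmN : m ^ ε ≤ m * z.im := by
    calc m ^ ε = m * m ^ (-1 + ε) := by
          rw [Real.rpow_add hm0, Real.rpow_neg_one]; field_simp
      _ ≤ _ := by gcongr
  have hmε : 1 ≤ m ^ ε := Real.one_le_rpow hm1 hε.le
  have hinv : z.im⁻¹ ≤ m := by
    rw [inv_le_iff_one_le_mul₀ hz]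
    exact hmε.trans hmN
  have hzκ : κ ≤ z.re := by
    have : 0 ≤ lambdaMinus d := sq_nonneg _
    linarith
  obtain ⟨p, hp, hre, him, hdist⟩ := exists_gridPoint_near hL1 (hκ.le.trans hzκ) hz.le hz4
  rw [hLm] at hdist
  set w := gridPoint L p with hw
  have hw0 : 0 < w.im := hz.trans_le him
  have hwinv : w.im⁻¹ ≤ m := (inv_anti₀ hz him).trans hinv
  have hdist2 : ‖z - w‖ ≤ 2 := by
    refine hdist.trans (div_le_self (by norm_num) (one_le_pow₀ hm1))
  have hw6 : ‖w‖ ≤ 6 := by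
    have := norm_sub_le z (z - w)
    rw [sub_sub_cancel] at this
    linarith
  have hpn : p ∈ net κ (m ^ (-1 + ε)) L :=
    Finset.mem_filter.2 ⟨hp, hzκ.trans hre, hw6, hzi.le.trans him⟩
  have h1 := defectSum_le_add (d / (β * m)) hz.ne' hw0.ne' B
  rw [abs_of_pos hz, abs_of_pos hw0] at h1
  have h2 : 4 * (‖z - w‖ * (z.im⁻¹ * w.im⁻¹)) ≤ δ / 3 := by
    calc _ ≤ 4 * (2 / m ^ 3 * (m * m)) := by gcongr
      _ = 8 / m := by field_simp; norm_num
      _ ≤ _ := by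
          rw [div_le_iff₀ hδ] at hn1
          rw [div_le_iff₀ hm0]; linarith
  have h3 : 3 / (m * z.im) ≤ δ / 3 := by
    rw [div_le_iff₀ hδ] at hn2
    rw [div_le_iff₀ (by positivity)]
    nlinarith
  have h4 := hnet p hpn
  exact norm_stieltjes_sub_le hd hd1 hκ hB hβ hz hz1 hz2 (hz4.trans (by norm_num)) hδd hc.1 hc.2
    (by rw [← hm]; linarith)

/-- The union bound over the net: it has `O((n + 2) ^ 6)` points, which costs six powers of
`n + 2`. -/
theorem exists_measure_domain_le {β d ε κ c : ℝ} (hβ : 0 < β) (hd : 0 < d) (hd1 : d ≤ 1)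
    (hε : 0 < ε) (hκ : 0 < κ) (hc : 0 < c) (r : ℕ) :
    ∃ C : ℝ, 0 ≤ C ∧ ∀ (n : ℕ) (Ω : Type u) [MeasurableSpace Ω] (P : Measure Ω)
      [IsProbabilityMeasure P] (B : Ω → Matrix (Fin (n + 2)) (Fin (n + 2)) ℝ),
      IsBidiagonalModel P β ((n + 2) * β / (2 * d)) B →
      P.real {ω | ¬ ∀ z ∈ domain d ε κ (n + 2),
        ‖stieltjes (laguerreMatrix β d (B ω)) z - stieltjesMP d z‖ ≤ c} ≤ C / (n + 2) ^ r := by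
  set K1 := selfConsistentConst d κ / (√d * √(κ / 2)) with hK1
  have hK0 : 0 ≤ K1 := div_nonneg (selfConsistentConst_nonneg hd hκ) (by positivity)
  set δ := min (d / 2) (c / (1 + K1)) with hδ
  have hδ0 : 0 < δ := lt_min (by positivity) (by positivity)
  have hδd : δ ≤ d / 2 := min_le_left _ _
  have hδc : δ + K1 * δ ≤ c := by
    have : δ ≤ c / (1 + K1) := min_le_right _ _
    rw [le_div_iff₀ (by positivity)] at this
    linarith
  obtain ⟨C1, hC1, hcorner⟩ := exists_measureReal_cornerEvent_compl_le.{u} hβ hd hd1 hδ0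
    (by linarith) r
  obtain ⟨C2, hC2, hdef⟩ := exists_measureReal_defectSum_ge_le.{u} hβ hd hd1 hε hκ
    (by positivity : 0 < δ / 3) (r + 6)
  -- the first two summands make the bound trivial for small `n`
  refine ⟨(24 / δ) ^ r + ((9 / δ) ^ (1 / ε)) ^ r + (C1 + 25 * C2), by positivity,
    fun n Ω _ P _ B hB => ?_⟩
  have hm0 : (0 : ℝ) < n + 2 := by positivity
  have hm1 : (1 : ℝ) ≤ n + 2 := by linarith [(n.cast_nonneg : (0 : ℝ) ≤ n)]
  rw [add_div, add_div]
  rcases lt_or_ge ((n : ℝ) + 2) (24 / δ) with h1 | h1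
  · refine measureReal_le_one.trans ((one_le_div_pow hm0 h1.le r).trans ?_)
    rw [add_assoc]
    exact le_add_of_nonneg_right (by positivity)
  rcases lt_or_ge (((n : ℝ) + 2) ^ ε) (9 / δ) with h2 | h2
  · have hle : (n : ℝ) + 2 ≤ (9 / δ) ^ (1 / ε) := by
      calc (n : ℝ) + 2 = (((n : ℝ) + 2) ^ ε) ^ (1 / ε) := by
            rw [← Real.rpow_mul hm0.le, mul_one_div_cancel hε.ne', Real.rpow_one]
        _ ≤ _ := by gcongr
    refine measureReal_le_one.trans ((one_le_div_pow hm0 hle r).trans ?_)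
    rw [add_right_comm]
    exact le_add_of_nonneg_left (by positivity)
  refine le_trans ?_ (le_add_of_nonneg_left (by positivity))
  set η := ((n : ℝ) + 2) ^ (-1 + ε) with hη
  set T := net κ η ((n + 2) ^ 3) with hT
  set cc := d / (β * ((n : ℝ) + 2)) with hcc
  have hsub : {ω | ¬ ∀ z ∈ domain d ε κ (n + 2),
        ‖stieltjes (laguerreMatrix β d (B ω)) z - stieltjesMP d z‖ ≤ c}
      ⊆ {ω | B ω ∉ cornerEvent cc d δ}
        ∪ ⋃ p ∈ T, {ω | δ / 3 ≤ defectSum cc (gridPoint ((n + 2) ^ 3) p) (B ω)} := by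
    intro ω hω
    by_contra hcon
    simp only [Set.mem_union, Set.mem_iUnion, Set.mem_ofPred_eq, not_or, not_not, not_exists,
      not_le] at hcon
    refine hω fun z hz => ?_
    refine (norm_stieltjes_sub_le_of_net hβ hd hd1 hε hκ (hB.isLowerBidiagonal ω) hδ0 hδd h1 h2
      hcon.1 hcon.2 hz).trans ?_
    rw [mul_div_right_comm]
    exact hδc
  have hpt : ∀ p ∈ T, P.real {ω | δ / 3 ≤ defectSum cc (gridPoint ((n + 2) ^ 3) p) (B ω)}
      ≤ C2 / ((n : ℝ) + 2) ^ (r + 6) := fun p hp => by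
    obtain ⟨-, a1, a2, a3⟩ := Finset.mem_filter.1 hp
    exact hdef n Ω P B hB _ a1 a2 a3
  have hcard : (T.card : ℝ) ≤ 25 * ((n : ℝ) + 2) ^ 6 := by
    have h := card_net_le κ η ((n + 2) ^ 3)
    have h' : (T.card : ℝ) ≤ (4 * ((n : ℝ) + 2) ^ 3 + 1) ^ 2 := by exact_mod_cast h
    have h3 : 1 ≤ ((n : ℝ) + 2) ^ 3 := one_le_pow₀ hm1
    calc _ ≤ _ := h'
      _ ≤ (5 * ((n : ℝ) + 2) ^ 3) ^ 2 := by gcongr; linarith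
      _ = _ := by ring
  calc _ ≤ _ := measureReal_mono hsub
    _ ≤ _ := measureReal_union_le _ _
    _ ≤ C1 / ((n : ℝ) + 2) ^ r + ∑ p ∈ T, C2 / ((n : ℝ) + 2) ^ (r + 6) :=
        add_le_add (hcorner n Ω P B hB)
          ((measureReal_biUnion_finset_le _ _).trans (Finset.sum_le_sum hpt))
    _ ≤ C1 / ((n : ℝ) + 2) ^ r + 25 * ((n : ℝ) + 2) ^ 6 * (C2 / ((n : ℝ) + 2) ^ (r + 6)) := by
        rw [Finset.sum_const, nsmul_eq_mul]; gcongr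
    _ = _ := by rw [pow_add]; field_simp

end Net

end BetaLaguerre

theorem theorem2 (β d ε κ : ℝ) (hβ : 0 < β) (hd : 0 < d) (hd1 : d ≤ 1) (hε : 0 < ε) (hκ : 0 < κ)
    {Ω : ℕ → Type*} [∀ m, MeasurableSpace (Ω m)]
    (P : ∀ m, Measure (Ω m)) [∀ m, IsProbabilityMeasure (P m)]
    (B : ∀ m, Ω m → Matrix (Fin m) (Fin m) ℝ)
    (hB : ∀ m : ℕ, BetaLaguerre.IsBidiagonalModel (P m) β (m * β / (2 * d)) (B m)) :
    BetaLaguerre.IsLittleOOneWOP P fun m ω =>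
      ⨆ z ∈ BetaLaguerre.domain d ε κ m,
        ‖BetaLaguerre.stieltjes (BetaLaguerre.laguerreMatrix β d (B m ω)) z
          - BetaLaguerre.stieltjesMP d z‖ₑ := by
  intro c hc r
  obtain ⟨C, hC, h⟩ := BetaLaguerre.exists_measure_domain_le hβ hd hd1 hε hκ hc r
  refine ⟨C + 1, fun m hm => ?_⟩
  obtain rfl | ⟨n, rfl⟩ : m = 1 ∨ ∃ n, m = n + 2 := by
    rcases hm.eq_or_lt with h | h
    · exact Or.inl h.symm
    · exact Or.inr ⟨m - 2, by omega⟩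
  · refine prob_le_one.trans ?_
    rw [Nat.cast_one, one_pow, div_one, ENNReal.one_le_ofReal]
    linarith
  · have hB' := hB (n + 2)
    push_cast at hB'
    have hn := h n (Ω (n + 2)) (P (n + 2)) (B (n + 2)) hB'
    have hsub : {ω | ⨆ z ∈ BetaLaguerre.domain d ε κ (n + 2),
        ‖BetaLaguerre.stieltjes (BetaLaguerre.laguerreMatrix β d (B (n + 2) ω)) z
          - BetaLaguerre.stieltjesMP d z‖ₑ ≤ ENNReal.ofReal c}ᶜ
        ⊆ {ω | ¬ ∀ z ∈ BetaLaguerre.domain d ε κ (n + 2),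
        ‖BetaLaguerre.stieltjes (BetaLaguerre.laguerreMatrix β d (B (n + 2) ω)) z
          - BetaLaguerre.stieltjesMP d z‖ ≤ c} := by
      intro ω hω hall
      refine hω (Set.mem_ofPred_eq ▸ iSup₂_le fun z hz => ?_)
      rw [← ofReal_norm]
      exact ENNReal.ofReal_le_ofReal (hall z hz)
    refine (measure_mono hsub).trans ?_
    rw [← ofReal_measureReal (measure_ne_top _ _)]
    refine ENNReal.ofReal_le_ofReal (hn.trans ?_)
    push_cast
    gcongr
    linarith
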